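/- Let $q\ge 3$, $\lambda=2\cos(\pi/q)$, and let $G_q$ be the Hecke triangle group generated by $S:z\mapsto -1/z$ and $T:z\mapsto z+\lambda$, acting on the upper half-plane $\mathbb H$ and on $\mathbb R\cup\{\infty\}$. Put $h=\frac{q-2}2$, $\kappa=h$ if $q$ is even and $h=\frac{q-3}2$, $\kappa=2h+1$ if $q$ is odd, and $\mathbb R^\infty=\mathbb R\setminus G_q(\infty)$. An oriented geodesic $\gamma$ on $\mathbb H$ is identified with its pair of forward and backward endpoints $\gamma_+\neq\gamma_-$ in $\mathbb R\cup\{\infty\}$. *$\lambda$-fractions.* For integers $a_0$ and $a_j\ne 0$ ($j\ge1$), the $\lambda$-fraction $\langle a_0;a_1,\dots,a_n\rangle$ has the value $T^{a_0}ST^{a_1}\cdots ST^{a_n}(0)$, and $\langle a_0;a_1,a_2,\dots\rangle$ has the value $\lim_n T^{a_0}ST^{a_1}\cdots ST^{a_n}(0)$ if this converges. The forbidden blocks are $(\pm1)^h,\pm m$ for $q$ even, and $(\pm1)^{h+1}$ and $(\pm1)^h,\pm2,(\pm1)^h,\pm m$ for $q$ odd, where $m\ge1$, all signs in a block are equal,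 and powers denote repetition. Let $R$ be the largest value of a finite or infinite $\lambda$-fraction $\langle 0;b_1,b_2,\dots\rangle$ that contains no forbidden block read in reversed order, and let $r=R-\lambda$. *Dual regular fractions.* An infinite $\lambda$-fraction $\langle b_0;b_1,\dots\rangle$ with value $y$, whose shifts $\langle0;b_j,b_{j+1},\dots\rangle$ have values $y_j$ ($j\ge1$), is dual regular if $b_0=0$ implies $y\in[-R,R]$, $b_0\neq0$ implies $y_1\in\operatorname{sign}(b_0)[r,R]$, and $y_{j+1}\in\operatorname{sign}(-y_j)[r,R]$ for all $j\ge1$. Define $F_q^*(0)=0$ and $F_q^*(y)=-\frac1y-\{-\frac1y\}^*\lambda$ for $y\ne0$, where $\{w\}^*$ is the integer with $w-\{w\}^*\lambda\in[r,R)$ if $w>0$ and $w-\{w\}^*\lambda\in(-R,-r]$ if $w<0$. The expansion $c_q^*(y)$ of $y\in\mathbb R^\infty$ has the digits $b_0=0$ if $|y|\le R$ and $b_0=\{y\}^*$ otherwise, $y_1=y-b_0\lambda$, $b_j=\{-1/y_j\}^*$, $y_{j+1}=F_q^*(y_j)$. Two numbers have the same tail if $c_q^*$ of the one and $c_q^*$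 of the other agree after deletion of finitely many leading digits from each. *Reduced geodesics.* Let $\lfloor x\rfloor'$ be the integer $n$ with $n<x\le n+1$ if $x>0$ and $n\le x<n+1$ if $x\le 0$; let $F_q(0)=0$ and $F_q(x)=-\frac1x-\lfloor-\frac1{x\lambda}+\frac12\rfloor'\lambda$ for $x\ne0$. Let $-\frac\lambda2=\phi_0<\phi_1<\dots<\phi_\kappa=0$ be the ordering of the $F_q$-orbit of $-\frac\lambda2$, let $r_0=-R$, and let $0>r_1>\dots>r_\kappa=r>-R$ be the ordering of the remaining points of the $F_q^*$-orbit of $-R$. Let $\Omega$ be the union of the rectangles $[\phi_{j-1},\phi_j)\times[r_j,R]$, $1\le j\le\kappa$, and of their images under $(x,y)\mapsto(-x,-y)$, and let $\Omega^*=\{(-1/x,-y):(x,y)\in\Omega,\ x,y\in\mathbb R^\infty\}$. A geodesic $\gamma$ is reduced if $(\gamma_+,\gamma_-)\in\Omega^*$ and $\gamma_-$ does not have the same tail as $-r$. **Statement.** 1. Let $\gamma$ be a geodesic on $\mathbb H$ with both endpoints in $\mathbb R^\infty$ and let $\langle b_0;b_1,b_2,\dots\rangle$ be a dual regular $\lambda$-fraction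 with value $\gamma_-$. Then there are an integer $n\ge0$ and a map $A$ such that $$A\,T^{-b_n}S\cdots T^{-b_1}S\,T^{-b_0}\,\gamma$$ is reduced, where $A$ is one of $\mathrm{Id}$, $T^{-1}$, $T^{-1}ST^{-1}$ if $q$ is even, and one of $\mathrm{Id}$, $T^{-1}$, $T^{-1}(ST^{-1})^hST^{-2}$ if $q$ is odd. 2. Let $\gamma^*$ be a geodesic on $\mathbb H/G_q$ (a $G_q$-orbit of oriented geodesics on $\mathbb H$, its lifts) all of whose lifts have both endpoints in $\mathbb R^\infty$. Then $\gamma^*$ has a reduced lift. -/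

import Mathlib

open Filter Topology
open scoped MatrixGroups

noncomputable section

namespace Hecke

/-! ### The Hecke triangle group -/

/-- `λ = λ_q = 2 cos (π / q)`. -/
def lam (q : ℕ) : ℝ := 2 * Real.cos (Real.pi / q)

/-- `h = (q - 2) / 2` for even `q` and `h = (q - 3) / 2` for odd `q`. -/
def hq (q : ℕ) : ℕ := if Even q then (q - 2) / 2 else (q - 3) / 2

/-- The map `S : z ↦ -1 / z`. It acts on `ℝ ∪ {∞} = OnePoint ℝ` through Mathlib's action of
`GL (Fin 2) ℝ` by fractional linear maps. -/
def S : GL (Fin 2) ℝ :=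
  Matrix.GeneralLinearGroup.mkOfDetNeZero !![0, -1; 1, 0] (by simp [Matrix.det_fin_two])

/-- The map `T : z ↦ z + λ`. -/
def T (q : ℕ) : GL (Fin 2) ℝ :=
  Matrix.GeneralLinearGroup.mkOfDetNeZero !![1, lam q; 0, 1] (by simp [Matrix.det_fin_two])

/-- The Hecke triangle group `G_q`, generated by `S` and `T`. (This is the full preimage in
`SL₂(ℝ)` of the group of transformations: `S ^ 2 = -1` acts trivially.) -/
def heckeGroup (q : ℕ) : Subgroup (GL (Fin 2) ℝ) := Subgroup.closure {S, T q}

/-- `ℝ^∞ = ℝ ∖ G_q(∞)`: the real numbers that are not cusps of `G_q`. -/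
def irrationalPoints (q : ℕ) : Set ℝ :=
  {x | ∀ g ∈ heckeGroup q, g • OnePoint.infty ≠ (x : OnePoint ℝ)}

/-! ### Geodesics -/

/-- Oriented geodesics on the upper half-plane, given by their forward and backward endpoints
`γ₊ ≠ γ₋` in `ℝ ∪ {∞}`. -/
@[ext]
structure Geodesic where
  fwd : OnePoint ℝ
  bwd : OnePoint ℝ
  ne : fwd ≠ bwd

instance : MulAction (GL (Fin 2) ℝ) Geodesic where
  smul g γ := ⟨g • γ.fwd, g • γ.bwd, fun e => γ.ne (MulAction.injective g e)⟩
  one_smul γ := Geodesic.ext (one_smul _ γ.fwd) (one_smul _ γ.bwd)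
  mul_smul g g' γ := Geodesic.ext (mul_smul g g' γ.fwd) (mul_smul g g' γ.bwd)

/-- Both endpoints of `γ` lie in `ℝ^∞`. -/
def Geodesic.EndpointsIrrational (q : ℕ) (γ : Geodesic) : Prop :=
  (∃ x ∈ irrationalPoints q, γ.fwd = (x : OnePoint ℝ)) ∧
    ∃ y ∈ irrationalPoints q, γ.bwd = (y : OnePoint ℝ)

/-- Oriented geodesics on `ℍ / G_q`: classes of geodesics on `ℍ` modulo `G_q`. The lifts of a
geodesic on `ℍ / G_q` are the members of the class. -/
abbrev QuotientGeodesic (q : ℕ) : Type := MulAction.orbitRel.Quotient (heckeGroup q) Geodesic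

/-- The projection of geodesics on `ℍ` to geodesics on `ℍ / G_q`. -/
def project (q : ℕ) (γ : Geodesic) : QuotientGeodesic q :=
  Quotient.mk (MulAction.orbitRel (heckeGroup q) Geodesic) γ

/-! ### `λ`-fractions -/

/-- `T^{a₀} S T^{a₁} ⋯ S T^{aₙ}`. -/
def fractionWord (q : ℕ) (a : ℕ → ℤ) : ℕ → GL (Fin 2) ℝ
  | 0 => T q ^ a 0
  | n + 1 => fractionWord q a n * S * T q ^ a (n + 1)

/-- The finite `λ`-fraction `⟨a₀; a₁, …, aₙ⟩` has the value `x`. -/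
def FiniteValue (q : ℕ) (a : ℕ → ℤ) (n : ℕ) (x : ℝ) : Prop :=
  fractionWord q a n • ((0 : ℝ) : OnePoint ℝ) = (x : OnePoint ℝ)

/-- The infinite `λ`-fraction `⟨a₀; a₁, a₂, …⟩` converges to `x`. -/
def InfiniteValue (q : ℕ) (a : ℕ → ℤ) (x : ℝ) : Prop :=
  Tendsto (fun n => fractionWord q a n • ((0 : ℝ) : OnePoint ℝ)) atTop (𝓝 (x : OnePoint ℝ))

/-- The digits of `⟨0; a_j, a_{j+1}, …⟩`, for `j ≥ 1`. -/
def shiftDigits (a : ℕ → ℤ) (j : ℕ) : ℕ → ℤ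
  | 0 => 0
  | i + 1 => a (j + i)

/-- The forbidden blocks: `((±1)^h, ±m)` for even `q`; `((±1)^(h+1))` and
`((±1)^h, ±2, (±1)^h, ±m)` for odd `q`; here `m ≥ 1`. -/
def forbiddenBlocks (q : ℕ) : Set (List ℤ) :=
  {B | ∃ ε : ℤ, (ε = 1 ∨ ε = -1) ∧
    if Even q then ∃ m : ℤ, 1 ≤ m ∧ B = List.replicate (hq q) ε ++ [ε * m]
    else B = List.replicate (hq q + 1) ε ∨
      ∃ m : ℤ, 1 ≤ m ∧ B = List.replicate (hq q) ε ++ [ε * 2] ++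
        List.replicate (hq q) ε ++ [ε * m]}

/-- `a₁, …, aₙ` are nonzero and contain no forbidden block read in reversed order. -/
def NoReversedForbidden (q : ℕ) (a : ℕ → ℤ) (n : ℕ) : Prop :=
  (∀ j, 1 ≤ j → j ≤ n → a j ≠ 0) ∧
    ∀ B ∈ forbiddenBlocks q, ¬ B.reverse <:+: (List.range n).map (fun i => a (i + 1))

/-- `R` is the largest value of a finite or infinite `λ`-fraction `⟨0; b₁, b₂, …⟩` without
reversed forbidden blocks. -/
def R (q : ℕ) : ℝ :=
  sSup {y | ∃ b : ℕ → ℤ, b 0 = 0 ∧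
    ((∃ n, NoReversedForbidden q b n ∧ FiniteValue q b n y) ∨
      ((∀ n, NoReversedForbidden q b n) ∧ InfiniteValue q b y))}

/-- `r = R - λ`. -/
def r (q : ℕ) : ℝ := R q - lam q

/-- The infinite `λ`-fraction `⟨b₀; b₁, b₂, …⟩` is dual regular and has the value `y`. Here
`t j` is the value of `⟨0; b_j, b_{j+1}, …⟩`. -/
def IsDualRegular (q : ℕ) (b : ℕ → ℤ) (y : ℝ) : Prop :=
  (∀ j, 1 ≤ j → b j ≠ 0) ∧ InfiniteValue q b y ∧
    ∃ t : ℕ → ℝ, (∀ j, 1 ≤ j → InfiniteValue q (shiftDigits b j) (t j)) ∧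
      (b 0 = 0 → y ∈ Set.Icc (-R q) (R q)) ∧
      (b 0 ≠ 0 → t 1 ∈ (fun z => ((b 0).sign : ℝ) * z) '' Set.Icc (r q) (R q)) ∧
      ∀ j, 1 ≤ j → t (j + 1) ∈ (fun z => Real.sign (-t j) * z) '' Set.Icc (r q) (R q)

/-! ### The generating maps -/

/-- The floor function with `n < x ≤ n + 1` for `x > 0` and `n ≤ x < n + 1` for `x ≤ 0`. -/
def floorOut (x : ℝ) : ℤ := if 0 < x then ⌈x⌉ - 1 else ⌊x⌋

/-- The nearest `λ`-multiple function. -/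
def nearest (q : ℕ) (x : ℝ) : ℤ := floorOut (x / lam q + 1 / 2)

/-- The generating map `F_q` of the regular `λ`-fractions. -/
def F (q : ℕ) (x : ℝ) : ℝ :=
  if x = 0 then 0 else -1 / x - nearest q (-1 / x) * lam q

/-- The shifted nearest `λ`-multiple function: the integer `n` with `w - n λ ∈ [r, R)` for
`w > 0`, and with `w - n λ ∈ (-R, -r]` for `w < 0`. -/
def nearestDual (q : ℕ) (w : ℝ) : ℤ :=
  if 0 < w then ⌊(w - r q) / lam q⌋ else -⌊(-w - r q) / lam q⌋

/-- The generating map `F_q^*` of the dual regular `λ`-fractions. -/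
def Fdual (q : ℕ) (y : ℝ) : ℝ :=
  if y = 0 then 0 else -1 / y - nearestDual q (-1 / y) * lam q

/-- The leading digit of the dual regular expansion: it is `0` exactly on `I_R = [-R, R]`. -/
def dualLeading (q : ℕ) (y : ℝ) : ℤ := if |y| ≤ R q then 0 else nearestDual q y

/-- The digits `b₀, b₁, b₂, …` of the dual regular expansion `c_q^*(y)` of a number `y ∈ ℝ^∞`:
`y₁ = y - b₀ λ`, `y_{j+1} = F_q^* y_j` and `b_j` is the shifted nearest `λ`-multiple of
`-1 / y_j`. -/
def dualDigits (q : ℕ) (y : ℝ) : ℕ → ℤ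
  | 0 => dualLeading q y
  | j + 1 => nearestDual q (-1 / ((Fdual q)^[j] (y - dualLeading q y * lam q)))

/-- The dual regular expansions of `u` and `v` have the same tail. -/
def SameTail (q : ℕ) (u v : ℝ) : Prop :=
  ∃ m n : ℕ, ∀ k, dualDigits q u (m + k) = dualDigits q v (n + k)

/-! ### The domains `Ω` and `Ω^*`, and reduced geodesics -/

/-- `κ = h` for even `q` and `κ = 2 h + 1 = q - 2` for odd `q`. -/
def kappa (q : ℕ) : ℕ := if Even q then hq q else 2 * hq q + 1

/-- `-λ/2 = φ₀ < φ₁ < ⋯ < φ_κ` is the ordering of the `F_q`-orbit of `-λ/2`. -/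
def IsOrbitOrdering (q : ℕ) (φ : ℕ → ℝ) : Prop :=
  StrictMonoOn φ (Set.Iic (kappa q)) ∧ φ 0 = -lam q / 2 ∧
    φ '' Set.Iic (kappa q) = {x | ∃ j, x = (F q)^[j] (-lam q / 2)}

/-- `r₀ = -R` and `0 > r₁ > r₂ > ⋯ > r_κ = r > -R` is the ordering of the `F_q^*`-orbit
of `-R`. -/
def IsDualOrbitOrdering (q : ℕ) (ρ : ℕ → ℝ) : Prop :=
  ρ 0 = -R q ∧ StrictAntiOn ρ (Set.Icc 1 (kappa q)) ∧ ρ 1 < 0 ∧ ρ (kappa q) = r q ∧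
    ρ '' Set.Iic (kappa q) = {y | ∃ j, y = (Fdual q)^[j] (-R q)}

/-- `Ω` is the union, over `1 ≤ j ≤ κ`, of the rectangles `[φ_{j-1}, φ_j) × [r_j, R]` and their
images under `(x, y) ↦ (-x, -y)`. -/
def Omega (q : ℕ) : Set (ℝ × ℝ) :=
  {p | ∃ φ ρ : ℕ → ℝ, IsOrbitOrdering q φ ∧ IsDualOrbitOrdering q ρ ∧
    ∃ j, 1 ≤ j ∧ j ≤ kappa q ∧
      (p ∈ Set.Ico (φ (j - 1)) (φ j) ×ˢ Set.Icc (ρ j) (R q) ∨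
        -p ∈ Set.Ico (φ (j - 1)) (φ j) ×ˢ Set.Icc (ρ j) (R q))}

/-- `Ω^* = {(-1 / x, -y)}`, where `(x, y)` ranges over the points of `Ω` with both coordinates
in `ℝ^∞`. -/
def OmegaStar (q : ℕ) : Set (ℝ × ℝ) :=
  (fun p : ℝ × ℝ => (-1 / p.1, -p.2)) ''
    (Omega q ∩ irrationalPoints q ×ˢ irrationalPoints q)

/-- The set `Υ_q` of reduced geodesics: `(γ₊, γ₋) ∈ Ω^*`, and `γ₋` does not have the same tail
as `-r`. -/
def reducedGeodesics (q : ℕ) : Set Geodesic :=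
  {γ | ∃ ξ η : ℝ, γ.fwd = (ξ : OnePoint ℝ) ∧ γ.bwd = (η : OnePoint ℝ) ∧
    (ξ, η) ∈ OmegaStar q ∧ ¬ SameTail q η (-r q)}

/-! ### The reduction words -/

/-- `T^{-bₙ} S ⋯ T^{-b₁} S T^{-b₀}`. -/
def reductionWord (q : ℕ) (b : ℕ → ℤ) : ℕ → GL (Fin 2) ℝ
  | 0 => T q ^ (-b 0)
  | n + 1 => T q ^ (-b (n + 1)) * S * reductionWord q b n

/-- The maps `Id`, `T⁻¹`, and `T⁻¹ S T⁻¹` for even `q`, `T⁻¹ (S T⁻¹)^h S T⁻²` for odd `q`. -/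
def finalMaps (q : ℕ) : Set (GL (Fin 2) ℝ) :=
  {1, (T q)⁻¹,
    if Even q then (T q)⁻¹ * S * (T q)⁻¹
    else (T q)⁻¹ * (S * (T q)⁻¹) ^ hq q * S * T q ^ (-2 : ℤ)}

end Hecke

end

namespace Hecke

/-! ### The translation length -/

/-! Let `U` be the map `T⁻¹S : x ↦ -1/x - λ`, which is elliptic of order `q`. A dual regular
expansion of `γ₋` produces values `t_n` in `[-R, R]` with `t_{n+1} = -1/t_n - bλ`, where a negative
`t_n` is followed by a point of `[r, R]` and a positive one by a point of `[-R, -r]` (`DualSeq`).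
The reduction words apply the same maps to `γ₊` and give forward endpoints `ξ_n` (`FwdSeq`). The
task is to find an `n` for which `(ξ_n, t_n)`, possibly after a final map, lies in `Ω^*`.

All data are made explicit through `U`. The number `R` is characterised by `U^{h+1}(-R) = R`; that
it is the supremum in the definition is `R_eq`. The upper bound there is an induction over contexts
of digits (`fracVal_ge_aux`), and the value is approached by truncating the expansion of `R`. The
dual orbit of `-R` consists of runs of `U` started at `-R` and at `r`, and the orbit of `-λ/2` is
handled in the same way, so that the corners of `Ω` are known (`isOrbitOrdering_phi`,
`isDualOrbitOrdering_rho`). Only the rectangle with `j = κ` and, for odd `q > 3`, the one with `j =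
κ - 1` are needed; `GoodPair` and `mem_OmegaStar` record this.

The engine is a contraction. For geodesics with a common backward endpoint the difference of the
quantities `1/(ξ_n - t_n)` is multiplied by `t_n²` in each step (`FwdSeq.inv_sub`), and `|t_n
t_{n+1}|` is bounded by a constant below `1` (`Step.abs_mul_le`). Hence every forward sequence
approaches that of any convenient comparison geodesic.

If the values `t_n`, `n ≥ 1`, avoid `±R`, the comparison geodesic starts at `∞`; its forward
endpoints are at most `-1` after positive digits (`low_refSeq`). A late change of sign of the digits
gives a good pair at once. Otherwise the signs are eventually constant, and since `h + 1` digits `1`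
in a row would lead to `R`, a larger digit occurs and pushes the forward endpoint far enough
(`exists_goodPair`). If moreover `-r` is avoided, `γ₋` does not acquire the tail of `-r`
(`DualSeq.not_sameTail`).

If some `t_n`, `n ≥ 1`, is `±R` or `-r`, the comparison geodesic is the closed one through `(1/R,
-R)`. The backward endpoint returns infinitely often to `R`, `r` or `-r` while the forward one comes
arbitrarily close to its partner (`exists_target`). One of the three final maps then moves the
backward endpoint exactly to `r`, and `r` does not have the tail of `-r` (`exists_finalMap`,
`not_sameTail_r_neg_r`). The second assertion follows because every point of `ℝ^∞` has such an
expansion (`exists_dualSeq`). -/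

lemma angle_pos {q : ℕ} (hq3 : 3 ≤ q) : 0 < Real.pi / q := by
  have : (0 : ℝ) < q := by exact_mod_cast (by omega : 0 < q)
  exact div_pos Real.pi_pos this

lemma sin_angle_pos {q i : ℕ} (hi : 1 ≤ i) (hiq : i < q) : 0 < Real.sin (i * (Real.pi / q)) := by
  have hq : (0 : ℝ) < q := by exact_mod_cast (by omega : 0 < q)
  have hi' : (0 : ℝ) < i := by exact_mod_cast (by omega : 0 < i)
  have h2 : (i : ℝ) < q := by exact_mod_cast hiq
  apply Real.sin_pos_of_pos_of_lt_pi
  · have := Real.pi_pos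
    positivity
  · rw [mul_div_assoc', div_lt_iff₀ hq, mul_comm]
    exact mul_lt_mul_of_pos_left h2 Real.pi_pos

/-- The Chebyshev recurrence: it makes the entries of the powers of `T⁻¹S` equal to sines of
multiples of `π/q`, up to a common factor. -/
lemma sin_angle_add_two (q i : ℕ) : Real.sin (((i : ℝ) + 2) * (Real.pi / q)) =
    lam q * Real.sin (((i : ℝ) + 1) * (Real.pi / q)) - Real.sin (i * (Real.pi / q)) := by
  set θ := Real.pi / q with hθ
  have e1 : ((i : ℝ) + 2) * θ = ((i : ℝ) + 1) * θ + θ := by ring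
  have e2 : (i : ℝ) * θ = ((i : ℝ) + 1) * θ - θ := by ring
  rw [e1, e2, Real.sin_add, Real.sin_sub, lam, ← hθ]
  ring

lemma sin_angle_sub {q : ℕ} (hq3 : 3 ≤ q) {i j : ℕ} (h : i + j = q) :
    Real.sin (i * (Real.pi / q)) = Real.sin (j * (Real.pi / q)) := by
  have hq : (q : ℝ) ≠ 0 := by exact_mod_cast (by omega : q ≠ 0)
  have h' : (i : ℝ) = q - j := by rw [← h]; push_cast; ring
  have : (i : ℝ) * (Real.pi / q) = Real.pi - j * (Real.pi / q) := by
    rw [h']; field_simp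
  rw [this, Real.sin_pi_sub]

lemma lam_lt_two {q : ℕ} (hq3 : 3 ≤ q) : lam q < 2 := by
  have h := angle_pos hq3
  have hq : (1 : ℝ) ≤ q := by exact_mod_cast (by omega : 1 ≤ q)
  have : Real.cos (Real.pi / q) < Real.cos 0 := by
    apply Real.cos_lt_cos_of_nonneg_of_le_pi le_rfl _ h
    exact div_le_self Real.pi_pos.le hq
  rw [Real.cos_zero] at this
  unfold lam
  linarith

lemma one_le_lam {q : ℕ} (hq3 : 3 ≤ q) : 1 ≤ lam q := by
  have hq : (3 : ℝ) ≤ q := by exact_mod_cast hq3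
  have : Real.cos (Real.pi / 3) ≤ Real.cos (Real.pi / q) := by
    apply Real.cos_le_cos_of_nonneg_of_le_pi (angle_pos hq3).le
    · linarith [Real.pi_pos]
    · exact div_le_div_of_nonneg_left Real.pi_pos.le (by norm_num) hq
  rw [Real.cos_pi_div_three] at this
  unfold lam
  linarith

lemma two_le_lam_sq {q : ℕ} (hq4 : 4 ≤ q) : 2 ≤ lam q ^ 2 := by
  have hq : (4 : ℝ) ≤ q := by exact_mod_cast hq4
  have h : Real.cos (Real.pi / 4) ≤ Real.cos (Real.pi / q) := by
    apply Real.cos_le_cos_of_nonneg_of_le_pi (angle_pos (by omega)).le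
    · linarith [Real.pi_pos]
    · exact div_le_div_of_nonneg_left Real.pi_pos.le (by norm_num) hq
  rw [Real.cos_pi_div_four] at h
  have h2 : √2 ≤ lam q := by unfold lam; linarith
  have h3 : √2 ^ 2 = 2 := Real.sq_sqrt (by norm_num)
  have h4 : (0 : ℝ) ≤ √2 := Real.sqrt_nonneg _
  nlinarith

lemma lam_three : lam 3 = 1 := by
  unfold lam
  push_cast
  rw [Real.cos_pi_div_three]; norm_num

/-- The largest `k` for which `k` digits `1` may follow a positive digit. -/
def kq (q : ℕ) : ℕ := if Even q then hq q - 1 else hq q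

lemma even_eq {q : ℕ} (hq3 : 3 ≤ q) (he : Even q) :
    q = 2 * hq q + 2 ∧ 1 ≤ hq q ∧ kq q + 1 = hq q := by
  have h1 : hq q = (q - 2) / 2 := if_pos he
  have h2 : kq q = hq q - 1 := if_pos he
  obtain ⟨m, hm⟩ := he
  omega

lemma odd_eq {q : ℕ} (hq3 : 3 ≤ q) (ho : ¬ Even q) : q = 2 * hq q + 3 ∧ kq q = hq q := by
  have h1 : hq q = (q - 3) / 2 := if_neg ho
  have h2 : kq q = hq q := if_neg ho
  obtain ⟨m, hm⟩ := Nat.not_even_iff_odd.1 ho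
  omega

lemma eq_hq_add_kq {q : ℕ} (hq3 : 3 ≤ q) : q = hq q + kq q + 3 := by
  by_cases he : Even q
  · have := even_eq hq3 he; omega
  · have := odd_eq hq3 he; omega

/-! ### The rotation `x ↦ -1 / x - λ` and the orbit ending at `0` -/

/-- The elliptic map `T⁻¹ S` on the real line. -/
noncomputable def U (q : ℕ) (x : ℝ) : ℝ := -1 / x - lam q

/-- The points `(T⁻¹ S)^{-i} (0)`. -/
noncomputable def wseq (q i : ℕ) : ℝ :=
  -Real.sin (i * (Real.pi / q)) / Real.sin (((i : ℝ) + 1) * (Real.pi / q))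

lemma wseq_zero (q : ℕ) : wseq q 0 = 0 := by simp [wseq]

lemma sin_angle_succ_pos {q i : ℕ} (h : i + 1 < q) :
    0 < Real.sin (((i : ℝ) + 1) * (Real.pi / q)) := by
  have := sin_angle_pos (q := q) (i := i + 1) (by omega) h
  push_cast at this
  exact this

lemma wseq_neg {q i : ℕ} (hi : 1 ≤ i) (hiq : i + 1 < q) : wseq q i < 0 := by
  unfold wseq
  rw [neg_div]
  exact neg_neg_of_pos (div_pos (sin_angle_pos hi (by omega)) (sin_angle_succ_pos hiq))

lemma U_wseq {q i : ℕ} (hiq : i + 1 < q) : U q (wseq q (i + 1)) = wseq q i := by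
  have h1 := (sin_angle_succ_pos hiq).ne'
  have h2 := sin_angle_add_two q i
  have e : ((i + 1 : ℕ) : ℝ) + 1 = (i : ℝ) + 2 := by push_cast; ring
  have e' : ((i + 1 : ℕ) : ℝ) = (i : ℝ) + 1 := by push_cast; ring
  unfold U wseq
  rw [e, e', h2]
  rw [div_div_eq_mul_div, neg_one_mul, neg_div_neg_eq, eq_div_iff h1, sub_mul, div_mul_cancel₀ _ h1]
  ring

/-- The discriminant of `x² + λx + 1` is negative because `λ < 2`: an elliptic map has no real fixed
point, so its graph stays on one side of the diagonal. -/
lemma lt_U {q : ℕ} (hq3 : 3 ≤ q) {x : ℝ} (hx : x < 0) : x < U q x := by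
  have h1 := one_le_lam hq3
  have h2 := lam_lt_two hq3
  unfold U
  rw [lt_sub_iff_add_lt, lt_div_iff_of_neg hx]
  nlinarith [sq_nonneg (x + lam q / 2)]

lemma U_lt_U {q : ℕ} {x y : ℝ} (hxy : x < y) (hy : y < 0) : U q x < U q y := by
  unfold U
  have : 1 / y < 1 / x := one_div_lt_one_div_of_neg_of_lt hy hxy
  rw [neg_div, neg_div]
  linarith

lemma U_le_U {q : ℕ} {x y : ℝ} (hxy : x ≤ y) (hy : y < 0) : U q x ≤ U q y := by
  rcases hxy.eq_or_lt with rfl | h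
  · rfl
  · exact (U_lt_U h hy).le

lemma wseq_succ_lt {q i : ℕ} (hq3 : 3 ≤ q) (hiq : i + 2 < q) : wseq q (i + 1) < wseq q i := by
  have := lt_U hq3 (wseq_neg (q := q) (i := i + 1) (by omega) (by omega))
  rwa [U_wseq (by omega)] at this

lemma wseq_lt {q i j : ℕ} (hq3 : 3 ≤ q) (hij : i < j) (hj : j + 1 < q) :
    wseq q j < wseq q i := by
  induction j, hij using Nat.le_induction with
  | base => exact wseq_succ_lt hq3 (by omega)
  | succ j hj' ih => exact (wseq_succ_lt hq3 (by omega)).trans (ih (by omega))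

lemma wseq_le {q i j : ℕ} (hq3 : 3 ≤ q) (hij : i ≤ j) (hj : j + 1 < q) :
    wseq q j ≤ wseq q i := by
  rcases hij.eq_or_lt with rfl | h
  · rfl
  · exact (wseq_lt hq3 h hj).le

lemma wseq_one {q : ℕ} (hq3 : 3 ≤ q) : wseq q 1 = -1 / lam q := by
  have h1 : 0 < Real.sin (((0 : ℕ) + 1 : ℝ) * (Real.pi / q)) := sin_angle_succ_pos (by omega)
  have h2 := sin_angle_add_two q 0
  have hl := one_le_lam hq3
  simp only [Nat.cast_zero, zero_add, one_mul, zero_mul, Real.sin_zero, sub_zero] at h1 h2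
  unfold wseq
  norm_num
  rw [h2]
  field_simp

/-- `U` has order `q` and sends `0` to `∞` and `∞` to `-λ`, so `-λ` is the last finite point on the
way backwards from `0`. The symmetry of the sines under `i ↦ q - i` expresses this. -/
lemma wseq_sub_two {q : ℕ} (hq3 : 3 ≤ q) : wseq q (q - 2) = -lam q := by
  obtain ⟨n, rfl⟩ : ∃ n, q = n + 3 := ⟨q - 3, by omega⟩
  have h1 : n + 3 - 2 = n + 1 := by omega
  have hs := sin_angle_sub hq3 (i := n + 1) (j := 2) (by omega)
  have hs' := sin_angle_sub hq3 (i := n + 2) (j := 1) (by omega)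
  have hp := sin_angle_succ_pos (q := n + 3) (i := 0) (by omega)
  have h2 := sin_angle_add_two (n + 3) 0
  have e : ((n + 2 : ℕ) : ℝ) = ((n + 1 : ℕ) : ℝ) + 1 := by push_cast; ring
  rw [e] at hs'
  simp only [Nat.cast_zero, zero_add, one_mul, zero_mul, Real.sin_zero, sub_zero] at h2 hp
  rw [h1, wseq, hs, hs']
  push_cast at h2 hp ⊢
  rw [one_mul, h2, neg_div, mul_div_cancel_right₀ _ hp.ne']

/-- At the middle of the chain the sines with indices `h` and `h + 2` agree, which closes the
recurrence. -/
lemma wseq_even {q : ℕ} (hq3 : 3 ≤ q) (he : Even q) :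
    wseq q (hq q) = -lam q / 2 ∧ wseq q (hq q + 1) = -2 / lam q := by
  obtain ⟨h1, h2, -⟩ := even_eq hq3 he
  have hp := sin_angle_succ_pos (q := q) (i := hq q) (by omega)
  have hs := sin_angle_sub hq3 (i := hq q + 2) (j := hq q) (by omega)
  have h3 := sin_angle_add_two q (hq q)
  have hl := one_le_lam hq3
  have e : ((hq q + 2 : ℕ) : ℝ) = (hq q : ℝ) + 2 := by push_cast; ring
  rw [e] at hs
  have h4 : Real.sin (hq q * (Real.pi / q)) =
      lam q / 2 * Real.sin (((hq q : ℝ) + 1) * (Real.pi / q)) := by linarith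
  constructor
  · unfold wseq
    rw [h4, neg_div, mul_div_cancel_right₀ _ hp.ne', neg_div]
  · unfold wseq
    have e' : ((hq q + 1 : ℕ) : ℝ) + 1 = (hq q : ℝ) + 2 := by push_cast; ring
    rw [e', hs, h4]
    push_cast
    rw [div_eq_div_iff (mul_pos (by linarith) hp).ne' (by linarith)]
    ring

/-- Here the middle falls between two indices: the sines with indices `h + 1` and `h + 2` agree, so
their quotient is `-1`. -/
lemma wseq_odd {q : ℕ} (hq3 : 3 ≤ q) (ho : ¬ Even q) :
    wseq q (hq q) = 1 - lam q ∧ wseq q (hq q + 1) = -1 := by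
  obtain ⟨h1, -⟩ := odd_eq hq3 ho
  have hp := sin_angle_succ_pos (q := q) (i := hq q) (by omega)
  have hs := sin_angle_sub hq3 (i := hq q + 2) (j := hq q + 1) (by omega)
  have e : ((hq q + 2 : ℕ) : ℝ) = ((hq q + 1 : ℕ) : ℝ) + 1 := by push_cast; ring
  have h : wseq q (hq q + 1) = -1 := by
    rw [e] at hs
    unfold wseq
    rw [hs]
    push_cast
    rw [neg_div, div_self hp.ne']
  refine ⟨?_, h⟩
  rw [← U_wseq (by omega), h, U]
  norm_num

lemma neg_one_div_wseq_hq_succ_le {q : ℕ} (hq3 : 3 ≤ q) :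
    -1 / wseq q (hq q + 1) ≤ lam q ∧ wseq q (hq q + 1) ≤ -1 := by
  have hl := one_le_lam hq3
  have hl' := lam_lt_two hq3
  by_cases he : Even q
  · rw [(wseq_even hq3 he).2]
    constructor
    · have : -1 / (-2 / lam q) = lam q / 2 := by field_simp
      rw [this]; linarith
    · rw [div_le_iff₀ (by linarith)]; linarith
  · rw [(wseq_odd hq3 he).2]
    norm_num
    exact hl

/-! ### Iterates of the rotation -/

lemma iterate_U_wseq {q i j : ℕ} (h : i + j < q) : (U q)^[j] (wseq q (i + j)) = wseq q i := by
  induction j with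
  | zero => rfl
  | succ j ih => rw [Function.iterate_succ_apply, ← add_assoc, U_wseq (by omega), ih (by omega)]

/-- `U` is increasing only on either side of its pole `0`, so the larger starting point has to stay
negative until the last step. -/
lemma iterate_U_lt {q n : ℕ} {x y : ℝ} (hxy : x < y) (hy : ∀ k < n, (U q)^[k] y < 0) :
    (U q)^[n] x < (U q)^[n] y := by
  induction n with
  | zero => exact hxy
  | succ n ih =>
    rw [Function.iterate_succ_apply', Function.iterate_succ_apply']
    exact U_lt_U (ih fun k hk => hy k (by omega)) (hy n (by omega))

lemma iterate_U_lt_wseq {q i k : ℕ} {x : ℝ} (hx : x < wseq q (i + k)) (h : i + k + 1 < q) :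
    (U q)^[k] x < wseq q i := by
  have := iterate_U_lt (q := q) (n := k) hx (fun j hj => ?_)
  · rwa [iterate_U_wseq (by omega)] at this
  · have e : i + k = (i + k - j) + j := by omega
    rw [e, iterate_U_wseq (by omega)]
    exact wseq_neg (by omega) (by omega)

/-- The iterates of `U` as fractional linear maps. -/
lemma iterate_U_formula {q n : ℕ} (hq3 : 3 ≤ q) {x : ℝ} (h : ∀ k ≤ n, (U q)^[k] x ≠ 0) :
    Real.sin (((n : ℝ) + 1) * (Real.pi / q)) * x + Real.sin (n * (Real.pi / q)) ≠ 0 ∧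
    (U q)^[n + 1] x = -(Real.sin (((n : ℝ) + 2) * (Real.pi / q)) * x
        + Real.sin (((n : ℝ) + 1) * (Real.pi / q))) /
      (Real.sin (((n : ℝ) + 1) * (Real.pi / q)) * x + Real.sin (n * (Real.pi / q))) := by
  induction n with
  | zero =>
    have h1 := sin_angle_succ_pos (q := q) (i := 0) (by omega)
    have h2 := sin_angle_add_two q 0
    have hx : x ≠ 0 := h 0 le_rfl
    simp only [Nat.cast_zero, zero_add, one_mul, zero_mul, Real.sin_zero, sub_zero, add_zero] at *
    refine ⟨mul_ne_zero h1.ne' hx, ?_⟩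
    rw [Function.iterate_one, U, h2]
    field_simp
    ring
  | succ n ih =>
    obtain ⟨h1, h2⟩ := ih fun k hk => h k (by omega)
    have h3 := h (n + 1) le_rfl
    have s3 := sin_angle_add_two q n
    have s4 := sin_angle_add_two q (n + 1)
    have e : ((n + 1 : ℕ) : ℝ) + 1 = (n : ℝ) + 2 := by push_cast; ring
    have e' : ((n + 1 : ℕ) : ℝ) = (n : ℝ) + 1 := by push_cast; ring
    rw [e, e'] at s4
    rw [Function.iterate_succ_apply', h2, e, e', s4]
    rw [h2] at h3
    have h4 := (div_ne_zero_iff.1 h3).1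
    rw [neg_ne_zero] at h4
    refine ⟨h4, ?_⟩
    unfold U
    set A := Real.sin (((n : ℝ) + 2) * (Real.pi / q)) with hA
    set B := Real.sin (((n : ℝ) + 1) * (Real.pi / q)) with hB
    set C := Real.sin ((n : ℝ) * (Real.pi / q)) with hC
    have e1 : C = lam q * B - A := by linarith
    rw [div_div_eq_mul_div, neg_one_mul, neg_div_neg_eq, eq_div_iff h4, sub_mul,
      div_mul_cancel₀ _ h4, e1]
    ring

/-- Since `h + 1 = q / 2`, this power of `U` is an involution. -/
lemma iterate_U_hq_succ_even {q : ℕ} (hq3 : 3 ≤ q) (he : Even q) {x : ℝ}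
    (h : ∀ k ≤ hq q, (U q)^[k] x ≠ 0) :
    (U q)^[hq q + 1] x = -(lam q / 2 * x + 1) / (x + lam q / 2) := by
  obtain ⟨h1, h2⟩ := iterate_U_formula hq3 h
  obtain ⟨h3, h4, -⟩ := even_eq hq3 he
  have hp := sin_angle_succ_pos (q := q) (i := hq q) (by omega)
  have hs := sin_angle_sub hq3 (i := hq q + 2) (j := hq q) (by omega)
  have e : ((hq q + 2 : ℕ) : ℝ) = (hq q : ℝ) + 2 := by push_cast; ring
  rw [e] at hs
  have h5 := sin_angle_add_two q (hq q)
  have h6 : Real.sin (hq q * (Real.pi / q)) =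
      lam q / 2 * Real.sin (((hq q : ℝ) + 1) * (Real.pi / q)) := by linarith
  rw [h2, hs, h6]
  rw [h6] at h1
  set B := Real.sin (((hq q : ℝ) + 1) * (Real.pi / q))
  have h7 : B * (x + lam q / 2) ≠ 0 := by convert h1 using 1; ring
  have h8 := right_ne_zero_of_mul h7
  rw [div_eq_div_iff h1 h8]
  ring

/-- For `q = 2h + 3` two of the sines in the general formula coincide and cancel. -/
lemma iterate_U_hq_succ_odd {q : ℕ} (hq3 : 3 ≤ q) (ho : ¬ Even q) {x : ℝ}
    (h : ∀ k ≤ hq q, (U q)^[k] x ≠ 0) :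
    (U q)^[hq q + 1] x = -(x + 1) / (x + lam q - 1) := by
  obtain ⟨h1, h2⟩ := iterate_U_formula hq3 h
  obtain ⟨h3, -⟩ := odd_eq hq3 ho
  have hp := sin_angle_succ_pos (q := q) (i := hq q) (by omega)
  have hs := sin_angle_sub hq3 (i := hq q + 2) (j := hq q + 1) (by omega)
  have e : ((hq q + 2 : ℕ) : ℝ) = (hq q : ℝ) + 2 := by push_cast; ring
  have e' : ((hq q + 1 : ℕ) : ℝ) = (hq q : ℝ) + 1 := by push_cast; ring
  rw [e, e'] at hs
  have h5 := sin_angle_add_two q (hq q)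
  have h6 : Real.sin (hq q * (Real.pi / q)) =
      (lam q - 1) * Real.sin (((hq q : ℝ) + 1) * (Real.pi / q)) := by linarith
  rw [h2, hs, h6]
  rw [h6] at h1
  set B := Real.sin (((hq q : ℝ) + 1) * (Real.pi / q))
  have h7 : B * (x + lam q - 1) ≠ 0 := by convert h1 using 1; ring
  have h8 := right_ne_zero_of_mul h7
  rw [div_eq_div_iff h1 h8]
  ring

/-! ### The radius and the orbits of `-R` and `r` -/

/-- The closed form of `R`. -/
noncomputable def radius (q : ℕ) : ℝ :=
  if Even q then 1 else (lam q - 2 + √((2 - lam q) ^ 2 + 4)) / 2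

lemma radius_even {q : ℕ} (he : Even q) : radius q = 1 := if_pos he

lemma radius_pos {q : ℕ} (hq3 : 3 ≤ q) : 0 < radius q := by
  unfold radius
  split_ifs
  · exact one_pos
  · have h2 := lam_lt_two hq3
    have : 2 - lam q < √((2 - lam q) ^ 2 + 4) := by
      apply Real.lt_sqrt_of_sq_lt
      linarith
    linarith

/-- This quadratic equation is exactly the condition `U^{h+1}(-R) = R`. -/
lemma radius_odd {q : ℕ} (ho : ¬ Even q) : radius q ^ 2 + (2 - lam q) * radius q = 1 := by
  have h := Real.sq_sqrt (show (0 : ℝ) ≤ (2 - lam q) ^ 2 + 4 by positivity)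
  simp only [radius, ho, if_false]
  nlinarith

lemma radius_odd_lt_one {q : ℕ} (hq3 : 3 ≤ q) (ho : ¬ Even q) : radius q < 1 := by
  have h := radius_odd ho
  have h2 := lam_lt_two hq3
  have h3 := radius_pos hq3
  nlinarith [mul_pos h3 (sub_pos.2 h2)]

lemma radius_le_one {q : ℕ} (hq3 : 3 ≤ q) : radius q ≤ 1 := by
  by_cases he : Even q
  · exact (radius_even he).le
  · exact (radius_odd_lt_one hq3 he).le

lemma radius_le_one_div {q : ℕ} (hq3 : 3 ≤ q) : radius q ≤ 1 / radius q := by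
  have h1 := radius_le_one hq3
  have h2 := radius_pos hq3
  rw [le_div_iff₀ h2]
  nlinarith

lemma one_div_radius_odd {q : ℕ} (hq3 : 3 ≤ q) (ho : ¬ Even q) :
    1 / radius q = radius q + 2 - lam q := by
  have h := radius_odd ho
  have h2 := radius_pos hq3
  rw [div_eq_iff h2.ne']
  linarith

lemma even_four_le {q : ℕ} (hq3 : 3 ≤ q) (he : Even q) : 4 ≤ q := by
  have := even_eq hq3 he; omega

lemma radius_lt_lam {q : ℕ} (hq3 : 3 ≤ q) : radius q < lam q := by
  have h1 := one_le_lam hq3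
  by_cases he : Even q
  · rw [radius_even he]
    have := two_le_lam_sq (even_four_le hq3 he)
    nlinarith
  · linarith [radius_odd_lt_one hq3 he]

lemma lam_lt_two_mul_radius {q : ℕ} (hq3 : 3 ≤ q) : lam q < 2 * radius q := by
  have h2 := lam_lt_two hq3
  have h1 := one_le_lam hq3
  by_cases he : Even q
  · rw [radius_even he]; linarith
  · have h := radius_odd he
    have h3 := radius_pos hq3
    by_contra! hc
    nlinarith [mul_pos (sub_pos.2 h2) (sub_pos.2 h2)]

lemma lam_sub_one_lt_radius {q : ℕ} (hq3 : 3 ≤ q) : lam q - 1 < radius q := by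
  linarith [lam_lt_two_mul_radius hq3, radius_le_one hq3]

/-- The iterates of `-R` under `U`. -/
noncomputable def aseq (q k : ℕ) : ℝ := (U q)^[k] (-radius q)

/-- The iterates of `r` under `U`. -/
noncomputable def dseq (q k : ℕ) : ℝ := (U q)^[k] (radius q - lam q)

lemma aseq_succ (q k : ℕ) : aseq q (k + 1) = U q (aseq q k) := Function.iterate_succ_apply' _ _ _

lemma dseq_succ (q k : ℕ) : dseq q (k + 1) = U q (dseq q k) := Function.iterate_succ_apply' _ _ _

lemma aseq_one (q : ℕ) : aseq q 1 = 1 / radius q - lam q := by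
  simp [aseq, U, neg_div_neg_eq]

/-- With `R = 1` one has `1/R - λ = R - λ`, so for even `q` the run from `r` is a part of the run
from `-R`. -/
lemma dseq_eq_aseq_succ {q : ℕ} (he : Even q) (k : ℕ) : dseq q k = aseq q (k + 1) := by
  have : aseq q 1 = radius q - lam q := by rw [aseq_one, radius_even he]; norm_num
  unfold dseq
  rw [← this]
  unfold aseq
  rw [← Function.iterate_add_apply]

lemma neg_radius_lt_wseq {q : ℕ} (hq3 : 3 ≤ q) : -radius q < wseq q (hq q) := by
  have := lam_lt_two_mul_radius hq3
  by_cases he : Even q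
  · rw [(wseq_even hq3 he).1]; linarith
  · rw [(wseq_odd hq3 he).1]
    linarith [lam_sub_one_lt_radius hq3]

lemma hq_succ_lt {q : ℕ} (hq3 : 3 ≤ q) : hq q + 1 < q := by
  have := eq_hq_add_kq hq3; omega

lemma aseq_lt_wseq {q k : ℕ} (hq3 : 3 ≤ q) (hk : k ≤ hq q) : aseq q k < wseq q (hq q - k) := by
  have h1 := hq_succ_lt hq3
  apply iterate_U_lt_wseq
  · rw [Nat.sub_add_cancel hk]
    exact neg_radius_lt_wseq hq3
  · omega

lemma wseq_nonpos {q i : ℕ} (hiq : i + 1 < q) : wseq q i ≤ 0 := by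
  rcases Nat.eq_zero_or_pos i with rfl | h
  · exact (wseq_zero q).le
  · exact (wseq_neg h hiq).le

lemma aseq_neg {q k : ℕ} (hq3 : 3 ≤ q) (hk : k ≤ hq q) : aseq q k < 0 :=
  (aseq_lt_wseq hq3 hk).trans_le (wseq_nonpos (by have := hq_succ_lt hq3; omega))

/-- The defining property of `R`: a run of `h + 1` digits `1` leads from one end of `[-R, R]` to the
other. It is the source of the forbidden blocks. -/
lemma aseq_hq_succ {q : ℕ} (hq3 : 3 ≤ q) : aseq q (hq q + 1) = radius q := by
  have hn : ∀ k ≤ hq q, (U q)^[k] (-radius q) ≠ 0 := fun k hk => (aseq_neg hq3 hk).ne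
  have h2 := lam_lt_two hq3
  by_cases he : Even q
  · rw [aseq, iterate_U_hq_succ_even hq3 he hn, radius_even he, div_eq_one_iff_eq (by linarith)]
    ring
  · have h := radius_odd he
    have h3 := lam_sub_one_lt_radius hq3
    rw [aseq, iterate_U_hq_succ_odd hq3 he hn, div_eq_iff (by linarith)]
    linarith

lemma dseq_lt_wseq_odd {q k : ℕ} (hq3 : 3 ≤ q) (ho : ¬ Even q) (hk : k ≤ hq q) :
    dseq q k < wseq q (hq q - k) := by
  have h1 := hq_succ_lt hq3
  apply iterate_U_lt_wseq
  · rw [Nat.sub_add_cancel hk, (wseq_odd hq3 ho).1]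
    linarith [radius_odd_lt_one hq3 ho]
  · omega

lemma dseq_neg {q k : ℕ} (hq3 : 3 ≤ q) (hk : k ≤ kq q) : dseq q k < 0 := by
  by_cases he : Even q
  · rw [dseq_eq_aseq_succ he]
    exact aseq_neg hq3 (by have := even_eq hq3 he; omega)
  · have h := (odd_eq hq3 he).2
    exact (dseq_lt_wseq_odd hq3 he (by omega)).trans_le
      (wseq_nonpos (by have := hq_succ_lt hq3; omega))

lemma dseq_kq_succ_even {q : ℕ} (hq3 : 3 ≤ q) (he : Even q) : dseq q (kq q + 1) = radius q := by
  rw [dseq_eq_aseq_succ he, (even_eq hq3 he).2.2, aseq_hq_succ hq3]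

/-- For odd `q` the run from `r` overshoots `R`. A further digit `2` brings it back to `1/R - λ =
a_1`, which explains the long forbidden blocks. -/
lemma dseq_kq_succ_odd {q : ℕ} (hq3 : 3 ≤ q) (ho : ¬ Even q) :
    dseq q (kq q + 1) = 1 / radius q := by
  have hk := (odd_eq hq3 ho).2
  have hn : ∀ k ≤ hq q, (U q)^[k] (radius q - lam q) ≠ 0 :=
    fun k hk' => (dseq_neg hq3 (by omega)).ne
  have h := radius_odd ho
  have h2 := radius_pos hq3
  have h3 := radius_odd_lt_one hq3 ho
  rw [hk, dseq, iterate_U_hq_succ_odd hq3 ho hn, div_eq_div_iff (by linarith) h2.ne']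
  linarith

lemma aseq_lt_succ {q k : ℕ} (hq3 : 3 ≤ q) (hk : k ≤ hq q) : aseq q k < aseq q (k + 1) := by
  rw [aseq_succ]; exact lt_U hq3 (aseq_neg hq3 hk)

lemma dseq_lt_succ {q k : ℕ} (hq3 : 3 ≤ q) (hk : k ≤ kq q) : dseq q k < dseq q (k + 1) := by
  rw [dseq_succ]; exact lt_U hq3 (dseq_neg hq3 hk)

lemma aseq_le {q i j : ℕ} (hq3 : 3 ≤ q) (hij : i ≤ j) (hj : j ≤ hq q + 1) :
    aseq q i ≤ aseq q j := by
  induction j, hij using Nat.le_induction with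
  | base => rfl
  | succ j hj' ih => exact (ih (by omega)).trans (aseq_lt_succ hq3 (by omega)).le

lemma dseq_le {q i j : ℕ} (hq3 : 3 ≤ q) (hij : i ≤ j) (hj : j ≤ kq q + 1) :
    dseq q i ≤ dseq q j := by
  induction j, hij using Nat.le_induction with
  | base => rfl
  | succ j hj' ih => exact (ih (by omega)).trans (dseq_lt_succ hq3 (by omega)).le

lemma aseq_zero (q : ℕ) : aseq q 0 = -radius q := rfl

lemma dseq_zero (q : ℕ) : dseq q 0 = radius q - lam q := rfl

lemma dseq_zero_le_aseq_one {q : ℕ} (hq3 : 3 ≤ q) : dseq q 0 ≤ aseq q 1 := by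
  rw [aseq_one, dseq_zero]
  linarith [radius_le_one_div hq3]

lemma dseq_lt_aseq_succ_odd {q k : ℕ} (hq3 : 3 ≤ q) (ho : ¬ Even q) (hk : k ≤ hq q) :
    dseq q k < aseq q (k + 1) := by
  have e : aseq q (k + 1) = (U q)^[k] (aseq q 1) := by
    unfold aseq; rw [← Function.iterate_add_apply]
  rw [e]
  apply iterate_U_lt
  · rw [aseq_one, one_div_radius_odd hq3 ho]
    linarith [lam_lt_two hq3]
  · intro j hj
    have := aseq_neg (q := q) (k := j + 1) hq3 (by omega)
    unfold aseq at this ⊢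
    rwa [← Function.iterate_add_apply]

lemma aseq_lt_dseq {q k : ℕ} (hq3 : 3 ≤ q) (hk : k ≤ kq q + 1) : aseq q k < dseq q k := by
  apply iterate_U_lt
  · linarith [lam_lt_two_mul_radius hq3]
  · intro j hj
    exact dseq_neg hq3 (by omega)

/-! ### Steps of dual regular expansions -/

/-- One step `t' = -1 / t - b λ` of a dual regular expansion. -/
structure Step (q : ℕ) (t : ℝ) (b : ℤ) (t' : ℝ) : Prop where
  ne : t ≠ 0
  digit_ne : b ≠ 0
  eq : t' = -1 / t - b * lam q
  of_neg : t < 0 → radius q - lam q ≤ t' ∧ t' ≤ radius q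
  of_pos : 0 < t → -radius q ≤ t' ∧ t' ≤ -(radius q - lam q)

lemma Step.neg {q : ℕ} {t t' : ℝ} {b : ℤ} (h : Step q t b t') : Step q (-t) (-b) (-t') where
  ne := neg_ne_zero.2 h.ne
  digit_ne := neg_ne_zero.2 h.digit_ne
  eq := by rw [h.eq]; push_cast; rw [div_neg]; ring
  of_neg ht := by
    have := h.of_pos (by linarith)
    constructor <;> linarith
  of_pos ht := by
    have := h.of_neg (by linarith)
    constructor <;> linarith

lemma Step.abs_le {q : ℕ} (hq3 : 3 ≤ q) {t t' : ℝ} {b : ℤ} (h : Step q t b t') :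
    |t'| ≤ radius q := by
  have := lam_lt_two_mul_radius hq3
  rw [_root_.abs_le]
  rcases lt_or_gt_of_ne h.ne with ht | ht
  · have := h.of_neg ht
    constructor <;> linarith
  · have := h.of_pos ht
    constructor <;> linarith

/-- For `-R ≤ t < 0` one has `-1/t ≥ 1/R ≥ R ≥ t'`, so the subtracted multiple of `λ` is
nonnegative, and a zero digit is excluded. -/
lemma Step.one_le {q : ℕ} (hq3 : 3 ≤ q) {t t' : ℝ} {b : ℤ} (h : Step q t b t')
    (ht' : |t| ≤ radius q) (ht : t < 0) : 1 ≤ b := by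
  have h1 := h.of_neg ht
  have h2 := radius_le_one_div hq3
  have h3 := radius_pos hq3
  have h4 : 1 / radius q ≤ -1 / t := by
    have e : -1 / t = 1 / -t := by rw [div_neg, neg_div]
    rw [e]
    rw [abs_of_neg ht] at ht'
    exact one_div_le_one_div_of_le (by linarith) ht'
  have h5 : (0 : ℝ) ≤ b * lam q := by linarith [h.eq]
  have h6 : (0 : ℝ) ≤ b := by
    by_contra! hc
    nlinarith [one_le_lam hq3]
  have h7 : 0 ≤ b := by exact_mod_cast h6
  have := h.digit_ne
  omega

lemma Step.le_neg_one {q : ℕ} (hq3 : 3 ≤ q) {t t' : ℝ} {b : ℤ} (h : Step q t b t')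
    (ht' : |t| ≤ radius q) (ht : 0 < t) : b ≤ -1 := by
  have := h.neg.one_le hq3 (by rwa [abs_neg]) (by linarith)
  omega

lemma Step.neg_of_pos {q : ℕ} (hq3 : 3 ≤ q) {t t' : ℝ} {b : ℤ} (h : Step q t b t')
    (ht' : |t| ≤ radius q) (hb : 0 < b) : t < 0 := by
  by_contra! hc
  have := h.le_neg_one hq3 ht' (lt_of_le_of_ne hc h.ne.symm)
  omega

lemma Step.range_of_pos {q : ℕ} (hq3 : 3 ≤ q) {t t' : ℝ} {b : ℤ} (h : Step q t b t')
    (ht' : |t| ≤ radius q) (hb : 0 < b) : radius q - lam q ≤ t' ∧ t' ≤ radius q :=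
  h.of_neg (h.neg_of_pos hq3 ht' hb)

lemma Step.eq_U {q : ℕ} {t t' : ℝ} {b : ℤ} (h : Step q t b t') :
    t' = U q t - (b - 1) * lam q := by
  rw [h.eq, U]; ring

lemma Step.eq_U_one {q : ℕ} {t t' : ℝ} (h : Step q t 1 t') : t' = U q t := by
  rw [h.eq_U]; push_cast; ring

/-- A sequence of values `t 0, t 1, …` of the shifts of a dual regular expansion with the digits
`b 0, b 1, …`. -/
structure DualSeq (q : ℕ) (b : ℕ → ℤ) (t : ℕ → ℝ) : Prop where
  abs_zero : |t 0| ≤ radius q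
  step : ∀ n, Step q (t n) (b n) (t (n + 1))

lemma DualSeq.abs_le {q : ℕ} (hq3 : 3 ≤ q) {b : ℕ → ℤ} {t : ℕ → ℝ} (h : DualSeq q b t) (n : ℕ) :
    |t n| ≤ radius q := by
  cases n with
  | zero => exact h.abs_zero
  | succ n => exact (h.step n).abs_le hq3

lemma DualSeq.neg {q : ℕ} {b : ℕ → ℤ} {t : ℕ → ℝ} (h : DualSeq q b t) :
    DualSeq q (fun n => -b n) (fun n => -t n) :=
  ⟨by rw [abs_neg]; exact h.abs_zero, fun n => (h.step n).neg⟩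

lemma DualSeq.shift {q : ℕ} (hq3 : 3 ≤ q) {b : ℕ → ℤ} {t : ℕ → ℝ} (h : DualSeq q b t) (m : ℕ) :
    DualSeq q (fun n => b (m + n)) (fun n => t (m + n)) :=
  ⟨h.abs_le hq3 m, fun n => h.step (m + n)⟩

/-- The rate of contraction over two steps. -/
noncomputable def rate (q : ℕ) : ℝ := max (1 / 2) (lam q - radius q)

lemma rate_pos (q : ℕ) : 0 < rate q := lt_of_lt_of_le (by norm_num) (le_max_left _ _)

lemma rate_lt_one {q : ℕ} (hq3 : 3 ≤ q) : rate q < 1 :=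
  max_lt (by norm_num) (by linarith [lam_sub_one_lt_radius hq3])

/-- For even `q` the value `|t| = R = 1` is possible, so one step need not contract. The product of
two consecutive values is always bounded away from `1`, by the identity `t t' = -1 - bλt` and the
lower bound `t' ≥ r`. -/
lemma Step.abs_mul_le_of_neg {q : ℕ} (hq3 : 3 ≤ q) {t t' : ℝ} {b : ℤ} (h : Step q t b t')
    (ht' : |t| ≤ radius q) (ht : t < 0) : |t * t'| ≤ rate q := by
  have h1 := h.of_neg ht
  have hb : (1 : ℝ) ≤ b := by exact_mod_cast h.one_le hq3 ht' ht
  have hl := one_le_lam hq3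
  have hR := radius_le_one hq3
  have hrl := radius_lt_lam hq3
  rw [abs_of_neg ht] at ht'
  have e : t * t' = -1 - b * lam q * t := by
    rw [h.eq]; field_simp [h.ne]
  have h5 : 1 / 2 ≤ rate q := le_max_left _ _
  have h6 : lam q - radius q ≤ rate q := le_max_right _ _
  rw [_root_.abs_le]
  constructor
  · rcases le_total (-t) (1 / 2) with h3 | h3
    · nlinarith
    · have : (1 : ℝ) ≤ b * lam q := by nlinarith
      nlinarith
  · nlinarith

lemma Step.abs_mul_le {q : ℕ} (hq3 : 3 ≤ q) {t t' : ℝ} {b : ℤ} (h : Step q t b t')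
    (ht' : |t| ≤ radius q) : |t * t'| ≤ rate q := by
  rcases lt_or_gt_of_ne h.ne with ht | ht
  · exact h.abs_mul_le_of_neg hq3 ht' ht
  · have := h.neg.abs_mul_le_of_neg hq3 (by rwa [abs_neg]) (by linarith)
    rwa [neg_mul_neg] at this

/-! ### The canonical orbit of `-R` -/

/-- The points of the canonical orbit of `-R`. -/
def orbitSet (q : ℕ) : Set ℝ :=
  {t | (∃ k ≤ hq q, t = aseq q k) ∨ ∃ k ≤ kq q, t = dseq q k}

lemma orbitSet_neg {q : ℕ} (hq3 : 3 ≤ q) {t : ℝ} (ht : t ∈ orbitSet q) : t < 0 := by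
  rcases ht with ⟨k, hk, rfl⟩ | ⟨k, hk, rfl⟩
  · exact aseq_neg hq3 hk
  · exact dseq_neg hq3 hk

lemma neg_one_div_eq (q : ℕ) (t : ℝ) : -1 / t = U q t + lam q := by unfold U; ring

lemma aseq_step (q k : ℕ) :
    aseq q (k + 1) = -1 / aseq q k - (1 : ℤ) * lam q := by
  rw [aseq_succ, U]; push_cast; ring

lemma aseq_step_last {q : ℕ} (hq3 : 3 ≤ q) :
    dseq q 0 = -1 / aseq q (hq q) - (2 : ℤ) * lam q := by
  rw [neg_one_div_eq q, ← aseq_succ, aseq_hq_succ hq3, dseq_zero]; push_cast; ring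

lemma dseq_step (q k : ℕ) :
    dseq q (k + 1) = -1 / dseq q k - (1 : ℤ) * lam q := by
  rw [dseq_succ, U]; push_cast; ring

lemma dseq_step_last_even {q : ℕ} (hq3 : 3 ≤ q) (he : Even q) :
    dseq q 0 = -1 / dseq q (kq q) - (2 : ℤ) * lam q := by
  rw [neg_one_div_eq q, ← dseq_succ, dseq_kq_succ_even hq3 he, dseq_zero]; push_cast; ring

lemma dseq_step_last_odd {q : ℕ} (hq3 : 3 ≤ q) (ho : ¬ Even q) :
    aseq q 1 = -1 / dseq q (kq q) - (2 : ℤ) * lam q := by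
  rw [neg_one_div_eq q, ← dseq_succ, dseq_kq_succ_odd hq3 ho, aseq_one]; push_cast; ring

lemma dseq_step_last_three : dseq 3 0 = -1 / dseq 3 (kq 3) - (3 : ℤ) * lam 3 := by
  have ho : ¬ Even 3 := by decide
  rw [neg_one_div_eq 3, ← dseq_succ, dseq_kq_succ_odd le_rfl ho, dseq_zero,
    one_div_radius_odd le_rfl ho, lam_three]
  push_cast; ring

lemma odd_hq_pos {q : ℕ} (hq3 : 3 ≤ q) (ho : ¬ Even q) (h3 : q ≠ 3) : 1 ≤ hq q := by
  have := odd_eq hq3 ho; omega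

/-- The canonical step on the orbit of `-R`. -/
lemma orbitSet_step {q : ℕ} (hq3 : 3 ≤ q) {t : ℝ} (ht : t ∈ orbitSet q) :
    ∃ b : ℤ, 1 ≤ b ∧ ∃ t' ∈ orbitSet q, t' = -1 / t - b * lam q ∧
      radius q - lam q ≤ t' ∧ t' < radius q := by
  have hR := radius_pos hq3
  have d0 : dseq q 0 ∈ orbitSet q := Or.inr ⟨0, Nat.zero_le _, rfl⟩
  have key : ∀ t' ∈ orbitSet q, t' < radius q := fun t' h => (orbitSet_neg hq3 h).trans hR
  rcases ht with ⟨k, hk, rfl⟩ | ⟨k, hk, rfl⟩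
  · rcases hk.lt_or_eq with h | rfl
    · have hm : aseq q (k + 1) ∈ orbitSet q := Or.inl ⟨k + 1, h, rfl⟩
      refine ⟨1, le_rfl, _, hm, aseq_step q k, ?_, key _ hm⟩
      exact (dseq_zero_le_aseq_one hq3).trans (aseq_le hq3 (by omega) (by omega))
    · exact ⟨2, by norm_num, _, d0, aseq_step_last hq3, le_rfl, key _ d0⟩
  · rcases hk.lt_or_eq with h | rfl
    · have hm : dseq q (k + 1) ∈ orbitSet q := Or.inr ⟨k + 1, h, rfl⟩
      exact ⟨1, le_rfl, _, hm, dseq_step q k, dseq_le hq3 (Nat.zero_le _) (by omega), key _ hm⟩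
    · by_cases he : Even q
      · exact ⟨2, by norm_num, _, d0, dseq_step_last_even hq3 he, le_rfl, key _ d0⟩
      · by_cases h3 : q = 3
        · subst h3
          exact ⟨3, by norm_num, _, d0, dseq_step_last_three, le_rfl, key _ d0⟩
        · have hm : aseq q 1 ∈ orbitSet q := Or.inl ⟨1, odd_hq_pos hq3 he h3, rfl⟩
          exact ⟨2, by norm_num, _, hm, dseq_step_last_odd hq3 he,
            dseq_zero_le_aseq_one hq3, key _ hm⟩

/-- The negated canonical orbit of `-R`. All values after the first lie strictly inside `(-R, R)`,
because the orbit stays in `[r, 0)` and `|r| < R`; this is what makes its digits admissible. -/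
lemma exists_dualSeq_radius {q : ℕ} (hq3 : 3 ≤ q) :
    ∃ b t, DualSeq q b t ∧ t 0 = radius q ∧ ∀ n, |t (n + 1)| ≠ radius q := by
  choose! β hβ τ hτ h1 h2 h3 using fun t (ht : t ∈ orbitSet q) => orbitSet_step hq3 ht
  let t : ℕ → ℝ := fun n => τ^[n] (-radius q)
  have hs : ∀ n, t (n + 1) = τ (t n) := fun n => Function.iterate_succ_apply' _ _ _
  have hm : ∀ n, t n ∈ orbitSet q := by
    intro n
    induction n with
    | zero => exact Or.inl ⟨0, Nat.zero_le _, rfl⟩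
    | succ n ih => rw [hs]; exact hτ _ ih
  have hd : DualSeq q (fun n => β (t n)) t := by
    refine ⟨?_, fun n => ⟨(orbitSet_neg hq3 (hm n)).ne, ?_, ?_, fun _ => ?_, fun h => ?_⟩⟩
    · show |-radius q| ≤ radius q
      rw [abs_neg, abs_of_pos (radius_pos hq3)]
    · have := hβ _ (hm n)
      omega
    · rw [hs]; exact h1 _ (hm n)
    · rw [hs]; exact ⟨h2 _ (hm n), (h3 _ (hm n)).le⟩
    · exact absurd h (orbitSet_neg hq3 (hm n)).not_gt
  refine ⟨_, _, hd.neg, neg_neg _, fun n => ?_⟩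
  have e1 := h2 _ (hm n)
  rw [abs_neg, hs, abs_of_neg (orbitSet_neg hq3 (hτ _ (hm n)))]
  have := lam_lt_two_mul_radius hq3
  intro e
  linarith

/-! ### Finite fractions -/

/-- The value of the finite fraction `⟨0; b₁, …, bₙ⟩`. -/
noncomputable def fracVal (q : ℕ) : List ℤ → ℝ
  | [] => 0
  | b :: L => -1 / (b * lam q + fracVal q L)

/-- A list of nonzero digits without reversed forbidden blocks. -/
def Admissible (q : ℕ) (L : List ℤ) : Prop :=
  (∀ b ∈ L, b ≠ 0) ∧ ∀ B ∈ forbiddenBlocks q, ¬ B.reverse <:+: L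

lemma Admissible.of_infix {q : ℕ} {L L' : List ℤ} (h : Admissible q L) (hL : L' <:+: L) :
    Admissible q L' :=
  ⟨fun b hb => h.1 b (hL.subset hb), fun B hB hi => h.2 B hB (hi.trans hL)⟩

lemma Admissible.of_append {q : ℕ} {C L : List ℤ} (h : Admissible q (C ++ L)) :
    Admissible q L := h.of_infix (List.suffix_append C L).isInfix

lemma Admissible.tail {q : ℕ} {b : ℤ} {L : List ℤ} (h : Admissible q (b :: L)) :
    Admissible q L := h.of_infix (List.suffix_cons b L).isInfix

lemma fracVal_map_neg (q : ℕ) (L : List ℤ) :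
    fracVal q (L.map fun b => -b) = -fracVal q L := by
  induction L with
  | nil => simp [fracVal]
  | cons b L ih =>
    simp only [List.map_cons, fracVal, ih]
    push_cast
    rw [show -(b : ℝ) * lam q + -fracVal q L = -(b * lam q + fracVal q L) by ring, div_neg]

lemma forbiddenBlocks_map_neg {q : ℕ} {B : List ℤ} (h : B ∈ forbiddenBlocks q) :
    (B.map fun b => -b) ∈ forbiddenBlocks q := by
  obtain ⟨ε, hε, h⟩ := h
  refine ⟨-ε, by omega, ?_⟩
  split_ifs at h ⊢ with he
  · obtain ⟨m, hm, rfl⟩ := h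
    exact ⟨m, hm, by simp⟩
  · rcases h with rfl | ⟨m, hm, rfl⟩
    · left; simp
    · right; exact ⟨m, hm, by simp⟩

lemma Admissible.map_neg {q : ℕ} {L : List ℤ} (h : Admissible q L) :
    Admissible q (L.map fun b => -b) := by
  refine ⟨fun b hb => ?_, fun B hB hi => ?_⟩
  · obtain ⟨c, hc, rfl⟩ := List.mem_map.1 hb
    exact neg_ne_zero.2 (h.1 c hc)
  · apply h.2 _ (forbiddenBlocks_map_neg hB)
    have := hi.map fun b => -b
    rw [List.map_map] at this
    simpa [List.map_reverse, Function.comp_def] using this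

lemma Admissible.not_even_block {q : ℕ} (he : Even q) {L : List ℤ} (h : Admissible q L) {m : ℤ}
    (hm : 1 ≤ m) : ¬ (m :: List.replicate (hq q) 1) <:+: L := by
  have := h.2 (List.replicate (hq q) 1 ++ [1 * m]) ⟨1, Or.inl rfl, by rw [if_pos he]; exact ⟨m, hm, rfl⟩⟩
  simpa using this

lemma Admissible.not_odd_run {q : ℕ} (ho : ¬ Even q) {L : List ℤ} (h : Admissible q L) :
    ¬ List.replicate (hq q + 1) 1 <:+: L := by
  have := h.2 (List.replicate (hq q + 1) 1) ⟨1, Or.inl rfl, by rw [if_neg ho]; exact Or.inl rfl⟩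
  simpa only [List.reverse_replicate] using this

lemma Admissible.not_odd_block {q : ℕ} (ho : ¬ Even q) {L : List ℤ} (h : Admissible q L) {m : ℤ}
    (hm : 1 ≤ m) :
    ¬ (m :: List.replicate (hq q) 1 ++ 2 :: List.replicate (hq q) 1) <:+: L := by
  have := h.2 (List.replicate (hq q) 1 ++ [1 * 2] ++ List.replicate (hq q) 1 ++ [1 * m])
    ⟨1, Or.inl rfl, by rw [if_neg ho]; exact Or.inr ⟨m, hm, rfl⟩⟩
  simpa using this

lemma le_neg_one_div {x z : ℝ} (hx : x < 0) (h : -1 / x ≤ z) : x ≤ -1 / z := by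
  have h0 : 0 < -1 / x := div_pos_of_neg_of_neg (by norm_num) hx
  have hz : 0 < z := h0.trans_le h
  rw [le_div_iff₀ hz]
  rw [div_le_iff_of_neg hx] at h
  linarith

/-- Contexts after which the value of an admissible fraction is at least `a_k`. -/
def LowContext (q k : ℕ) (C : List ℤ) : Prop :=
  C = List.replicate k 1 ∨ ∃ m : ℤ, 1 ≤ m ∧ ∃ j, k = j + 1 ∧
    C = m :: List.replicate (hq q) 1 ++ 2 :: List.replicate j 1

lemma LowContext.succ {q k : ℕ} {C : List ℤ} (h : LowContext q k C) :
    LowContext q (k + 1) (C ++ [1]) := by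
  rcases h with rfl | ⟨m, hm, j, rfl, rfl⟩
  · left; rw [List.replicate_succ']
  · right; exact ⟨m, hm, j + 1, rfl, by simp [List.replicate_succ']⟩

lemma LowContext.not_admissible {q : ℕ} (ho : ¬ Even q) {C L : List ℤ}
    (h : LowContext q (hq q) C) : ¬ Admissible q (C ++ 1 :: L) := by
  intro ha
  rcases h with rfl | ⟨m, hm, j, hj, rfl⟩
  · apply ha.not_odd_run ho
    rw [List.replicate_succ']
    exact ⟨[], L, by simp⟩
  · apply ha.not_odd_block ho hm
    exact ⟨[], L, by rw [hj, List.replicate_succ' (n := j)]; simp⟩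

/-- The lower bounds for the values of admissible fractions in all contexts. -/
lemma fracVal_ge_aux {q : ℕ} (hq3 : 3 ≤ q) (n : ℕ) : ∀ L : List ℤ, L.length = n →
    (∀ k ≤ kq q, ∀ m : ℤ, 1 ≤ m → Admissible q (m :: List.replicate k 1 ++ L) →
      dseq q k ≤ fracVal q L) ∧
    (¬ Even q → ∀ k ≤ hq q, ∀ C, LowContext q k C → Admissible q (C ++ L) →
      aseq q k ≤ fracVal q L) := by
  have hR := radius_pos hq3
  have hl := one_le_lam hq3
  induction n with
  | zero =>
    intro L hL
    rw [List.length_eq_zero_iff] at hL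
    subst hL
    exact ⟨fun k hk _ _ _ => (dseq_neg hq3 hk).le, fun _ k hk _ _ _ => (aseq_neg hq3 hk).le⟩
  | succ n ih =>
    intro L hL
    obtain ⟨b, L, rfl⟩ := List.exists_cons_of_length_eq_add_one hL
    have hL' : L.length = n := by simpa using hL
    have hlow : Admissible q (b :: L) → 1 ≤ b → radius q - lam q ≤ fracVal q L := fun ha hb =>
      (ih L hL').1 0 (Nat.zero_le _) b hb (by simpa using ha)
    have hup : Admissible q (b :: L) → b ≤ -1 → 0 ≤ fracVal q (b :: L) := by
      intro ha hb
      have h1 := (ih (L.map fun b => -b) (by simpa using hL')).1 0 (Nat.zero_le _) (-b) (by omega)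
        (by simpa using ha.map_neg)
      rw [fracVal_map_neg, dseq_zero] at h1
      have hb' : (b : ℝ) ≤ -1 := by exact_mod_cast hb
      exact div_nonneg_of_nonpos (by norm_num) (by nlinarith)
    have hne : Admissible q (b :: L) → b ≠ 0 := fun ha => ha.1 b (by simp)
    have hbig : Admissible q (b :: L) → 2 ≤ b → lam q + radius q ≤ b * lam q + fracVal q L := by
      intro ha hb
      have := hlow ha (by omega)
      have hb' : (2 : ℝ) ≤ b := by exact_mod_cast hb
      nlinarith
    constructor
    · intro k hk m hm ha
      have ha' := ha.of_append
      have hx := dseq_neg hq3 hk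
      rcases le_or_gt b (-1) with hb | hb
      · exact hx.le.trans (hup ha' hb)
      have hb1 : 1 ≤ b := by have := hne ha'; omega
      -- Inverting turns the bound by a point of the run into a bound for `bλ` plus the tail by the
      -- next point of the run plus `λ`. A digit `1` is then the tight case.
      apply le_neg_one_div hx
      rw [neg_one_div_eq q, ← dseq_succ]
      rcases hk.lt_or_eq with hk' | rfl
      · rcases hb1.eq_or_lt with rfl | hb2
        · have := (ih L hL').1 (k + 1) hk' m hm (by simpa [List.replicate_succ'] using ha)
          push_cast
          linarith
        · have := hbig ha' (by omega)
          have := dseq_neg hq3 (show k + 1 ≤ kq q from hk')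
          linarith
      · by_cases he : Even q
        · rw [dseq_kq_succ_even hq3 he]
          rcases hb1.eq_or_lt with rfl | hb2
          · exfalso
            apply ha.not_even_block he hm
            rw [← (even_eq hq3 he).2.2, List.replicate_succ']
            exact ⟨[], L, by simp⟩
          · linarith [hbig ha' (by omega)]
        · rw [dseq_kq_succ_odd hq3 he]
          have hk := (odd_eq hq3 he).2
          rw [hk] at ha
          rcases hb1.eq_or_lt with rfl | hb2
          · exfalso
            apply ha.not_odd_run he
            rw [List.replicate_succ']
            exact ⟨[m], L, by simp⟩
          rcases (show (2 : ℤ) ≤ b by omega).eq_or_lt with rfl | hb3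
          · rcases Nat.eq_zero_or_pos (hq q) with h0 | h0
            -- Here `h = 0`, that is `q = 3`, and a digit `2` after a positive digit is itself a
            -- forbidden block.
            · exfalso
              apply ha.not_odd_block he hm
              rw [h0]
              exact ⟨[], L, by simp⟩
            -- After `m, 1^h, 2` the remaining fraction obeys the restrictions of a fraction
            -- preceded by a single `1`; the resulting bound `a_1 = 1/R - λ` is exactly what is
            -- required.
            · have := (ih L hL').2 he 1 h0 (m :: List.replicate (hq q) 1 ++ [2])
                (Or.inr ⟨m, hm, 0, rfl, by simp⟩) (by simpa using ha)
              rw [aseq_one] at this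
              push_cast
              linarith
          · have h3 := hlow ha' hb1
            have hb' : (3 : ℝ) ≤ b := by exact_mod_cast (show (3 : ℤ) ≤ b by omega)
            rw [one_div_radius_odd hq3 he]
            nlinarith
    · intro ho k hk C hC ha
      have ha' := ha.of_append
      have hx := aseq_neg hq3 hk
      rcases le_or_gt b (-1) with hb | hb
      · exact hx.le.trans (hup ha' hb)
      have hb1 : 1 ≤ b := by have := hne ha'; omega
      apply le_neg_one_div hx
      rw [neg_one_div_eq q, ← aseq_succ]
      rcases hb1.eq_or_lt with rfl | hb2
      · rcases hk.lt_or_eq with hk' | rfl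
        · have := (ih L hL').2 ho (k + 1) hk' _ hC.succ (by simpa using ha)
          push_cast
          linarith
        · exact absurd ha (hC.not_admissible ho)
      · have h1 := hbig ha' (by omega)
        have h2 := aseq_le hq3 (show k + 1 ≤ hq q + 1 by omega) le_rfl
        rw [aseq_hq_succ hq3] at h2
        linarith

lemma fracVal_tail_ge {q : ℕ} (hq3 : 3 ≤ q) {b : ℤ} {L : List ℤ} (h : Admissible q (b :: L))
    (hb : 1 ≤ b) : radius q - lam q ≤ fracVal q L :=
  (fracVal_ge_aux hq3 _ L rfl).1 0 (Nat.zero_le _) b hb (by simpa using h)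

lemma fracVal_tail_le {q : ℕ} (hq3 : 3 ≤ q) {b : ℤ} {L : List ℤ} (h : Admissible q (b :: L))
    (hb : b ≤ -1) : fracVal q L ≤ -(radius q - lam q) := by
  have := fracVal_tail_ge hq3 (b := -b) (L := L.map fun b => -b) h.map_neg (by omega)
  rw [fracVal_map_neg] at this
  linarith

lemma Admissible.radius_le {q : ℕ} (hq3 : 3 ≤ q) {b : ℤ} {L : List ℤ}
    (h : Admissible q (b :: L)) :
    (0 < b → radius q ≤ b * lam q + fracVal q L) ∧
      (b < 0 → b * lam q + fracVal q L ≤ -radius q) := by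
  have hl := one_le_lam hq3
  constructor
  · intro hb
    have h1 := fracVal_tail_ge hq3 h (by omega)
    have hb' : (1 : ℝ) ≤ b := by exact_mod_cast hb
    nlinarith
  · intro hb
    have h1 := fracVal_tail_le hq3 h (by omega)
    have hb' : (b : ℝ) ≤ -1 := by exact_mod_cast (show b ≤ -1 by omega)
    nlinarith

/-- This keeps the recursion of `fracVal` away from division by zero, so that it agrees with the
action on `ℝ ∪ {∞}`. -/
lemma Admissible.denom_ne {q : ℕ} (hq3 : 3 ≤ q) {b : ℤ} {L : List ℤ}
    (h : Admissible q (b :: L)) : b * lam q + fracVal q L ≠ 0 := by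
  have hR := radius_pos hq3
  obtain ⟨h1, h2⟩ := h.radius_le hq3
  rcases lt_or_gt_of_ne (h.1 b (by simp)) with hb | hb
  · linarith [h2 hb]
  · linarith [h1 hb]

lemma Admissible.neg_radius_le {q : ℕ} (hq3 : 3 ≤ q) {L : List ℤ} (h : Admissible q L) :
    -radius q ≤ fracVal q L := by
  have hR := radius_pos hq3
  by_cases he : Even q
  · cases L with
    | nil => simpa [fracVal] using hR.le
    | cons b L =>
      obtain ⟨h1, h2⟩ := h.radius_le hq3
      rcases lt_or_gt_of_ne (h.1 b (by simp)) with hb | hb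
      · refine (neg_nonpos.2 hR.le).trans ?_
        exact div_nonneg_of_nonpos (by norm_num) (by linarith [h2 hb])
      · have := h1 hb
        rw [radius_even he] at this ⊢
        apply le_neg_one_div (by norm_num)
        simpa using this
  · exact (fracVal_ge_aux hq3 _ L rfl).2 he 0 (Nat.zero_le _) [] (Or.inl rfl) (by simpa using h)

lemma Admissible.abs_le {q : ℕ} (hq3 : 3 ≤ q) {L : List ℤ} (h : Admissible q L) :
    |fracVal q L| ≤ radius q := by
  have h1 := h.neg_radius_le hq3
  have h2 := h.map_neg.neg_radius_le hq3
  rw [fracVal_map_neg] at h2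
  rw [_root_.abs_le]
  constructor <;> linarith

/-! ### The action of the words -/

lemma S_smul_coe {x : ℝ} (hx : x ≠ 0) : S • (x : OnePoint ℝ) = ((-1 / x : ℝ) : OnePoint ℝ) := by
  rw [OnePoint.smul_some_eq_ite]
  simp [S, hx]

lemma S_smul_zero : S • ((0 : ℝ) : OnePoint ℝ) = OnePoint.infty := by
  rw [OnePoint.smul_some_eq_ite]
  simp [S]

lemma S_smul_infty : S • (OnePoint.infty : OnePoint ℝ) = ((0 : ℝ) : OnePoint ℝ) := by
  rw [OnePoint.smul_infty_eq_ite]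
  simp [S]

lemma T_smul_coe (q : ℕ) (x : ℝ) : T q • (x : OnePoint ℝ) = ((x + lam q : ℝ) : OnePoint ℝ) := by
  rw [OnePoint.smul_some_eq_ite]
  simp [T]

lemma T_zpow_smul_coe (q : ℕ) (n : ℤ) (x : ℝ) :
    T q ^ n • (x : OnePoint ℝ) = ((x + n * lam q : ℝ) : OnePoint ℝ) := by
  induction n generalizing x with
  | zero => simp
  | succ n ih =>
    rw [zpow_add_one, mul_smul, T_smul_coe, ih]
    push_cast; congr 1; ring
  | pred n ih =>
    have h : (T q)⁻¹ • (x : OnePoint ℝ) = ((x - lam q : ℝ) : OnePoint ℝ) := by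
      rw [inv_smul_eq_iff, T_smul_coe, sub_add_cancel]
    rw [zpow_sub_one, mul_smul, h, ih]
    push_cast; congr 1; ring

lemma fractionWord_succ (q : ℕ) (b : ℕ → ℤ) (n : ℕ) :
    fractionWord q b (n + 1) = T q ^ b 0 * S * fractionWord q (fun i => b (i + 1)) n := by
  induction n with
  | zero => rfl
  | succ n ih =>
    rw [fractionWord, ih, fractionWord]
    simp only [mul_assoc]

/-- The digits `b 1, …, b n`. -/
def digitList (b : ℕ → ℤ) (n : ℕ) : List ℤ := (List.range n).map fun i => b (i + 1)

lemma digitList_succ (b : ℕ → ℤ) (n : ℕ) :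
    digitList b (n + 1) = b 1 :: digitList (fun i => b (i + 1)) n := by
  simp [digitList, List.range_succ_eq_map, Function.comp_def]

lemma fractionWord_smul_zero {q : ℕ} (hq3 : 3 ≤ q) (n : ℕ) : ∀ b : ℕ → ℤ,
    Admissible q (digitList b n) →
    fractionWord q b n • ((0 : ℝ) : OnePoint ℝ) =
      ((b 0 * lam q + fracVal q (digitList b n) : ℝ) : OnePoint ℝ) := by
  induction n with
  | zero =>
    intro b _
    simp [fractionWord, T_zpow_smul_coe, digitList, fracVal]
  | succ n ih =>
    intro b h
    rw [digitList_succ] at h ⊢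
    rw [fractionWord_succ, mul_smul, mul_smul, ih _ h.tail, zero_add, S_smul_coe (h.denom_ne hq3),
      T_zpow_smul_coe, fracVal, add_comm]

lemma noReversedForbidden_iff (q : ℕ) (b : ℕ → ℤ) (n : ℕ) :
    NoReversedForbidden q b n ↔ Admissible q (digitList b n) := by
  unfold NoReversedForbidden Admissible
  refine and_congr ?_ Iff.rfl
  simp only [digitList, List.mem_map, List.mem_range, forall_exists_index, and_imp]
  constructor
  · rintro h _ i hi rfl
    exact h _ (by omega) (by omega)
  · intro h j h1 h2
    have := h (b j) (j - 1) (by omega) (by rw [Nat.sub_add_cancel h1])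
    exact this

/-! ### Digits of dual regular expansions are admissible -/

lemma exists_of_infix_map_range {B : List ℤ} {β : ℕ → ℤ} {n : ℕ}
    (h : B <:+: (List.range n).map β) : ∃ i, ∀ k (hk : k < B.length), β (i + k) = B[k] := by
  obtain ⟨s, u, h⟩ := h
  refine ⟨s.length, fun k hk => ?_⟩
  have h1 : (s ++ B ++ u)[s.length + k]? = ((List.range n).map β)[s.length + k]? := by rw [h]
  have hl : s.length + k < n := by
    have := congrArg List.length h
    simp at this
    omega
  rw [List.append_assoc, List.getElem?_append_right (by omega), Nat.add_sub_cancel_left,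
    List.getElem?_append_left hk, List.getElem?_map, List.getElem?_range hl,
    List.getElem?_eq_getElem hk] at h1
  simpa using h1.symm

/-- A positive digit forces its point to be negative, where `U` is increasing, so lower bounds are
carried along a run of ones. -/
lemma DualSeq.run_ge {q : ℕ} (hq3 : 3 ≤ q) {b : ℕ → ℤ} {t : ℕ → ℝ} (h : DualSeq q b t) {i n : ℕ}
    {x : ℝ} (hx : x ≤ t i) (hb : ∀ k < n, b (i + k) = 1) : (U q)^[n] x ≤ t (i + n) := by
  induction n with
  | zero => exact hx
  | succ n ih =>
    have h1 := hb n (by omega)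
    have h2 := h.step (i + n)
    have h3 := h2.neg_of_pos hq3 (h.abs_le hq3 _) (by omega)
    rw [h1] at h2
    rw [Function.iterate_succ_apply', ← add_assoc, h2.eq_U_one]
    exact U_le_U (ih fun k hk => hb k (by omega)) h3

lemma DualSeq.ge_neg {q : ℕ} (hq3 : 3 ≤ q) {b : ℕ → ℤ} {t : ℕ → ℝ} (h : DualSeq q b t) (i : ℕ) :
    -radius q ≤ t i := (_root_.abs_le.1 (h.abs_le hq3 i)).1

lemma DualSeq.le_radius {q : ℕ} (hq3 : 3 ≤ q) {b : ℕ → ℤ} {t : ℕ → ℝ} (h : DualSeq q b t)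
    (i : ℕ) : t i ≤ radius q := (_root_.abs_le.1 (h.abs_le hq3 i)).2

/-- `h + 1` consecutive digits `1` lead to `R`. -/
lemma DualSeq.eq_radius_of_run {q : ℕ} (hq3 : 3 ≤ q) {b : ℕ → ℤ} {t : ℕ → ℝ} (h : DualSeq q b t)
    {i : ℕ} (hb : ∀ k < hq q + 1, b (i + k) = 1) : t (i + (hq q + 1)) = radius q := by
  have := h.run_ge hq3 (h.ge_neg hq3 i) hb
  have e : (U q)^[hq q + 1] (-radius q) = radius q := aseq_hq_succ hq3
  exact le_antisymm (h.le_radius hq3 _) (e ▸ this)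

/-- A reversed forbidden block is precisely a pattern that carries a lower bound of the closed
intervals up to `R`. The value would then equal `R`, which is excluded by hypothesis. -/
lemma DualSeq.admissible {q : ℕ} (hq3 : 3 ≤ q) {b : ℕ → ℤ} {t : ℕ → ℝ} (h : DualSeq q b t)
    (hne : ∀ n, |t (n + 1)| ≠ radius q) (n : ℕ) : Admissible q ((List.range n).map b) := by
  refine ⟨fun c hc => ?_, ?_⟩
  · obtain ⟨i, -, rfl⟩ := List.mem_map.1 hc
    exact (h.step i).digit_ne
  rintro B ⟨ε, hε, hB⟩ hi
  wlog h1 : ε = 1 generalizing b t B ε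
  · have h2 : ε = -1 := by omega
    subst h2
    refine this h.neg (by simpa using hne) (B.map fun b => -b) 1 (Or.inl rfl) ?_ ?_ rfl
    · split_ifs at hB ⊢ with he
      · obtain ⟨m, hm, rfl⟩ := hB
        exact ⟨m, hm, by simp⟩
      · rcases hB with rfl | ⟨m, hm, rfl⟩
        · left; simp
        · right; exact ⟨m, hm, by simp⟩
    · have := hi.map fun b => -b
      simpa [List.map_reverse, Function.comp_def] using this
  subst h1
  have hne' : ∀ n, t (n + 1) ≠ radius q := fun n e =>
    hne n (by rw [e, abs_of_pos (radius_pos hq3)])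
  split_ifs at hB with he
  · obtain ⟨m, hm, rfl⟩ := hB
    obtain ⟨i, hi⟩ := exists_of_infix_map_range hi
    simp only [List.reverse_append, List.reverse_replicate, one_mul, List.reverse_cons,
      List.reverse_nil, List.nil_append, List.length_replicate,
      List.singleton_append, List.length_cons] at hi
    have h0 := hi 0 (by omega)
    have h1 : ∀ k < hq q, b (i + 1 + k) = 1 := by
      intro k hk
      have := hi (k + 1) (by omega)
      rw [List.getElem_cons_succ, List.getElem_replicate] at this
      rw [← this]; congr 1; omega
    simp only [add_zero, List.getElem_cons_zero] at h0
    have h2 := ((h.step i).range_of_pos hq3 (h.abs_le hq3 _) (by omega)).1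
    have h3 := h.run_ge hq3 h2 h1
    have e : (U q)^[hq q] (radius q - lam q) = radius q := by
      have := dseq_kq_succ_even hq3 he
      rwa [(even_eq hq3 he).2.2] at this
    rw [e] at h3
    have h4 := le_antisymm (h.le_radius hq3 _) h3
    exact hne' (i + hq q) (by rw [← h4]; congr 1; omega)
  · rcases hB with rfl | ⟨m, hm, rfl⟩
    · obtain ⟨i, hi⟩ := exists_of_infix_map_range hi
      simp only [List.reverse_replicate, List.length_replicate, List.getElem_replicate] at hi
      exact hne' (i + hq q) (h.eq_radius_of_run hq3 hi)
    · obtain ⟨i, hi⟩ := exists_of_infix_map_range hi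
      have hk := (odd_eq hq3 he).2
      simp only [List.reverse_append, List.reverse_replicate, List.length_append, one_mul,
        List.reverse_cons, List.reverse_nil, List.nil_append, List.length_replicate,
        List.singleton_append, List.length_cons] at hi
      have h0 := hi 0 (by omega)
      have h1 : ∀ k < hq q, b (i + 1 + k) = 1 := by
        intro k hk
        have := hi (k + 1) (by omega)
        rw [List.getElem_cons_succ, List.getElem_append_left (by simpa using hk),
          List.getElem_replicate] at this
        rw [← this]; congr 1; omega
      have h1' : b (i + 1 + hq q) = 2 := by
        have := hi (hq q + 1) (by omega)
        rw [List.getElem_cons_succ, List.getElem_append_right (by simp)] at this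
        simp at this
        rw [← this]; congr 1; omega
      have h1'' : ∀ k < hq q, b (i + 1 + hq q + 1 + k) = 1 := by
        intro k hk
        have := hi (hq q + 1 + k + 1) (by omega)
        rw [List.getElem_cons_succ, List.getElem_append_right (by simp; omega)] at this
        simp [show hq q + 1 + k - hq q = k + 1 by omega] at this
        rw [← this]; congr 1; omega
      simp only [add_zero, List.getElem_cons_zero] at h0
      have h2 := ((h.step i).range_of_pos hq3 (h.abs_le hq3 _) (by omega)).1
      have h3 := h.run_ge hq3 h2 h1
      have h4 := h.step (i + 1 + hq q)
      have h5 := h4.neg_of_pos hq3 (h.abs_le hq3 _) (by omega)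
      rw [h1'] at h4
      -- The first run of ones gives `U t ≥ 1/R` here; the digit `2` lowers this to `a_1`, and `h`
      -- more ones raise it to `R`.
      have h6 := U_le_U (q := q) h3 h5
      have e := dseq_kq_succ_odd hq3 he
      rw [hk, dseq_succ, dseq] at e
      rw [e] at h6
      have h7 : aseq q 1 ≤ t (i + 1 + hq q + 1) := by
        rw [h4.eq_U, aseq_one]; push_cast; linarith
      have h8 := h.run_ge hq3 h7 h1''
      have e' : (U q)^[hq q] (aseq q 1) = radius q := by
        rw [← aseq_hq_succ hq3]; unfold aseq; rw [← Function.iterate_add_apply]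
      rw [e'] at h8
      exact hne' (i + 1 + hq q + hq q)
        (le_antisymm (h.le_radius hq3 _) (h8.trans (le_of_eq (by congr 1; omega))))

/-! ### The value of `R` -/

lemma fracVal_cons_sub {q : ℕ} {b : ℤ} {s t t' : ℝ} (hs : b * lam q + s ≠ 0)
    (h : Step q t b t') : -1 / (b * lam q + s) - t = -1 / (b * lam q + s) * t * (s - t') := by
  have h1 : b * lam q + t' ≠ 0 := by
    rw [h.eq]
    have := h.ne
    have e : b * lam q + (-1 / t - b * lam q) = -1 / t := by ring
    rw [e]
    exact div_ne_zero (by norm_num) this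
  have h2 : t = -1 / (b * lam q + t') := by
    have e : b * lam q + t' = -1 / t := by rw [h.eq]; ring
    rw [e]
    field_simp [h.ne]
  rw [h2]
  field_simp
  ring

/-- Two peeled digits multiply the error by two truncated values, of modulus at most `R ≤ 1`, and by
`t_0 t_1`, which supplies the factor `rate q`. Admissibility of the truncations is needed for the
former bound. -/
lemma DualSeq.abs_fracVal_sub_le {q : ℕ} (hq3 : 3 ≤ q) (m : ℕ) : ∀ {b : ℕ → ℤ} {t : ℕ → ℝ},
    DualSeq q b t → (∀ n, |t (n + 1)| ≠ radius q) →
    |fracVal q ((List.range (2 * m)).map b) - t 0| ≤ rate q ^ m := by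
  have hR := radius_le_one hq3
  induction m with
  | zero =>
    intro b t h _
    simpa [fracVal] using h.abs_zero.trans hR
  | succ m ih =>
    intro b t h hne
    have h2 := h.shift hq3 2
    have ih' := ih h2 fun n => by
      have := hne (2 + n)
      rwa [add_assoc] at this
    have ha := h.admissible hq3 hne (2 * (m + 1))
    have e : (List.range (2 * (m + 1))).map b =
        b 0 :: b 1 :: (List.range (2 * m)).map fun n => b (2 + n) := by
      rw [show 2 * (m + 1) = 2 * m + 1 + 1 by ring, List.range_succ_eq_map, List.range_succ_eq_map]
      simp [Function.comp_def, add_comm 2]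
    rw [e] at ha ⊢
    have a0 := (ha.abs_le hq3).trans hR
    have a1 := (ha.tail.abs_le hq3).trans hR
    have e0 := fracVal_cons_sub (ha.denom_ne hq3) (h.step 0)
    have e1 := fracVal_cons_sub (ha.tail.denom_ne hq3) (h.step 1)
    set L := (List.range (2 * m)).map fun n => b (2 + n)
    change fracVal q (b 0 :: b 1 :: L) - t 0 =
      fracVal q (b 0 :: b 1 :: L) * t 0 * (fracVal q (b 1 :: L) - t 1) at e0
    change fracVal q (b 1 :: L) - t 1 = fracVal q (b 1 :: L) * t 1 * (fracVal q L - t 2) at e1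
    have h3 := (h.step 0).abs_mul_le hq3 h.abs_zero
    have e2 : fracVal q (b 0 :: b 1 :: L) - t 0 = (fracVal q (b 0 :: b 1 :: L) *
        fracVal q (b 1 :: L)) * (t 0 * t 1) * (fracVal q L - t 2) := by
      rw [e0, e1]; ring
    rw [e2, abs_mul, abs_mul, abs_mul (fracVal q _), pow_succ']
    have h4 : |fracVal q (b 0 :: b 1 :: L)| * |fracVal q (b 1 :: L)| ≤ 1 :=
      mul_le_one₀ a0 (abs_nonneg _) a1
    calc _ ≤ 1 * rate q * rate q ^ m := by
          gcongr
          exact mul_nonneg zero_le_one (rate_pos q).le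
      _ = _ := by ring

lemma tendsto_coe_onePoint {u : ℕ → ℝ} {y : ℝ} :
    Tendsto (fun n => (u n : OnePoint ℝ)) atTop (𝓝 (y : OnePoint ℝ)) ↔ Tendsto u atTop (𝓝 y) :=
  OnePoint.isOpenEmbedding_coe.isEmbedding.tendsto_nhds_iff.symm

/-- Every admissible value is at most the explicit radius, and the even truncations of the canonical
expansion of the radius are admissible and converge to it. -/
theorem R_eq {q : ℕ} (hq3 : 3 ≤ q) : R q = radius q := by
  have hub : ∀ y ∈ {y | ∃ b : ℕ → ℤ, b 0 = 0 ∧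
      ((∃ n, NoReversedForbidden q b n ∧ FiniteValue q b n y) ∨
      ((∀ n, NoReversedForbidden q b n) ∧ InfiniteValue q b y))}, y ≤ radius q := by
    have key : ∀ b : ℕ → ℤ, b 0 = 0 → ∀ n, NoReversedForbidden q b n →
        fractionWord q b n • ((0 : ℝ) : OnePoint ℝ) = (fracVal q (digitList b n) : OnePoint ℝ) ∧
        fracVal q (digitList b n) ≤ radius q := by
      intro b h0 n hn
      rw [noReversedForbidden_iff] at hn
      refine ⟨?_, (abs_le.1 (hn.abs_le hq3)).2⟩
      rw [fractionWord_smul_zero hq3 n b hn, h0]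
      simp
    rintro y ⟨b, h0, ⟨n, hn, hy⟩ | ⟨hn, hy⟩⟩
    · obtain ⟨h1, h2⟩ := key b h0 n hn
      rw [FiniteValue, h1, OnePoint.coe_eq_coe] at hy
      rwa [← hy]
    · unfold InfiniteValue at hy
      simp_rw [fun n => (key b h0 n (hn n)).1] at hy
      exact le_of_tendsto' (tendsto_coe_onePoint.1 hy) fun n => (key b h0 n (hn n)).2
  apply le_antisymm
  · refine csSup_le ⟨0, fun _ => 0, rfl, Or.inl ⟨0, ?_, ?_⟩⟩ hub
    · rw [noReversedForbidden_iff]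
      refine ⟨by simp [digitList], ?_⟩
      rintro B ⟨ε, -, hB⟩ hi
      have : B = [] := by simpa [digitList] using hi
      subst this
      split_ifs at hB with he
      · obtain ⟨m, -, hm⟩ := hB
        exact absurd hm (by simp)
      · rcases hB with hB | ⟨m, -, hm⟩
        · exact absurd hB (by simp [List.replicate_succ])
        · exact absurd hm (by simp)
    · simp [FiniteValue, fractionWord]
  · obtain ⟨b, t, hd, h0, hne⟩ := exists_dualSeq_radius hq3
    have hlim : Tendsto (fun m => fracVal q ((List.range (2 * m)).map b)) atTop
        (𝓝 (radius q)) := by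
      rw [tendsto_iff_norm_sub_tendsto_zero]
      refine squeeze_zero (fun _ => norm_nonneg _) (fun m => ?_)
        (tendsto_pow_atTop_nhds_zero_of_lt_one (rate_pos q).le (rate_lt_one hq3))
      rw [← h0]
      exact hd.abs_fracVal_sub_le hq3 m hne
    refine le_of_tendsto' hlim fun m => le_csSup ⟨_, hub⟩ ?_
    have ha := hd.admissible hq3 hne (2 * m)
    -- The digits are moved up by one place to make room for the leading digit `0`.
    let b' : ℕ → ℤ := fun i => i.casesOn 0 b
    have ha' : Admissible q (digitList b' (2 * m)) := ha
    refine ⟨b', rfl, Or.inl ⟨2 * m, (noReversedForbidden_iff _ _ _).2 ha', ?_⟩⟩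
    rw [FiniteValue, fractionWord_smul_zero hq3 _ _ ha']
    simp [b', digitList]

theorem r_eq {q : ℕ} (hq3 : 3 ≤ q) : r q = radius q - lam q := by rw [r, R_eq hq3]

/-! ### The dual generating map -/

lemma nearestDual_eq_of_pos {q : ℕ} (hq3 : 3 ≤ q) {w : ℝ} {b : ℤ} (hw : 0 < w)
    (h1 : radius q - lam q ≤ w - b * lam q) (h2 : w - b * lam q < radius q) :
    nearestDual q w = b := by
  have hl := one_le_lam hq3
  rw [nearestDual, if_pos hw, r_eq hq3, Int.floor_eq_iff, le_div_iff₀ (by linarith),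
    div_lt_iff₀ (by linarith)]
  constructor <;> linarith

/-- The definition is not symmetric at `w = 0`, so that point has to be excluded. -/
lemma nearestDual_neg {q : ℕ} {w : ℝ} (hw : w ≠ 0) : nearestDual q (-w) = -nearestDual q w := by
  unfold nearestDual
  rcases lt_or_gt_of_ne hw with h | h
  · rw [if_pos (by linarith), if_neg h.not_gt]; simp
  · rw [if_neg (by linarith), if_pos h]; simp

lemma Fdual_neg {q : ℕ} (y : ℝ) : Fdual q (-y) = -Fdual q y := by
  unfold Fdual
  by_cases hy : y = 0
  · simp [hy]
  · rw [if_neg (neg_ne_zero.2 hy), if_neg hy, div_neg,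
      nearestDual_neg (div_ne_zero (by norm_num) hy)]
    push_cast; ring

lemma Fdual_iterate_neg {q : ℕ} (y : ℝ) (n : ℕ) : (Fdual q)^[n] (-y) = -(Fdual q)^[n] y := by
  induction n with
  | zero => rfl
  | succ n ih => rw [Function.iterate_succ_apply', Function.iterate_succ_apply', ih, Fdual_neg]

/-- Steps into the half-open intervals are given by the dual generating map. -/
lemma Step.nearestDual_eq {q : ℕ} (hq3 : 3 ≤ q) {t t' : ℝ} {b : ℤ} (h : Step q t b t')
    (hne : |t'| ≠ radius q) : nearestDual q (-1 / t) = b := by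
  wlog ht : t < 0 generalizing t t' b
  · have h1 : 0 < t := lt_of_le_of_ne (not_lt.1 ht) h.ne.symm
    have := this h.neg (by rwa [abs_neg]) (by linarith)
    rw [div_neg, nearestDual_neg (div_ne_zero (by norm_num) h.ne)] at this
    omega
  obtain ⟨h1, h2⟩ := h.of_neg ht
  rw [h.eq] at h1
  refine nearestDual_eq_of_pos hq3 (div_pos_of_neg_of_neg (by norm_num) ht) h1 ?_
  rw [← h.eq]
  refine lt_of_le_of_ne h2 fun e => hne ?_
  rw [e, abs_of_pos (radius_pos hq3)]

lemma Step.Fdual_eq {q : ℕ} (hq3 : 3 ≤ q) {t t' : ℝ} {b : ℤ} (h : Step q t b t')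
    (hne : |t'| ≠ radius q) : Fdual q t = t' := by
  rw [Fdual, if_neg h.ne, h.nearestDual_eq hq3 hne, h.eq]

/-- The canonical step. -/
lemma step_Fdual {q : ℕ} (hq3 : 3 ≤ q) {t : ℝ} (ht : |t| ≤ radius q) (h0 : t ≠ 0) :
    Step q t (nearestDual q (-1 / t)) (Fdual q t) := by
  have hl := one_le_lam hq3
  have hF : Fdual q t = -1 / t - nearestDual q (-1 / t) * lam q := by rw [Fdual, if_neg h0]
  have key : ∀ s : ℝ, |s| ≤ radius q → s < 0 → 1 ≤ nearestDual q (-1 / s) ∧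
      radius q - lam q ≤ -1 / s - nearestDual q (-1 / s) * lam q ∧
      -1 / s - nearestDual q (-1 / s) * lam q ≤ radius q := by
    intro s hs hs0
    have hpos : 0 < -1 / s := div_pos_of_neg_of_neg (by norm_num) hs0
    have h1 : radius q ≤ -1 / s := by
      refine (radius_le_one_div hq3).trans ?_
      have e : -1 / s = 1 / -s := by rw [div_neg, neg_div]
      rw [e]
      rw [abs_of_neg hs0] at hs
      exact one_div_le_one_div_of_le (by linarith) hs
    have hn : nearestDual q (-1 / s) = ⌊(-1 / s - (radius q - lam q)) / lam q⌋ := by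
      rw [nearestDual, if_pos hpos, r_eq hq3]
    rw [hn]
    have h2 := Int.floor_le ((-1 / s - (radius q - lam q)) / lam q)
    have h3 := Int.lt_floor_add_one ((-1 / s - (radius q - lam q)) / lam q)
    rw [le_div_iff₀ (by linarith)] at h2
    rw [div_lt_iff₀ (by linarith)] at h3
    refine ⟨?_, by linarith, by linarith⟩
    rw [Int.le_floor, le_div_iff₀ (by linarith)]
    push_cast
    linarith
  refine ⟨h0, ?_, hF, fun h => ?_, fun h => ?_⟩
  · rcases lt_or_gt_of_ne h0 with h | h
    · have := (key t ht h).1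
      omega
    · have := (key (-t) (by rwa [abs_neg]) (by linarith)).1
      rw [div_neg, nearestDual_neg (div_ne_zero (by norm_num) h0)] at this
      omega
  · rw [hF]; exact (key t ht h).2
  · have := (key (-t) (by rwa [abs_neg]) (by linarith)).2
    rw [div_neg, nearestDual_neg (div_ne_zero (by norm_num) h0)] at this
    push_cast at this
    rw [hF]
    constructor <;> linarith

/-! ### The dual orbit of `-R` -/

lemma Fdual_eq_of_neg {q : ℕ} (hq3 : 3 ≤ q) {t t' : ℝ} {b : ℤ} (ht : t < 0)
    (h : t' = -1 / t - b * lam q) (h1 : radius q - lam q ≤ t') (h2 : t' < radius q) :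
    Fdual q t = t' := by
  rw [Fdual, if_neg ht.ne, nearestDual_eq_of_pos hq3 (div_pos_of_neg_of_neg (by norm_num) ht)
    (b := b) (by linarith) (by linarith), h]

lemma Fdual_mem_orbitSet {q : ℕ} (hq3 : 3 ≤ q) {t : ℝ} (ht : t ∈ orbitSet q) :
    Fdual q t ∈ orbitSet q ∧ 1 ≤ nearestDual q (-1 / t) := by
  obtain ⟨b, hb, t', ht', h1, h2, h3⟩ := orbitSet_step hq3 ht
  have hn := orbitSet_neg hq3 ht
  rw [Fdual_eq_of_neg hq3 hn h1 h2 h3, nearestDual_eq_of_pos hq3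
    (div_pos_of_neg_of_neg (by norm_num) hn) (b := b) (by linarith) (by linarith)]
  exact ⟨ht', hb⟩

lemma Fdual_iterate_mem_orbitSet {q : ℕ} (hq3 : 3 ≤ q) {t : ℝ} (ht : t ∈ orbitSet q) (n : ℕ) :
    (Fdual q)^[n] t ∈ orbitSet q := by
  induction n with
  | zero => exact ht
  | succ n ih => rw [Function.iterate_succ_apply']; exact (Fdual_mem_orbitSet hq3 ih).1

lemma orbitSet_lt {q : ℕ} (hq3 : 3 ≤ q) {t : ℝ} (ht : t ∈ orbitSet q) : t < radius q :=
  (orbitSet_neg hq3 ht).trans (radius_pos hq3)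

lemma aseq_mem {q k : ℕ} (hk : k ≤ hq q) : aseq q k ∈ orbitSet q := Or.inl ⟨k, hk, rfl⟩

lemma dseq_mem {q k : ℕ} (hk : k ≤ kq q) : dseq q k ∈ orbitSet q := Or.inr ⟨k, hk, rfl⟩

lemma Fdual_aseq {q k : ℕ} (hq3 : 3 ≤ q) (hk : k < hq q) : Fdual q (aseq q k) = aseq q (k + 1) :=
  Fdual_eq_of_neg hq3 (aseq_neg hq3 hk.le) (aseq_step q k)
    ((dseq_zero_le_aseq_one hq3).trans (aseq_le hq3 (by omega) (by omega)))
    (orbitSet_lt hq3 (aseq_mem hk))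

lemma Fdual_aseq_last {q : ℕ} (hq3 : 3 ≤ q) : Fdual q (aseq q (hq q)) = dseq q 0 :=
  Fdual_eq_of_neg hq3 (aseq_neg hq3 le_rfl) (aseq_step_last hq3) le_rfl
    (orbitSet_lt hq3 (dseq_mem (Nat.zero_le _)))

lemma Fdual_dseq {q k : ℕ} (hq3 : 3 ≤ q) (hk : k < kq q) : Fdual q (dseq q k) = dseq q (k + 1) :=
  Fdual_eq_of_neg hq3 (dseq_neg hq3 hk.le) (dseq_step q k)
    (dseq_le hq3 (Nat.zero_le _) (by omega)) (orbitSet_lt hq3 (dseq_mem hk))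

lemma Fdual_iterate_aseq {q k n : ℕ} (hq3 : 3 ≤ q) (hk : k + n ≤ hq q) :
    (Fdual q)^[n] (aseq q k) = aseq q (k + n) := by
  induction n with
  | zero => rfl
  | succ n ih =>
    rw [Function.iterate_succ_apply', ih (by omega), Fdual_aseq hq3 (by omega), add_assoc]

lemma Fdual_iterate_aseq_last {q k : ℕ} (hq3 : 3 ≤ q) (hk : k ≤ hq q) :
    (Fdual q)^[hq q - k + 1] (aseq q k) = dseq q 0 := by
  rw [Function.iterate_succ_apply', Fdual_iterate_aseq hq3 (by omega), Nat.add_sub_cancel' hk,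
    Fdual_aseq_last hq3]

lemma Fdual_iterate_dseq {q k n : ℕ} (hq3 : 3 ≤ q) (hk : k + n ≤ kq q) :
    (Fdual q)^[n] (dseq q k) = dseq q (k + n) := by
  induction n with
  | zero => rfl
  | succ n ih =>
    rw [Function.iterate_succ_apply', ih (by omega), Fdual_dseq hq3 (by omega), add_assoc]

lemma orbitSet_eq {q : ℕ} (hq3 : 3 ≤ q) :
    orbitSet q = {y | ∃ j, y = (Fdual q)^[j] (-radius q)} := by
  ext y
  constructor
  · rintro (⟨k, hk, rfl⟩ | ⟨k, hk, rfl⟩)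
    · refine ⟨k, ?_⟩
      rw [← aseq_zero, Fdual_iterate_aseq hq3 (by omega), zero_add]
    · refine ⟨k + (hq q - 0 + 1), ?_⟩
      rw [← aseq_zero, Function.iterate_add_apply, Fdual_iterate_aseq_last hq3 (Nat.zero_le _),
        Fdual_iterate_dseq hq3 (by omega), zero_add]
  · rintro ⟨j, rfl⟩
    exact Fdual_iterate_mem_orbitSet hq3 (aseq_mem (k := 0) (Nat.zero_le _)) j

/-- The canonical orbit of every point of the orbit of `-R` reaches `r`. -/
lemma exists_iterate_eq_r {q : ℕ} (hq3 : 3 ≤ q) {t : ℝ} (ht : t ∈ orbitSet q) :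
    ∃ n, (Fdual q)^[n] t = radius q - lam q := by
  rcases ht with ⟨k, hk, rfl⟩ | ⟨k, hk, rfl⟩
  · exact ⟨_, Fdual_iterate_aseq_last hq3 hk⟩
  have h1 : (Fdual q)^[kq q - k] (dseq q k) = dseq q (kq q) := by
    rw [Fdual_iterate_dseq hq3 (by omega), Nat.add_sub_cancel' hk]
  have d0 := orbitSet_lt hq3 (dseq_mem (q := q) (Nat.zero_le _))
  by_cases he : Even q
  · refine ⟨kq q - k + 1, ?_⟩
    rw [Function.iterate_succ_apply', h1, ← dseq_zero]
    exact Fdual_eq_of_neg hq3 (dseq_neg hq3 le_rfl) (dseq_step_last_even hq3 he) le_rfl d0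
  · by_cases h3 : q = 3
    · subst h3
      refine ⟨kq 3 - k + 1, ?_⟩
      rw [Function.iterate_succ_apply', h1, ← dseq_zero]
      exact Fdual_eq_of_neg hq3 (dseq_neg hq3 le_rfl) dseq_step_last_three le_rfl d0
    · have h4 := odd_hq_pos hq3 he h3
      have h5 : Fdual q (dseq q (kq q)) = aseq q 1 :=
        Fdual_eq_of_neg hq3 (dseq_neg hq3 le_rfl) (dseq_step_last_odd hq3 he)
          (dseq_zero_le_aseq_one hq3) (orbitSet_lt hq3 (aseq_mem h4))
      refine ⟨(hq q - 1 + 1) + 1 + (kq q - k), ?_⟩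
      rw [Function.iterate_add_apply, h1, Function.iterate_succ_apply, h5,
        Fdual_iterate_aseq_last hq3 h4, dseq_zero]

/-! ### Tails -/

lemma dualDigits_succ {q : ℕ} (hq3 : 3 ≤ q) {y : ℝ} (hy : |y| ≤ radius q) (j : ℕ) :
    dualDigits q y (j + 1) = nearestDual q (-1 / (Fdual q)^[j] y) := by
  have : dualLeading q y = 0 := by rw [dualLeading, R_eq hq3, if_pos hy]
  simp [dualDigits, this]

lemma abs_r_le {q : ℕ} (hq3 : 3 ≤ q) : |radius q - lam q| ≤ radius q := by
  have := lam_lt_two_mul_radius hq3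
  have := radius_lt_lam hq3
  have := radius_pos hq3
  rw [abs_le]
  constructor <;> linarith

/-- The orbit of `r` stays negative, so its digits are positive; those of `-r` are their negatives.
-/
lemma not_sameTail_r_neg_r {q : ℕ} (hq3 : 3 ≤ q) : ¬ SameTail q (r q) (-r q) := by
  rintro ⟨m, n, h⟩
  -- Offset `1` guarantees that neither digit is a leading one; both leading digits are `0` and
  -- carry no sign.
  have h1 := h 1
  have ha := abs_r_le hq3
  rw [r_eq hq3, dualDigits_succ hq3 ha, dualDigits_succ hq3 (by rwa [abs_neg]),
    Fdual_iterate_neg, div_neg] at h1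
  have h2 := fun j => Fdual_iterate_mem_orbitSet hq3 (dseq_mem (q := q) (Nat.zero_le _)) j
  have h3 := (Fdual_mem_orbitSet hq3 (h2 m)).2
  have h4 := (Fdual_mem_orbitSet hq3 (h2 n)).2
  rw [dseq_zero] at h3 h4
  rw [nearestDual_neg] at h1
  · omega
  · have := orbitSet_neg hq3 (h2 n)
    rw [dseq_zero] at this
    exact div_ne_zero (by norm_num) this.ne

/-- A dual regular expansion is determined by its digits. -/
lemma DualSeq.abs_sub_le {q : ℕ} (hq3 : 3 ≤ q) (m : ℕ) : ∀ {b : ℕ → ℤ} {t s : ℕ → ℝ},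
    DualSeq q b t → DualSeq q b s → |t 0 - s 0| ≤ 2 * rate q ^ m := by
  have hR := radius_le_one hq3
  induction m with
  | zero =>
    intro b t s ht hs
    have h1 := _root_.abs_le.1 ht.abs_zero
    have h2 := _root_.abs_le.1 hs.abs_zero
    rw [_root_.abs_le]
    constructor <;> linarith
  | succ m ih =>
    intro b t s ht hs
    have h := ih (ht.shift hq3 2) (hs.shift hq3 2)
    have key : ∀ n, t n - s n = t n * s n * (t (n + 1) - s (n + 1)) := by
      intro n
      have h1 := (ht.step n).ne
      have h2 := (hs.step n).ne
      rw [(ht.step n).eq, (hs.step n).eq]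
      field_simp
      ring
    have h3 : t 0 - s 0 = (t 0 * t 1) * (s 0 * s 1) * (t 2 - s 2) := by
      rw [key 0, key 1]; ring
    rw [h3, abs_mul, abs_mul, pow_succ']
    have h4 := (ht.step 0).abs_mul_le hq3 ht.abs_zero
    have h5 := ((hs.step 0).abs_mul_le hq3 hs.abs_zero).trans (rate_lt_one hq3).le
    have h6 := (rate_pos q).le
    calc _ ≤ rate q * 1 * (2 * rate q ^ m) := by
          gcongr
      _ = _ := by ring

lemma DualSeq.eq_of_digits {q : ℕ} (hq3 : 3 ≤ q) {b : ℕ → ℤ} {t s : ℕ → ℝ}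
    (ht : DualSeq q b t) (hs : DualSeq q b s) : t 0 = s 0 := by
  have h := (tendsto_pow_atTop_nhds_zero_of_lt_one (rate_pos q).le (rate_lt_one hq3)).const_mul 2
  rw [mul_zero] at h
  have := ge_of_tendsto' h fun m => ht.abs_sub_le hq3 m hs
  have := abs_nonpos_iff.1 this
  linarith

lemma dualSeq_Fdual {q : ℕ} (hq3 : 3 ≤ q) {t : ℝ} (ht : |t| ≤ radius q)
    (h0 : ∀ n, (Fdual q)^[n] t ≠ 0) :
    DualSeq q (fun n => nearestDual q (-1 / (Fdual q)^[n] t)) (fun n => (Fdual q)^[n] t) := by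
  have ha : ∀ n, |(Fdual q)^[n] t| ≤ radius q := by
    intro n
    induction n with
    | zero => exact ht
    | succ n ih =>
      rw [Function.iterate_succ_apply']
      exact (step_Fdual hq3 ih (h0 n)).abs_le hq3
  refine ⟨ht, fun n => ?_⟩
  rw [Function.iterate_succ_apply']
  exact step_Fdual hq3 (ha n) (h0 n)

/-- An expansion which avoids the boundary points and has the tail of `-r` does not exist. -/
lemma DualSeq.not_sameTail {q : ℕ} (hq3 : 3 ≤ q) {b : ℕ → ℤ} {t : ℕ → ℝ} (h : DualSeq q b t)
    (hR : ∀ n, |t n| ≠ radius q) (hr : ∀ n, t n ≠ -(radius q - lam q)) :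
    ¬ SameTail q (t 0) (-r q) := by
  have hF : ∀ n, (Fdual q)^[n] (t 0) = t n := by
    intro n
    induction n with
    | zero => rfl
    | succ n ih =>
      rw [Function.iterate_succ_apply', ih]
      exact (h.step n).Fdual_eq hq3 (hR (n + 1))
  rintro ⟨m, n, ht⟩
  have ha := abs_r_le hq3
  set s := fun j => (Fdual q)^[j] (radius q - lam q) with hs
  have hsm : ∀ j, s j ∈ orbitSet q := fun j =>
    Fdual_iterate_mem_orbitSet hq3 (dseq_mem (q := q) (Nat.zero_le _)) j
  have hs' := (dualSeq_Fdual hq3 ha fun j => (orbitSet_neg hq3 (hsm j)).ne).neg.shift hq3 n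
  have ht' := h.shift hq3 m
  have e : (fun j => b (m + j)) =
      fun j => -nearestDual q (-1 / (Fdual q)^[n + j] (radius q - lam q)) := by
    funext j
    have h1 := ht (j + 1)
    rw [r_eq hq3, ← add_assoc, ← add_assoc, dualDigits_succ hq3 h.abs_zero,
      dualDigits_succ hq3 (by rwa [abs_neg]), hF, (h.step _).nearestDual_eq hq3 (hR _),
      Fdual_iterate_neg, div_neg, nearestDual_neg] at h1
    · exact h1
    · exact div_ne_zero (by norm_num) (orbitSet_neg hq3 (hsm (n + j))).ne
  rw [e] at ht'
  have h1 := ht'.eq_of_digits hq3 hs'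
  simp only [add_zero] at h1
  -- Equal digits force equal values, so some `t_m` lies on the negated orbit of `r`. That orbit
  -- returns to `-r`, which the sequence is supposed to avoid.
  obtain ⟨k, hk⟩ := exists_iterate_eq_r hq3 (hsm n)
  apply hr (k + m)
  rw [← hF, Function.iterate_add_apply, hF, h1, Fdual_iterate_neg]
  exact congrArg _ hk

/-! ### The orbit of `-λ / 2` -/

/-- For `x < 0` the number `-1/x` is positive and is rounded by the ceiling branch of `floorOut`, so
the right end `λ/2` is included and the left end is not. -/
lemma F_eq_of_neg {q : ℕ} (hq3 : 3 ≤ q) {x x' : ℝ} {n : ℤ} (hx : x < 0) (h : x' = -1 / x - n * lam q)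
    (h1 : -lam q / 2 < x') (h2 : x' ≤ lam q / 2) : F q x = x' := by
  have hl := one_le_lam hq3
  have hw : 0 < -1 / x := div_pos_of_neg_of_neg (by norm_num) hx
  have hn : nearest q (-1 / x) = n := by
    have hp : 0 < -1 / x / lam q + 1 / 2 := by
      have : 0 < -1 / x / lam q := div_pos hw (by linarith)
      linarith
    have e : -1 / x / lam q + 1 / 2 = (-1 / x + lam q / 2) / lam q := by field_simp
    have hc : ⌈-1 / x / lam q + 1 / 2⌉ = n + 1 := by
      rw [e, Int.ceil_eq_iff, lt_div_iff₀ (by linarith), div_le_iff₀ (by linarith)]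
      push_cast
      constructor <;> linarith
    rw [nearest, floorOut, if_pos hp, hc]
    ring
  rw [F, if_neg hx.ne, hn, h]

lemma F_zero (q : ℕ) : F q 0 = 0 := if_pos rfl

lemma F_wseq {q i : ℕ} (hq3 : 3 ≤ q) (hi : i + 2 < q) (h : -lam q / 2 < wseq q i) :
    F q (wseq q (i + 1)) = wseq q i := by
  have hl := one_le_lam hq3
  refine F_eq_of_neg hq3 (n := 1) (wseq_neg (by omega) (by omega)) ?_ h ?_
  · rw [← U_wseq (by omega), U]; push_cast; ring
  · have := wseq_nonpos (q := q) (i := i) (by omega)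
    linarith

/-- The iterates of `-λ / 2` under `U`. -/
noncomputable def vseq (q k : ℕ) : ℝ := (U q)^[k] (-lam q / 2)

lemma vseq_succ (q k : ℕ) : vseq q (k + 1) = U q (vseq q k) := Function.iterate_succ_apply' _ _ _

lemma vseq_lt_wseq {q k : ℕ} (hq3 : 3 ≤ q) (ho : ¬ Even q) (hk : k ≤ hq q) :
    vseq q k < wseq q (hq q - k) := by
  have h1 := hq_succ_lt hq3
  apply iterate_U_lt_wseq
  · rw [Nat.sub_add_cancel hk, (wseq_odd hq3 ho).1]
    linarith [lam_lt_two hq3]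
  · omega

lemma vseq_neg {q k : ℕ} (hq3 : 3 ≤ q) (ho : ¬ Even q) (hk : k ≤ hq q) : vseq q k < 0 :=
  (vseq_lt_wseq hq3 ho hk).trans_le (wseq_nonpos (by have := hq_succ_lt hq3; omega))

/-- The formula for `U^{h+1}` sends the midpoint `-λ/2` to `1`; pulling back once gives the corner
`-1/(1 + λ)` of `Ω`. -/
lemma vseq_hq_succ {q : ℕ} (hq3 : 3 ≤ q) (ho : ¬ Even q) : vseq q (hq q + 1) = 1 := by
  have h2 := lam_lt_two hq3
  rw [vseq, iterate_U_hq_succ_odd hq3 ho fun k hk => (vseq_neg hq3 ho hk).ne, div_eq_one_iff_eq]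
  · ring
  · linarith

lemma vseq_hq {q : ℕ} (hq3 : 3 ≤ q) (ho : ¬ Even q) : vseq q (hq q) = -1 / (1 + lam q) := by
  have h1 := vseq_hq_succ hq3 ho
  have h2 := vseq_neg hq3 ho (le_refl (hq q))
  have hl := one_le_lam hq3
  rw [vseq_succ, U, sub_eq_iff_eq_add, div_eq_iff h2.ne] at h1
  rw [eq_div_iff (by linarith)]
  linarith

/-- Both sides are images under `U^{k+1}` of the pair `w_{h+1} = -1 < -λ/2 = v_0`. Together with
`vseq_lt_wseq` this interlaces the two chains. -/
lemma wseq_lt_vseq_succ {q k : ℕ} (hq3 : 3 ≤ q) (ho : ¬ Even q) (hk : k < hq q) :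
    wseq q (hq q - k) < vseq q (k + 1) := by
  have h1 := hq_succ_lt hq3
  have e1 : vseq q (k + 1) = (U q)^[k] (vseq q 1) := by
    unfold vseq; rw [← Function.iterate_add_apply]
  have e2 : wseq q (hq q - k) = (U q)^[k] (wseq q (hq q)) := by
    have e : hq q = (hq q - k) + k := by omega
    conv_rhs => rw [e]
    rw [iterate_U_wseq (by omega)]
  rw [e1, e2]
  apply iterate_U_lt
  · have hv : vseq q 0 < 0 := vseq_neg hq3 ho (Nat.zero_le _)
    rw [← U_wseq h1, vseq_succ q 0]
    refine U_lt_U ?_ hv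
    rw [(wseq_odd hq3 ho).2]
    show _ < -lam q / 2
    linarith [lam_lt_two hq3]
  · intro j hj
    have := vseq_neg (k := j + 1) hq3 ho (by omega)
    unfold vseq at this ⊢
    rwa [← Function.iterate_add_apply]

lemma vseq_ge {q k : ℕ} (hq3 : 3 ≤ q) (ho : ¬ Even q) (hk : k ≤ hq q) : -lam q / 2 ≤ vseq q k := by
  induction k with
  | zero => rfl
  | succ k ih =>
    rw [vseq_succ]
    exact (ih (by omega)).trans (lt_U hq3 (vseq_neg hq3 ho (by omega))).le

/-- The truncated subtraction matches the dynamics: once `0` is reached, `F` stays there. -/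
lemma F_iterate_even {q : ℕ} (hq3 : 3 ≤ q) (he : Even q) (j : ℕ) :
    (F q)^[j] (-lam q / 2) = wseq q (hq q - j) := by
  have h1 := hq_succ_lt hq3
  induction j with
  | zero => exact (wseq_even hq3 he).1.symm
  | succ j ih =>
    rw [Function.iterate_succ_apply', ih]
    rcases Nat.eq_zero_or_pos (hq q - j) with h | h
    · rw [h, show hq q - (j + 1) = 0 by omega, wseq_zero, F_zero]
    · obtain ⟨i, hi⟩ : ∃ i, hq q - j = i + 1 := ⟨hq q - j - 1, by omega⟩
      rw [hi, show hq q - (j + 1) = i by omega]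
      apply F_wseq hq3 (by omega)
      rw [← (wseq_even hq3 he).1]
      exact wseq_lt hq3 (by omega) (by omega)

lemma F_iterate_odd {q j : ℕ} (hq3 : 3 ≤ q) (ho : ¬ Even q) (hj : j ≤ hq q) :
    (F q)^[j] (-lam q / 2) = vseq q j := by
  induction j with
  | zero => rfl
  | succ j ih =>
    have hl := one_le_lam hq3
    have hv := vseq_neg hq3 ho (show j ≤ hq q by omega)
    rw [Function.iterate_succ_apply', ih (by omega)]
    refine F_eq_of_neg hq3 (n := 1) hv ?_ ?_ ?_
    · rw [vseq_succ, U]; push_cast; ring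
    · rw [vseq_succ]
      exact (vseq_ge hq3 ho (by omega)).trans_lt (lt_U hq3 hv)
    · linarith [vseq_neg hq3 ho hj]

lemma F_iterate_odd' {q : ℕ} (hq3 : 3 ≤ q) (ho : ¬ Even q) (j : ℕ) :
    (F q)^[hq q + 1 + j] (-lam q / 2) = wseq q (hq q - j) := by
  have h1 := hq_succ_lt hq3
  have hl := one_le_lam hq3
  have hl2 := lam_lt_two hq3
  have hw := (wseq_odd hq3 ho).1
  induction j with
  | zero =>
    rw [add_zero, Function.iterate_succ_apply', F_iterate_odd hq3 ho le_rfl, Nat.sub_zero, hw]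
    -- At `v_h = -1/(1 + λ)` the nearest multiple is `2λ`, and `1 + λ - 2λ = 1 - λ = w_h` switches
    -- to the chain that ends at `0`.
    refine F_eq_of_neg hq3 (n := 2) (vseq_neg hq3 ho le_rfl) ?_ ?_ ?_
    · rw [vseq_hq hq3 ho]
      push_cast
      field_simp
      ring
    · linarith
    · linarith
  | succ j ih =>
    rw [← add_assoc, Function.iterate_succ_apply', ih]
    rcases Nat.eq_zero_or_pos (hq q - j) with h | h
    · rw [h, show hq q - (j + 1) = 0 by omega, wseq_zero, F_zero]
    · obtain ⟨i, hi⟩ : ∃ i, hq q - j = i + 1 := ⟨hq q - j - 1, by omega⟩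
      rw [hi, show hq q - (j + 1) = i by omega]
      apply F_wseq hq3 (by omega)
      have := wseq_le hq3 (show i ≤ hq q by omega) (by omega)
      rw [hw] at this
      linarith

/-! ### The orderings of the orbits -/

/-- The points `φ_j`. -/
noncomputable def phi (q j : ℕ) : ℝ :=
  if Even q then wseq q (hq q - j)
  else if Even j then vseq q (j / 2) else wseq q (hq q - j / 2)

/-- The points `r_j`. -/
noncomputable def rho (q j : ℕ) : ℝ :=
  if j = 0 then -radius q
  else if Even q then dseq q (hq q - j)
  else if Even j then aseq q (hq q + 1 - j / 2) else dseq q (hq q - j / 2)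

lemma phi_odd_two_mul {q : ℕ} (ho : ¬ Even q) (i : ℕ) : phi q (2 * i) = vseq q i := by
  rw [phi, if_neg ho, if_pos (even_two_mul i), Nat.mul_div_cancel_left _ (by norm_num)]

lemma phi_odd_two_mul_add_one {q : ℕ} (ho : ¬ Even q) (i : ℕ) :
    phi q (2 * i + 1) = wseq q (hq q - i) := by
  rw [phi, if_neg ho, if_neg (by simp), show (2 * i + 1) / 2 = i by omega]

lemma rho_odd_two_mul {q : ℕ} (ho : ¬ Even q) {i : ℕ} (hi : 1 ≤ i) :
    rho q (2 * i) = aseq q (hq q + 1 - i) := by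
  rw [rho, if_neg (by omega), if_neg ho, if_pos (even_two_mul i),
    Nat.mul_div_cancel_left _ (by norm_num)]

lemma rho_odd_two_mul_add_one {q : ℕ} (ho : ¬ Even q) (i : ℕ) :
    rho q (2 * i + 1) = dseq q (hq q - i) := by
  rw [rho, if_neg (by omega), if_neg ho, if_neg (by simp), show (2 * i + 1) / 2 = i by omega]

lemma rho_even {q : ℕ} (he : Even q) {j : ℕ} (hj : 1 ≤ j) : rho q j = dseq q (hq q - j) := by
  rw [rho, if_neg (by omega), if_pos he]

lemma phi_even {q : ℕ} (he : Even q) (j : ℕ) : phi q j = wseq q (hq q - j) := by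
  rw [phi, if_pos he]

lemma kappa_even {q : ℕ} (he : Even q) : kappa q = hq q := if_pos he

lemma kappa_odd {q : ℕ} (ho : ¬ Even q) : kappa q = 2 * hq q + 1 := if_neg ho

/-- For even `q` the orbit is a single monotone chain. For odd `q` the two chains before and after
the digit `2` interlace and are listed alternately. -/
lemma isOrbitOrdering_phi {q : ℕ} (hq3 : 3 ≤ q) : IsOrbitOrdering q (phi q) := by
  have h1 := hq_succ_lt hq3
  by_cases he : Even q
  · refine ⟨?_, ?_, ?_⟩
    · intro i hi j hj hij
      rw [Set.mem_Iic, kappa_even he] at hi hj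
      rw [phi_even he, phi_even he]
      exact wseq_lt hq3 (by omega) (by omega)
    · rw [phi_even he]; exact (wseq_even hq3 he).1
    · ext x
      simp only [Set.mem_image, Set.mem_Iic, Set.mem_ofPred_eq, kappa_even he]
      simp_rw [F_iterate_even hq3 he, phi_even he]
      constructor
      · rintro ⟨j, -, rfl⟩; exact ⟨j, rfl⟩
      · rintro ⟨j, rfl⟩
        rcases le_total j (hq q) with h | h
        · exact ⟨j, h, rfl⟩
        · exact ⟨hq q, le_rfl, by congr 1; omega⟩
  · refine ⟨?_, ?_, ?_⟩
    · apply strictMonoOn_of_lt_add_one Set.ordConnected_Iic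
      intro j _ _ hj
      rw [Set.mem_Iic, kappa_odd he] at hj
      rcases Nat.even_or_odd' j with ⟨i, rfl | rfl⟩
      · rw [phi_odd_two_mul he, phi_odd_two_mul_add_one he]
        exact vseq_lt_wseq hq3 he (by omega)
      · rw [show 2 * i + 1 + 1 = 2 * (i + 1) by ring, phi_odd_two_mul he,
          phi_odd_two_mul_add_one he]
        exact wseq_lt_vseq_succ hq3 he (by omega)
    · exact phi_odd_two_mul he 0
    · ext x
      simp only [Set.mem_image, Set.mem_Iic, Set.mem_ofPred_eq, kappa_odd he]
      constructor
      · rintro ⟨j, hj, rfl⟩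
        rcases Nat.even_or_odd' j with ⟨i, rfl | rfl⟩
        · exact ⟨i, by rw [phi_odd_two_mul he, F_iterate_odd hq3 he (by omega)]⟩
        · exact ⟨hq q + 1 + i, by rw [phi_odd_two_mul_add_one he, F_iterate_odd' hq3 he]⟩
      · rintro ⟨j, rfl⟩
        rcases le_or_gt j (hq q) with h | h
        · exact ⟨2 * j, by omega, by rw [phi_odd_two_mul he, F_iterate_odd hq3 he h]⟩
        · obtain ⟨i, rfl⟩ : ∃ i, j = hq q + 1 + i := ⟨j - (hq q + 1), by omega⟩
          rw [F_iterate_odd' hq3 he]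
          rcases le_total i (hq q) with h | h
          · exact ⟨2 * i + 1, by omega, phi_odd_two_mul_add_one he i⟩
          · refine ⟨2 * hq q + 1, le_rfl, ?_⟩
            rw [phi_odd_two_mul_add_one he]; congr 1; omega

/-- For odd `q` the descending order rests on `d_k < a_{k+1}` and `a_k < d_k`, the interlacing of
the runs from `r` and from `-R`. For even `q` all points other than `-R` lie on the run from `r`. -/
lemma isDualOrbitOrdering_rho {q : ℕ} (hq3 : 3 ≤ q) : IsDualOrbitOrdering q (rho q) := by
  rw [IsDualOrbitOrdering, R_eq hq3, r_eq hq3, ← orbitSet_eq hq3]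
  refine ⟨if_pos rfl, ?_⟩
  by_cases he : Even q
  · obtain ⟨-, h1, h2⟩ := even_eq hq3 he
    rw [kappa_even he]
    refine ⟨?_, ?_, ?_, ?_⟩
    · apply strictAntiOn_of_add_one_lt Set.ordConnected_Icc
      intro j _ hj hj'
      rw [Set.mem_Icc] at hj hj'
      rw [rho_even he hj.1, rho_even he hj'.1, show hq q - j = hq q - (j + 1) + 1 by omega]
      exact dseq_lt_succ hq3 (by omega)
    · rw [rho_even he le_rfl]
      exact dseq_neg hq3 (by omega)
    · rw [rho_even he h1, Nat.sub_self, dseq_zero]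
    · ext y
      simp only [Set.mem_image, Set.mem_Iic]
      constructor
      · rintro ⟨j, hj, rfl⟩
        rcases Nat.eq_zero_or_pos j with rfl | hj0
        · exact aseq_mem (k := 0) (Nat.zero_le _)
        · rw [rho_even he hj0]
          exact dseq_mem (by omega)
      · have key : ∀ k ≤ kq q, ∃ j ≤ hq q, rho q j = dseq q k := fun k hk =>
          ⟨hq q - k, by omega, by
            rw [rho_even he (by omega)]; congr 1; omega⟩
        rintro (⟨k, hk, rfl⟩ | ⟨k, hk, rfl⟩)
        · cases k with
          | zero => exact ⟨0, Nat.zero_le _, if_pos rfl⟩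
          | succ k =>
            rw [← dseq_eq_aseq_succ he]
            exact key k (by omega)
        · exact key k hk
  · have h2 := (odd_eq hq3 he).2
    rw [kappa_odd he]
    refine ⟨?_, ?_, ?_, ?_⟩
    · apply strictAntiOn_of_add_one_lt Set.ordConnected_Icc
      intro j _ hj hj'
      rw [Set.mem_Icc] at hj hj'
      rcases Nat.even_or_odd' j with ⟨i, rfl | rfl⟩
      · rw [rho_odd_two_mul he (by omega), rho_odd_two_mul_add_one he,
          show hq q + 1 - i = hq q - i + 1 by omega]
        exact dseq_lt_aseq_succ_odd hq3 he (by omega)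
      · rw [show 2 * i + 1 + 1 = 2 * (i + 1) by ring, rho_odd_two_mul he (by omega),
          rho_odd_two_mul_add_one he, show hq q + 1 - (i + 1) = hq q - i by omega]
        exact aseq_lt_dseq hq3 (by omega)
    · rw [show 1 = 2 * 0 + 1 by rfl, rho_odd_two_mul_add_one he]
      exact dseq_neg hq3 (by omega)
    · rw [rho_odd_two_mul_add_one he, Nat.sub_self, dseq_zero]
    · ext y
      simp only [Set.mem_image, Set.mem_Iic]
      constructor
      · rintro ⟨j, hj, rfl⟩
        rcases Nat.eq_zero_or_pos j with rfl | hj0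
        · exact aseq_mem (k := 0) (Nat.zero_le _)
        rcases Nat.even_or_odd' j with ⟨i, rfl | rfl⟩
        · rw [rho_odd_two_mul he (by omega)]
          exact aseq_mem (by omega)
        · rw [rho_odd_two_mul_add_one he]
          exact dseq_mem (by omega)
      · rintro (⟨k, hk, rfl⟩ | ⟨k, hk, rfl⟩)
        · rcases Nat.eq_zero_or_pos k with rfl | hk0
          · exact ⟨0, Nat.zero_le _, if_pos rfl⟩
          · refine ⟨2 * (hq q + 1 - k), by omega, ?_⟩
            rw [rho_odd_two_mul he (by omega)]; congr 1; omega
        · refine ⟨2 * (hq q - k) + 1, by omega, ?_⟩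
          rw [rho_odd_two_mul_add_one he]; congr 1; omega

/-! ### Points of the domains -/

lemma neg_mem_Omega {q : ℕ} {p : ℝ × ℝ} (h : -p ∈ Omega q) : p ∈ Omega q := by
  obtain ⟨φ, ρ, h1, h2, j, h3, h4, h5⟩ := h
  rw [neg_neg] at h5
  exact ⟨φ, ρ, h1, h2, j, h3, h4, h5.symm⟩

lemma mem_Omega_of_rect {q : ℕ} (hq3 : 3 ≤ q) {j : ℕ} (h1 : 1 ≤ j) (h2 : j ≤ kappa q) {x y : ℝ}
    (hx : phi q (j - 1) ≤ x) (hx' : x < phi q j) (hy : rho q j ≤ y) (hy' : y ≤ radius q) :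
    (x, y) ∈ Omega q :=
  ⟨phi q, rho q, isOrbitOrdering_phi hq3, isDualOrbitOrdering_rho hq3, j, h1, h2,
    Or.inl ⟨⟨hx, hx'⟩, hy, by rwa [R_eq hq3]⟩⟩

lemma phi_kappa {q : ℕ} : phi q (kappa q) = 0 := by
  by_cases he : Even q
  · rw [kappa_even he, phi_even he, Nat.sub_self, wseq_zero]
  · rw [kappa_odd he, phi_odd_two_mul_add_one he, Nat.sub_self, wseq_zero]

/-- The bound `-1 / φ_{κ-1}`. -/
noncomputable def farBound (q : ℕ) : ℝ := if Even q then lam q else 1 + lam q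

lemma farBound_pos {q : ℕ} (hq3 : 3 ≤ q) : 0 < farBound q := by
  have := one_le_lam hq3
  unfold farBound
  split_ifs <;> linarith

lemma one_le_kappa {q : ℕ} (hq3 : 3 ≤ q) : 1 ≤ kappa q := by
  by_cases he : Even q
  · rw [kappa_even he]; exact (even_eq hq3 he).2.1
  · rw [kappa_odd he]; omega

lemma phi_kappa_sub_one {q : ℕ} (hq3 : 3 ≤ q) : phi q (kappa q - 1) = -1 / farBound q := by
  by_cases he : Even q
  · have := (even_eq hq3 he).2.1
    rw [kappa_even he, phi_even he, farBound, if_pos he, ← wseq_one hq3]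
    congr 1; omega
  · rw [kappa_odd he, Nat.add_sub_cancel, phi_odd_two_mul he, vseq_hq hq3 he, farBound, if_neg he]

lemma neg_one_div_le_one_div {B ξ : ℝ} (hB : 0 < B) (h : ξ ≤ -B) : -1 / B ≤ 1 / ξ := by
  have := one_div_le_one_div_of_le hB (show B ≤ -ξ by linarith)
  rw [div_neg] at this
  rw [neg_div]
  linarith

/-- The last rectangle, `j = κ`, whose vertical side is all of `[r, R]`. -/
lemma mem_Omega_far {q : ℕ} (hq3 : 3 ≤ q) {ξ η : ℝ} (h : ξ ≤ -farBound q)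
    (h1 : radius q - lam q ≤ η) (h2 : η ≤ radius q) : (1 / ξ, η) ∈ Omega q := by
  have hB := farBound_pos hq3
  refine mem_Omega_of_rect hq3 (one_le_kappa hq3) le_rfl ?_ ?_ ?_ h2
  · rw [phi_kappa_sub_one hq3]; exact neg_one_div_le_one_div hB h
  · rw [phi_kappa]
    exact one_div_neg.2 (by linarith)
  · rw [(isDualOrbitOrdering_rho hq3).2.2.2.1, r_eq hq3]; exact h1

/-- The last but one rectangle, `j = κ - 1 = 2h`, with the corners `φ_{2h-1} = -1/λ` and `r_{2h} =
a_1`; beyond `-(1 + λ)` the last rectangle takes over. -/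
lemma mem_Omega_near {q : ℕ} (hq3 : 3 ≤ q) (ho : ¬ Even q) (hne : q ≠ 3) {ξ η : ℝ}
    (h : ξ ≤ -lam q) (h1 : aseq q 1 ≤ η) (h2 : η ≤ radius q) : (1 / ξ, η) ∈ Omega q := by
  have hl := one_le_lam hq3
  have hh := odd_hq_pos hq3 ho hne
  by_cases hf : ξ ≤ -farBound q
  · exact mem_Omega_far hq3 hf ((dseq_zero_le_aseq_one hq3).trans h1) h2
  have hk := kappa_odd ho
  have hξ : ξ < 0 := by linarith
  refine mem_Omega_of_rect hq3 (j := 2 * hq q) (by omega) (by omega) ?_ ?_ ?_ h2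
  · rw [show 2 * hq q - 1 = 2 * (hq q - 1) + 1 by omega, phi_odd_two_mul_add_one ho,
      show hq q - (hq q - 1) = 1 by omega, wseq_one hq3]
    exact neg_one_div_le_one_div (by linarith) h
  · have e := phi_kappa_sub_one hq3
    rw [hk, Nat.add_sub_cancel] at e
    rw [e]
    have := one_div_lt_one_div_of_lt (show 0 < -ξ by linarith) (show -ξ < farBound q by linarith)
    rw [div_neg] at this
    rw [neg_div]
    linarith
  · rw [rho_odd_two_mul ho hh, Nat.add_sub_cancel_left]; exact h1

/-! ### Irrational points -/

lemma S_mem (q : ℕ) : S ∈ heckeGroup q := Subgroup.subset_closure (by simp)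

lemma T_mem (q : ℕ) : T q ∈ heckeGroup q := Subgroup.subset_closure (by simp)

lemma smul_mem_irrationalPoints {q : ℕ} {x x' : ℝ} (hx : x ∈ irrationalPoints q)
    {g : GL (Fin 2) ℝ} (hg : g ∈ heckeGroup q) (h : g • (x : OnePoint ℝ) = (x' : OnePoint ℝ)) :
    x' ∈ irrationalPoints q := by
  intro g' hg' e
  apply hx (g⁻¹ * g') (mul_mem (inv_mem hg) hg')
  rw [mul_smul, e, ← h, inv_smul_smul]

lemma smul_ne_infty {q : ℕ} {x : ℝ} (hx : x ∈ irrationalPoints q)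
    {g : GL (Fin 2) ℝ} (hg : g ∈ heckeGroup q) : g • (x : OnePoint ℝ) ≠ OnePoint.infty := by
  intro h
  apply hx g⁻¹ (inv_mem hg)
  rw [← h, inv_smul_smul]

lemma irrational_ne_zero {q : ℕ} {x : ℝ} (hx : x ∈ irrationalPoints q) : x ≠ 0 := by
  rintro rfl
  exact smul_ne_infty hx (S_mem q) S_smul_zero

/-- The reflection `z ↦ -z`. -/
noncomputable def reflection : GL (Fin 2) ℝ :=
  Matrix.GeneralLinearGroup.mkOfDetNeZero !![-1, 0; 0, 1] (by simp [Matrix.det_fin_two])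

lemma reflection_smul_coe (x : ℝ) : reflection • (x : OnePoint ℝ) = ((-x : ℝ) : OnePoint ℝ) := by
  rw [OnePoint.smul_some_eq_ite]
  simp [reflection]

lemma reflection_smul_infty : reflection • (OnePoint.infty : OnePoint ℝ) = OnePoint.infty := by
  rw [OnePoint.smul_infty_eq_ite]
  simp [reflection]

/-- Conjugation by `z ↦ -z` inverts both generators. This is why `ℝ^∞` is symmetric about `0`. -/
lemma reflection_conj_mem {q : ℕ} {g : GL (Fin 2) ℝ} (hg : g ∈ heckeGroup q) :
    reflection * g * reflection⁻¹ ∈ heckeGroup q := by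
  have hle : heckeGroup q ≤ (heckeGroup q).comap (MulAut.conj reflection).toMonoidHom := by
    rw [heckeGroup, Subgroup.closure_le]
    rintro g (rfl | rfl)
    · show reflection * S * reflection⁻¹ ∈ heckeGroup q
      have : reflection * S * reflection⁻¹ = S⁻¹ := by
        rw [mul_inv_eq_iff_eq_mul, eq_inv_mul_iff_mul_eq]
        ext i j
        fin_cases i <;> fin_cases j <;> simp [reflection, S, Matrix.mul_apply, Fin.sum_univ_two]
      rw [this]
      exact inv_mem (S_mem q)
    · show reflection * T q * reflection⁻¹ ∈ heckeGroup q
      have : reflection * T q * reflection⁻¹ = (T q)⁻¹ := by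
        rw [mul_inv_eq_iff_eq_mul, eq_inv_mul_iff_mul_eq]
        ext i j
        fin_cases i <;> fin_cases j <;> simp [reflection, T, Matrix.mul_apply, Fin.sum_univ_two]
      rw [this]
      exact inv_mem (T_mem q)
  exact hle hg

lemma neg_mem_irrationalPoints {q : ℕ} {x : ℝ} (hx : x ∈ irrationalPoints q) :
    -x ∈ irrationalPoints q := by
  intro g hg e
  apply hx _ (reflection_conj_mem hg)
  have h : reflection⁻¹ • (OnePoint.infty : OnePoint ℝ) = OnePoint.infty := by
    rw [inv_smul_eq_iff, reflection_smul_infty]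
  rw [mul_smul, mul_smul, h, e, reflection_smul_coe, neg_neg]

/-- The pair of endpoints belongs to the reduced domain up to sign, in one of the two ways that
are used. -/
def GoodPair (q : ℕ) (ξ η : ℝ) : Prop :=
  (ξ ≤ -farBound q ∧ radius q - lam q ≤ η ∧ η ≤ radius q) ∨
    (¬ Even q ∧ q ≠ 3 ∧ ξ ≤ -lam q ∧ aseq q 1 ≤ η ∧ η ≤ radius q)

lemma GoodPair.mem_Omega {q : ℕ} (hq3 : 3 ≤ q) {ξ η : ℝ} (h : GoodPair q ξ η) :
    (1 / ξ, η) ∈ Omega q := by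
  rcases h with ⟨h1, h2, h3⟩ | ⟨h1, h2, h3, h4, h5⟩
  · exact mem_Omega_far hq3 h1 h2 h3
  · exact mem_Omega_near hq3 h1 h2 h3 h4 h5

/-- The preimage of `(ξ, η)` is `(-1/ξ, -η)`; as `Ω` is symmetric under the point reflection, it
suffices to place `(1/ξ, η)` or its negative in `Ω`. -/
lemma mem_OmegaStar {q : ℕ} (hq3 : 3 ≤ q) {ξ η : ℝ} (hξ : ξ ∈ irrationalPoints q)
    (hη : η ∈ irrationalPoints q) (h : GoodPair q ξ η ∨ GoodPair q (-ξ) (-η)) :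
    (ξ, η) ∈ OmegaStar q := by
  have h0 := irrational_ne_zero hξ
  refine ⟨(-1 / ξ, -η), ⟨?_, ?_, neg_mem_irrationalPoints hη⟩, ?_⟩
  · rcases h with h | h
    · apply neg_mem_Omega
      convert h.mem_Omega hq3 using 1
      ext
      · simp [neg_div]
      · simp
    · convert h.mem_Omega hq3 using 1
      ext
      · simp [neg_div, div_neg]
      · simp
  · exact smul_mem_irrationalPoints hξ (S_mem q) (S_smul_coe h0)
  · ext
    · simp
    · simp

/-! ### Forward endpoints -/

/-- The forward endpoints along the reduction of a geodesic with backward endpoints `t`. -/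
structure FwdSeq (q : ℕ) (b : ℕ → ℤ) (t ξ : ℕ → ℝ) : Prop where
  ne_zero : ∀ n, ξ n ≠ 0
  ne : ∀ n, ξ n ≠ t n
  eq : ∀ n, ξ (n + 1) = -1 / ξ n - b n * lam q

lemma FwdSeq.neg {q : ℕ} {b : ℕ → ℤ} {t ξ : ℕ → ℝ} (h : FwdSeq q b t ξ) :
    FwdSeq q (fun n => -b n) (fun n => -t n) (fun n => -ξ n) where
  ne_zero n := neg_ne_zero.2 (h.ne_zero n)
  ne n := fun e => h.ne n (neg_injective e)
  eq n := by rw [h.eq, div_neg]; push_cast; ring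

lemma FwdSeq.shift {q : ℕ} {b : ℕ → ℤ} {t ξ : ℕ → ℝ} (h : FwdSeq q b t ξ) (m : ℕ) :
    FwdSeq q (fun n => b (m + n)) (fun n => t (m + n)) (fun n => ξ (m + n)) :=
  ⟨fun _ => h.ne_zero _, fun _ => h.ne _, fun _ => h.eq _⟩

/-- In the coordinate `1/(ξ - t)`, which sends the common backward endpoint to `∞`, the step is
affine with slope `t_n²`. Differences of two such coordinates are therefore just rescaled. -/
lemma FwdSeq.inv_sub {q : ℕ} {b : ℕ → ℤ} {t ξ : ℕ → ℝ} (h : FwdSeq q b t ξ)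
    (ht : DualSeq q b t) (n : ℕ) :
    1 / (ξ (n + 1) - t (n + 1)) = t n ^ 2 * (1 / (ξ n - t n)) + t n := by
  have h1 := h.ne_zero n
  have h2 := (ht.step n).ne
  have h3 := sub_ne_zero.2 (h.ne n)
  have e : ξ (n + 1) - t (n + 1) = (ξ n - t n) / (ξ n * t n) := by
    rw [h.eq, (ht.step n).eq]
    field_simp
    ring
  rw [e]
  field_simp
  ring

/-- Two geodesics with the same backward endpoint approach each other. -/
lemma FwdSeq.contract {q : ℕ} (hq3 : 3 ≤ q) {b : ℕ → ℤ} {t ξ ξ' : ℕ → ℝ} (ht : DualSeq q b t)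
    (h : FwdSeq q b t ξ) (h' : FwdSeq q b t ξ') {ε : ℝ} (hε : 0 < ε) :
    ∃ N, ∀ n ≥ N, |1 / (ξ n - t n) - 1 / (ξ' n - t n)| < ε := by
  set e : ℕ → ℝ := fun n => 1 / (ξ n - t n) - 1 / (ξ' n - t n) with he
  have hrec : ∀ n, e (n + 1) = t n ^ 2 * e n := by
    intro n
    simp only [he]
    rw [h.inv_sub ht, h'.inv_sub ht]
    ring
  have hanti : Antitone fun n => |e n| := by
    refine antitone_nat_of_succ_le fun n => ?_
    rw [hrec, abs_mul]
    have h1 := (ht.abs_le hq3 n).trans (radius_le_one hq3)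
    have h2 : |t n ^ 2| ≤ 1 := by
      rw [abs_pow]; exact pow_le_one₀ (abs_nonneg _) h1
    exact mul_le_of_le_one_left (abs_nonneg _) h2
  -- Strict contraction is only available over two steps; monotonicity fills in the odd indices.
  have hgeo : ∀ m, |e (2 * m)| ≤ rate q ^ m * |e 0| := by
    intro m
    induction m with
    | zero => simp
    | succ m ih =>
      have e1 : e (2 * (m + 1)) = (t (2 * m) * t (2 * m + 1)) ^ 2 * e (2 * m) := by
        rw [show 2 * (m + 1) = 2 * m + 1 + 1 by ring, hrec, hrec]; ring
      have h1 := (ht.step (2 * m)).abs_mul_le hq3 (ht.abs_le hq3 _)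
      have h2 : |(t (2 * m) * t (2 * m + 1)) ^ 2| ≤ rate q := by
        rw [abs_pow, sq]
        calc _ ≤ rate q * 1 := by
              apply mul_le_mul h1 (h1.trans (rate_lt_one hq3).le) (abs_nonneg _) (rate_pos q).le
          _ = _ := mul_one _
      rw [e1, abs_mul, pow_succ' (rate q), mul_assoc]
      exact mul_le_mul h2 ih (abs_nonneg _) (rate_pos q).le
  have hlim : Tendsto (fun m => rate q ^ m * |e 0|) atTop (𝓝 0) := by
    have := (tendsto_pow_atTop_nhds_zero_of_lt_one (rate_pos q).le
      (rate_lt_one hq3)).mul_const |e 0|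
    rwa [zero_mul] at this
  obtain ⟨m, hm⟩ := (hlim.eventually (gt_mem_nhds hε)).exists
  exact ⟨2 * m, fun n hn => ((hanti hn).trans (hgeo m)).trans_lt hm⟩

/-! ### Bounds for the forward endpoints -/

/-- A lower bound for the backward endpoint after a positive digit and `k` further digits `1`. -/
noncomputable def lowSeq (q k : ℕ) : ℝ := if Even q then dseq q k else aseq q k

lemma lowSeq_succ (q k : ℕ) : lowSeq q (k + 1) = U q (lowSeq q k) := by
  unfold lowSeq
  split_ifs
  · exact dseq_succ q k
  · exact aseq_succ q k

/-- The starting point of `lowSeq` depends on the parity so that both runs arrive exactly at `R`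
after `kq q + 1` steps. -/
lemma lowSeq_kq_succ {q : ℕ} (hq3 : 3 ≤ q) : lowSeq q (kq q + 1) = radius q := by
  unfold lowSeq
  split_ifs with he
  · exact dseq_kq_succ_even hq3 he
  · rw [(odd_eq hq3 he).2, aseq_hq_succ hq3]

lemma lowSeq_zero_le {q : ℕ} (hq3 : 3 ≤ q) : lowSeq q 0 ≤ radius q - lam q := by
  unfold lowSeq
  split_ifs with he
  · exact le_rfl
  · exact (aseq_lt_dseq hq3 (Nat.zero_le _)).le

/-- The forward endpoint is bounded in terms of the backward one, after a positive digit. -/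
def Low (q : ℕ) (ξ t : ℝ) : Prop := ∃ k ≤ kq q, ξ ≤ wseq q (q - 2 - k) ∧ lowSeq q k ≤ t

lemma Low.le_wseq {q : ℕ} (hq3 : 3 ≤ q) {ξ t : ℝ} (h : Low q ξ t) : ξ ≤ wseq q (hq q + 1) := by
  obtain ⟨k, hk, h1, -⟩ := h
  have := eq_hq_add_kq hq3
  exact h1.trans (wseq_le hq3 (by omega) (by omega))

lemma Low.le_neg_one {q : ℕ} (hq3 : 3 ≤ q) {ξ t : ℝ} (h : Low q ξ t) : ξ ≤ -1 :=
  (h.le_wseq hq3).trans (neg_one_div_wseq_hq_succ_le hq3).2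

lemma low_of_le {q : ℕ} (hq3 : 3 ≤ q) {ξ t : ℝ} (h : ξ ≤ -lam q) (ht : radius q - lam q ≤ t) :
    Low q ξ t :=
  ⟨0, Nat.zero_le _, by rwa [Nat.sub_zero, wseq_sub_two hq3], (lowSeq_zero_le hq3).trans ht⟩

lemma neg_one_div_le_neg_one_div {x y : ℝ} (hxy : x ≤ y) (hy : y < 0) : -1 / x ≤ -1 / y := by
  rw [neg_div, neg_div, neg_le_neg_iff]
  exact one_div_le_one_div_of_neg_of_le hy hxy

/-- A digit `1` moves both bounds one place along their runs. It cannot do so beyond `kq q`, since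
the backward endpoint would become `R`. A larger digit starts again at `k = 0`. -/
lemma Low.step {q : ℕ} (hq3 : 3 ≤ q) {ξ t t' : ℝ} {b : ℤ} (h : Low q ξ t) (hb : 0 < b)
    (hs : Step q t b t') (ht : |t| ≤ radius q) (hne : t' ≠ radius q) :
    Low q (-1 / ξ - b * lam q) t' := by
  have hl := one_le_lam hq3
  have hr := hs.range_of_pos hq3 ht hb
  have hw := neg_one_div_wseq_hq_succ_le hq3
  rcases (show (1 : ℤ) ≤ b by omega).eq_or_lt with rfl | hb2
  · have ht0 := hs.neg_of_pos hq3 ht hb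
    obtain ⟨k, hk, h1, h2⟩ := h
    have e1 := eq_hq_add_kq hq3
    have h3 : lowSeq q (k + 1) ≤ t' := by
      rw [lowSeq_succ, hs.eq_U_one]; exact U_le_U h2 ht0
    rcases hk.lt_or_eq with hk' | rfl
    · refine ⟨k + 1, hk', ?_, h3⟩
      have e2 : q - 2 - k = (q - 2 - (k + 1)) + 1 := by omega
      rw [e2] at h1
      have := U_le_U (q := q) h1 (wseq_neg (by omega) (by omega))
      rw [U_wseq (by omega)] at this
      convert this using 1
      rw [U]; push_cast; ring
    · rw [lowSeq_kq_succ hq3] at h3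
      exact absurd (le_antisymm hr.2 h3) hne
  -- The bound `ξ ≤ w_{h+1}` gives `-1/ξ ≤ λ`, and subtracting at least `2λ` leaves at most `-λ`.
  · apply low_of_le hq3 _ hr.1
    have hb' : (2 : ℝ) ≤ b := by exact_mod_cast hb2
    have h1 := neg_one_div_le_neg_one_div (h.le_wseq hq3) (by linarith)
    nlinarith

lemma low_step_of_pos {q : ℕ} (hq3 : 3 ≤ q) {ξ t t' : ℝ} {b : ℤ} (h : 0 < ξ) (hb : 0 < b)
    (hs : Step q t b t') (ht : |t| ≤ radius q) : Low q (-1 / ξ - b * lam q) t' := by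
  have hl := one_le_lam hq3
  apply low_of_le hq3 _ (hs.range_of_pos hq3 ht hb).1
  have hb' : (1 : ℝ) ≤ b := by exact_mod_cast hb
  have : 0 < 1 / ξ := by positivity
  rw [neg_div]
  nlinarith

/-- The forward endpoints of the geodesic which starts at `∞`. -/
noncomputable def refSeq (q : ℕ) (b : ℕ → ℤ) : ℕ → ℝ
  | 0 => -b 0 * lam q
  | n + 1 => -1 / refSeq q b n - b (n + 1) * lam q

lemma refSeq_neg (q : ℕ) (b : ℕ → ℤ) (n : ℕ) :
    refSeq q (fun n => -b n) n = -refSeq q b n := by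
  induction n with
  | zero => simp [refSeq]
  | succ n ih => rw [refSeq, ih, refSeq, div_neg]; push_cast; ring

/-- After a negative digit the mirrored bound makes the reference endpoint at least `1`, so a
following positive digit restarts the bound; after a positive digit `Low.step` continues it. -/
lemma low_refSeq {q : ℕ} (hq3 : 3 ≤ q) (n : ℕ) : ∀ {b : ℕ → ℤ} {t : ℕ → ℝ},
    DualSeq q b t → (∀ n, |t (n + 1)| ≠ radius q) → 0 < b n →
    Low q (refSeq q b n) (t (n + 1)) := by
  induction n with
  | zero =>
    intro b t h hne hb
    have hl := one_le_lam hq3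
    apply low_of_le hq3 _ ((h.step 0).range_of_pos hq3 h.abs_zero hb).1
    have hb' : (1 : ℝ) ≤ b 0 := by exact_mod_cast hb
    rw [refSeq]
    nlinarith
  | succ n ih =>
    intro b t h hne hb
    rcases lt_or_gt_of_ne (h.step n).digit_ne with hn | hn
    · have h1 := ih h.neg (by simpa using hne) (show 0 < -b n by omega)
      rw [refSeq_neg] at h1
      have := h1.le_neg_one hq3
      exact low_step_of_pos hq3 (by linarith) hb (h.step (n + 1)) (h.abs_le hq3 _)
    · refine (ih h hne hn).step hq3 hb (h.step (n + 1)) (h.abs_le hq3 _) fun e => ?_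
      apply hne (n + 1)
      rw [e, abs_of_pos (radius_pos hq3)]

/-- The reference endpoint lies beyond `±1` on one side, whereas `t` is confined to an interval
whose end on that side has modulus `λ - R < 1`. -/
lemma refSeq_bound {q : ℕ} (hq3 : 3 ≤ q) {b : ℕ → ℤ} {t : ℕ → ℝ}
    (h : DualSeq q b t) (hne : ∀ n, |t (n + 1)| ≠ radius q) (n : ℕ) :
    1 ≤ |refSeq q b n| ∧ refSeq q b n ≠ t (n + 1) := by
  have hr := lam_sub_one_lt_radius hq3
  rcases lt_or_gt_of_ne (h.step n).digit_ne with hn | hn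
  · have h1 := (low_refSeq hq3 n h.neg (by simpa using hne) (show 0 < -b n by omega)).le_neg_one hq3
    rw [refSeq_neg] at h1
    have h2 := (h.neg.step n).range_of_pos hq3 (h.neg.abs_le hq3 _) (show 0 < -b n by omega)
    refine ⟨by rw [le_abs]; left; linarith, fun e => ?_⟩
    rw [e] at h1
    linarith [h2.1]
  · have h1 := (low_refSeq hq3 n h hne hn).le_neg_one hq3
    have h2 := (h.step n).range_of_pos hq3 (h.abs_le hq3 _) hn
    refine ⟨by rw [le_abs]; right; linarith, fun e => ?_⟩
    rw [e] at h1
    linarith [h2.1]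

/-- Passing from the coordinate `1/(x - t)` back to `1/x` costs the factors `(x - t)/x` and `(z -
t)/z`, which are at most `4` and `2` in modulus when `|z| ≥ 1 ≥ |t|` and the error is at most `1/4`.
-/
lemma inv_sub_inv_le {x z t e : ℝ} (hx : x ≠ 0) (hxt : x ≠ t) (hz : 1 ≤ |z|) (hzt : z ≠ t)
    (ht : |t| ≤ 1) (he : |1 / (x - t) - 1 / (z - t)| < e) (he' : e ≤ 1 / 4) :
    |1 / x - 1 / z| < 8 * e := by
  have hz0 : z ≠ 0 := by
    rintro rfl
    rw [abs_zero] at hz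
    linarith
  have h1 := sub_ne_zero.2 hxt
  have h2 := sub_ne_zero.2 hzt
  set d := 1 / (x - t) - 1 / (z - t) with hd
  have e1 : 1 / x - 1 / z = d * ((x - t) / x) * ((z - t) / z) := by
    rw [hd]; field_simp; ring
  have e2 : (z - t) / z = 1 - t / z := by field_simp
  have h3 : |t / z| ≤ 1 := by
    rw [abs_div, div_le_one (by linarith)]; linarith
  have h4 : |(z - t) / z| ≤ 2 := by
    rw [e2]
    have := abs_le.1 h3
    rw [abs_le]
    constructor <;> linarith
  have e3 : x / (x - t) = z / (z - t) + t * d := by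
    rw [hd]; field_simp; ring
  have h5 : 1 / 2 ≤ |z / (z - t)| := by
    have h6 : |z / (z - t)| * |(z - t) / z| = 1 := by
      rw [← abs_mul, div_mul_div_cancel₀ h2, div_self hz0, abs_one]
    nlinarith [abs_nonneg (z / (z - t))]
  have h7 : |t * d| ≤ 1 / 4 := by
    rw [abs_mul]
    have := abs_nonneg d
    nlinarith
  have h8 : 1 / 4 ≤ |x / (x - t)| := by
    rw [e3]
    have := abs_sub_abs_le_abs_sub (z / (z - t)) (-(t * d))
    rw [sub_neg_eq_add, abs_neg] at this
    linarith
  have h9 : |(x - t) / x| ≤ 4 := by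
    have h6 : |x / (x - t)| * |(x - t) / x| = 1 := by
      rw [← abs_mul, div_mul_div_cancel₀ h1, div_self hx, abs_one]
    nlinarith [abs_nonneg ((x - t) / x)]
  rw [e1, abs_mul, abs_mul]
  have := abs_nonneg d
  calc |d| * |(x - t) / x| * |(z - t) / z| ≤ |d| * 4 * 2 := by gcongr
    _ < 8 * e := by linarith

lemma FwdSeq.approx {q : ℕ} (hq3 : 3 ≤ q) {b : ℕ → ℤ} {t ξ : ℕ → ℝ} (ht : DualSeq q b t)
    (h : FwdSeq q b t ξ) (hne : ∀ n, |t (n + 1)| ≠ radius q) {ε : ℝ} (hε : 0 < ε) :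
    ∃ N, ∀ n ≥ N, |1 / ξ (n + 1) - 1 / refSeq q b n| < ε ∧ |ξ (n + 1) - refSeq q b n| < ε := by
  have hb := refSeq_bound hq3 ht hne
  -- The geodesic from `∞` has a real forward endpoint only after one step, hence the shift by one.
  have hz : FwdSeq q (fun n => b (1 + n)) (fun n => t (1 + n)) (refSeq q b) := by
    refine ⟨fun n e => ?_, fun n => ?_, fun n => ?_⟩
    · have := (hb n).1
      rw [e, abs_zero] at this
      linarith
    · rw [add_comm]; exact (hb n).2
    · rw [add_comm 1 n]; rfl
  have key : ∃ N, ∀ n ≥ N, |1 / ξ (n + 1) - 1 / refSeq q b n| < ε := by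
    obtain ⟨N, hN⟩ := (h.shift 1).contract hq3 (ht.shift hq3 1) hz
      (show 0 < min (1 / 4) (ε / 8) by positivity)
    refine ⟨N, fun n hn => ?_⟩
    have h1 := hN n hn
    rw [add_comm 1 n] at h1
    have h2 := inv_sub_inv_le (h.ne_zero _) (h.ne _) (hb n).1 (hb n).2
      ((ht.abs_le hq3 _).trans (radius_le_one hq3)) h1 (min_le_left _ _)
    have := min_le_right (1 / 4) (ε / 8)
    linarith
  obtain ⟨N, hN⟩ := key
  -- Closeness of the endpoints themselves is closeness of their reciprocals one step earlier,
  -- because the same digit is subtracted from both.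
  refine ⟨N + 1, fun n hn => ⟨hN n (by omega), ?_⟩⟩
  obtain ⟨n, rfl⟩ : ∃ m, n = m + 1 := ⟨n - 1, by omega⟩
  have := hN n (by omega)
  rw [abs_sub_comm] at this
  rw [h.eq, refSeq]
  convert this using 2
  ring

/-! ### Expansions that avoid the boundary -/

/-- A change of sign: `-1/ξ` is negative, so the new endpoint is at most `-bλ`. For odd `q` and `b =
1` this only reaches `-λ`, but then `t' = U t ≥ U(-R) = a_1` permits the smaller rectangle. -/
lemma goodPair_of_pos {q : ℕ} (hq3 : 3 ≤ q) {ξ t t' : ℝ} {b : ℤ} (h : 0 < ξ) (hb : 0 < b)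
    (hs : Step q t b t') (ht : |t| ≤ radius q) (hne : t' ≠ radius q) :
    GoodPair q (-1 / ξ - b * lam q) t' := by
  have hl := one_le_lam hq3
  obtain ⟨h1, h2⟩ := hs.range_of_pos hq3 ht hb
  have hx : 0 < 1 / ξ := by positivity
  have hb' : (1 : ℝ) ≤ b := by exact_mod_cast hb
  have hle : -1 / ξ - b * lam q ≤ -(b * lam q) := by rw [neg_div]; linarith
  by_cases he : Even q
  · left
    refine ⟨?_, h1, h2⟩
    rw [farBound, if_pos he]
    nlinarith
  rcases (show (1 : ℤ) ≤ b by omega).eq_or_lt with rfl | hb2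
  · have ha : aseq q 1 ≤ t' := by
      have := U_le_U (q := q) (_root_.abs_le.1 ht).1 (hs.neg_of_pos hq3 ht hb)
      rwa [← hs.eq_U_one] at this
    right
    refine ⟨he, ?_, by push_cast at hle ⊢; linarith, ha, h2⟩
    -- For `q = 3` the run has length `h + 1 = 1`, so `a_1 = R` and the backward endpoint would be
    -- `R`.
    rintro rfl
    exact hne (le_antisymm h2 (aseq_hq_succ hq3 ▸ ha))
  · left
    refine ⟨?_, h1, h2⟩
    rw [farBound, if_neg he]
    have hb' : (2 : ℝ) ≤ b := by exact_mod_cast hb2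
    nlinarith

lemma DualSeq.exists_two_le {q : ℕ} (hq3 : 3 ≤ q) {b : ℕ → ℤ} {t : ℕ → ℝ}
    (h : DualSeq q b t) (hne : ∀ n, |t (n + 1)| ≠ radius q) {N : ℕ} (hb : ∀ n ≥ N, 0 < b n) :
    ∃ n ≥ N, 2 ≤ b (n + 1) := by
  by_contra! hc
  have := h.eq_radius_of_run hq3 (i := N + 1) fun k _ => by
    have h1 := hb (N + 1 + k) (by omega)
    have h2 := hc (N + k) (by omega)
    rw [show N + 1 + k = N + k + 1 by ring] at h1 ⊢
    omega
  apply hne (N + 1 + hq q)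
  rw [add_assoc, this, abs_of_pos (radius_pos hq3)]

/-- A run of digits `1` that starts with the forward endpoint at most `-λ` ends in a good pair. -/
lemma exists_goodPair_of_run {q : ℕ} (hq3 : 3 ≤ q) (ho : ¬ Even q) (h3 : q ≠ 3) {b : ℕ → ℤ}
    {t ξ : ℕ → ℝ} (ht : DualSeq q b t) (h : FwdSeq q b t ξ)
    (hne : ∀ n, |t (n + 1)| ≠ radius q) {m : ℕ} (hb : ∀ n ≥ m, 0 < b n)
    (hξ : ξ m ≤ -lam q) (hr : radius q - lam q ≤ t m) :
    ∃ n, GoodPair q (ξ (n + 1)) (t (n + 1)) := by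
  by_contra! hc
  have hl := one_le_lam hq3
  have hl2 := lam_lt_two hq3
  have hqe := (odd_eq hq3 ho).1
  have hqk := (odd_eq hq3 ho).2
  have key : ∀ k ≤ hq q, ξ (m + k) ≤ wseq q (q - 2 - k) ∧ dseq q k ≤ t (m + k) := by
    intro k
    induction k with
    | zero => intro _; exact ⟨by rwa [Nat.sub_zero, wseq_sub_two hq3], hr⟩
    | succ k ih =>
      intro hk
      obtain ⟨h1, h2⟩ := ih (by omega)
      have hs := ht.step (m + k)
      have hbk := hb (m + k) (by omega)
      have hrange := hs.range_of_pos hq3 (ht.abs_le hq3 _) hbk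
      have htn := hs.neg_of_pos hq3 (ht.abs_le hq3 _) hbk
      have e2 : q - 2 - k = (q - 2 - (k + 1)) + 1 := by omega
      rw [e2] at h1
      have h4 := U_le_U (q := q) h1 (wseq_neg (by omega) (by omega))
      rw [U_wseq (by omega)] at h4
      have e3 : ξ (m + k + 1) = U q (ξ (m + k)) - (b (m + k) - 1) * lam q := by
        rw [h.eq, U]; ring
      rcases (show (1 : ℤ) ≤ b (m + k) by omega).eq_or_lt with hb1 | hb2
      · rw [← add_assoc, e3, ← hb1]
        rw [← hb1] at hs
        refine ⟨by push_cast; linarith, ?_⟩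
        rw [hs.eq_U_one, dseq_succ]
        exact U_le_U h2 htn
      -- A digit at least `2` inside the run already gives a pair for the last rectangle: `U ξ ≤
      -- -1`, and at least one further `λ` is subtracted.
      · exfalso
        refine hc (m + k) (Or.inl ⟨?_, hrange⟩)
        have h5 := wseq_le hq3 (show hq q + 1 ≤ q - 2 - (k + 1) by omega) (by omega)
        rw [(wseq_odd hq3 ho).2] at h5
        have hb' : (2 : ℝ) ≤ b (m + k) := by exact_mod_cast hb2
        rw [e3, farBound, if_neg ho]
        nlinarith
  obtain ⟨h1, h2⟩ := key _ le_rfl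
  have hs := ht.step (m + hq q)
  have hbk := hb (m + hq q) (by omega)
  have hrange := hs.range_of_pos hq3 (ht.abs_le hq3 _) hbk
  have htn := hs.neg_of_pos hq3 (ht.abs_le hq3 _) hbk
  rw [show q - 2 - hq q = hq q + 1 by omega, (wseq_odd hq3 ho).2] at h1
  have h4 := neg_one_div_le_neg_one_div h1 (by norm_num)
  have h5 := U_le_U (q := q) h2 htn
  rw [← dseq_succ] at h5
  have hd := dseq_kq_succ_odd hq3 ho
  rw [hqk] at hd
  rw [hd] at h5
  have hξ' := h.eq (m + hq q)
  have hR := radius_le_one_div hq3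
  -- Now `ξ ≤ -1` and `U t ≥ 1/R`. A digit `1` would reach the boundary, a digit `2` gives `1 - 2λ ≤
  -- -λ` together with `a_1`, and a digit at least `3` gives at most `1 - 3λ ≤ -(1 + λ)`.
  rcases (show (1 : ℤ) ≤ b (m + hq q) by omega).eq_or_lt with hb1 | hb2
  · rw [← hb1] at hs
    rw [← hs.eq_U_one] at h5
    apply hne (m + hq q)
    rw [le_antisymm hrange.2 (hR.trans h5), abs_of_pos (radius_pos hq3)]
  rcases (show (2 : ℤ) ≤ b (m + hq q) by omega).eq_or_lt with hb2' | hb3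
  · rw [← hb2'] at hs hξ'
    refine hc (m + hq q) (Or.inr ⟨ho, h3, ?_, ?_, hrange.2⟩)
    · rw [hξ']; push_cast; norm_num at h4; linarith
    · rw [hs.eq_U, aseq_one]; push_cast; linarith
  · refine hc (m + hq q) (Or.inl ⟨?_, hrange⟩)
    have hb' : (3 : ℝ) ≤ b (m + hq q) := by exact_mod_cast (show (3 : ℤ) ≤ b (m + hq q) by omega)
    rw [hξ', farBound, if_neg ho]
    norm_num at h4
    nlinarith

/-- For `q = 3`, a positive digit after a positive digit is at least `3`. -/
lemma DualSeq.three_le {b : ℕ → ℤ} {t : ℕ → ℝ} (h : DualSeq 3 b t)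
    (hne : ∀ n, |t (n + 1)| ≠ radius 3) {n : ℕ} (h1 : 0 < b n) (h2 : 0 < b (n + 1)) :
    3 ≤ b (n + 1) := by
  have hq3 : 3 ≤ 3 := le_rfl
  have ho : ¬ Even 3 := by decide
  have hr := (h.step n).range_of_pos hq3 (h.abs_le hq3 _) h1
  have hs := h.step (n + 1)
  have hr' := hs.range_of_pos hq3 (h.abs_le hq3 _) h2
  have h4 := U_le_U (q := 3) hr.1 (hs.neg_of_pos hq3 (h.abs_le hq3 _) h2)
  have hd := dseq_kq_succ_odd hq3 ho
  have hk : kq 3 = 0 := by decide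
  rw [hk, zero_add, dseq_succ, dseq_zero, one_div_radius_odd hq3 ho] at hd
  rw [hd, lam_three] at h4
  by_contra! hc
  have hb : (b (n + 1) : ℝ) ≤ 2 := by exact_mod_cast (show b (n + 1) ≤ 2 by omega)
  apply hne (n + 1)
  have h5 : radius 3 ≤ t (n + 1 + 1) := by
    rw [hs.eq_U, lam_three]; linarith
  rw [le_antisymm hr'.2 h5, abs_of_pos (radius_pos hq3)]

/-- The tolerance `2/5` fits all cases: it is below `√2 - 1`, where `λ ≥ √2` for `q ≥ 4`, and for `q
= 3` the estimate `1/2 + 2/5 - 3 ≤ -2` is enough. -/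
lemma exists_goodPair_of_pos {q : ℕ} (hq3 : 3 ≤ q) {b : ℕ → ℤ} {t ξ : ℕ → ℝ}
    (ht : DualSeq q b t) (h : FwdSeq q b t ξ) (hne : ∀ n, |t (n + 1)| ≠ radius q) {N : ℕ}
    (hN : ∀ n ≥ N, |1 / ξ (n + 1) - 1 / refSeq q b n| < 2 / 5) (hb : ∀ n ≥ N, 0 < b n) :
    ∃ n, GoodPair q (ξ (n + 1)) (t (n + 1)) := by
  have hl := one_le_lam hq3
  have hlow := fun n (hn : n ≥ N) => low_refSeq hq3 n ht hne (hb n hn)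
  have hrange := fun n (hn : n ≥ N) => (ht.step n).range_of_pos hq3 (ht.abs_le hq3 _) (hb n hn)
  by_cases h3 : q = 3
  · subst h3
    have hb3 := fun n (hn : n ≥ N) => ht.three_le hne (hb n hn) (hb (n + 1) (by omega))
    refine ⟨N + 2, Or.inl ⟨?_, hrange (N + 2) (by omega)⟩⟩
    have h1 := (hlow N le_rfl).le_neg_one hq3
    have h2 : refSeq 3 b (N + 1) ≤ -2 := by
      have h4 := neg_one_div_le_neg_one_div h1 (by norm_num)
      have h5 : (3 : ℝ) ≤ b (N + 1) := by exact_mod_cast hb3 N le_rfl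
      rw [refSeq, lam_three]
      norm_num at h4
      linarith
    have h4 := neg_one_div_le_neg_one_div h2 (by norm_num)
    have h5 : (3 : ℝ) ≤ b (N + 2) := by exact_mod_cast hb3 (N + 1) (by omega)
    have h6 := abs_lt.1 (hN (N + 1) (by omega))
    rw [h.eq, lam_three, farBound, if_neg (by decide), lam_three]
    rw [neg_div] at h4 ⊢
    norm_num at h4 h6 ⊢
    linarith
  · obtain ⟨n, hn, hb2⟩ := ht.exists_two_le hq3 hne hb
    have h1 := (hlow n hn).le_wseq hq3
    have h2 := (neg_one_div_wseq_hq_succ_le hq3).2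
    have h4 := neg_one_div_le_neg_one_div h1 (by linarith)
    have h6 := abs_lt.1 (hN n hn)
    have hb' : (2 : ℝ) ≤ b (n + 1) := by exact_mod_cast hb2
    have hsq := two_le_lam_sq (q := q) (by omega)
    have hξ : ξ (n + 2) ≤ -lam q := by
      have h5 : -1 / wseq q (hq q + 1) + 2 / 5 ≤ lam q := by
        by_cases he : Even q
        · rw [(wseq_even hq3 he).2]
          have e : -1 / (-2 / lam q) = lam q / 2 := by field_simp
          rw [e]
          nlinarith
        · rw [(wseq_odd hq3 he).2]
          norm_num
          nlinarith
      rw [h.eq]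
      rw [neg_div] at h4 ⊢
      nlinarith
    by_cases he : Even q
    · refine ⟨n + 1, Or.inl ⟨?_, hrange (n + 1) (by omega)⟩⟩
      rw [farBound, if_pos he]
      exact hξ
    · exact exists_goodPair_of_run hq3 he h3 ht h hne (m := n + 2) (fun k hk => hb k (by omega)) hξ
        (hrange (n + 1) (by omega)).1

/-- Reduction, when the expansion of the backward endpoint avoids the boundary. -/
theorem exists_goodPair {q : ℕ} (hq3 : 3 ≤ q) {b : ℕ → ℤ} {t ξ : ℕ → ℝ} (ht : DualSeq q b t)
    (h : FwdSeq q b t ξ) (hne : ∀ n, |t (n + 1)| ≠ radius q) :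
    ∃ n, GoodPair q (ξ (n + 1)) (t (n + 1)) ∨ GoodPair q (-ξ (n + 1)) (-t (n + 1)) := by
  obtain ⟨N, hN⟩ := h.approx hq3 ht hne (show (0 : ℝ) < 2 / 5 by norm_num)
  have hne' : ∀ n, t (n + 1) ≠ radius q := fun n e => hne n (by
    rw [e, abs_of_pos (radius_pos hq3)])
  have hne'' : ∀ n, -t (n + 1) ≠ radius q := fun n e => hne n (by
    rw [← abs_neg, e, abs_of_pos (radius_pos hq3)])
  have hsign : ∀ n ≥ N, (0 < b n → ξ (n + 1) < 0) ∧ (b n < 0 → 0 < ξ (n + 1)) := by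
    intro n hn
    have h1 := abs_lt.1 (hN n hn).2
    constructor
    · intro hb
      have := (low_refSeq hq3 n ht hne hb).le_neg_one hq3
      linarith
    · intro hb
      have := (low_refSeq hq3 n ht.neg (by simpa using hne) (show 0 < -b n by omega)).le_neg_one hq3
      rw [refSeq_neg] at this
      linarith
  -- Beyond `N` the forward endpoint has the sign opposite to the preceding digit, so either kind of
  -- sign change gives a good pair immediately; without any, all later digits share one sign.
  by_cases hA : ∃ n ≥ N, b n < 0 ∧ 0 < b (n + 1)
  · obtain ⟨n, hn, h1, h2⟩ := hA
    refine ⟨n + 1, Or.inl ?_⟩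
    rw [h.eq]
    exact goodPair_of_pos hq3 ((hsign n hn).2 h1) h2 (ht.step _) (ht.abs_le hq3 _) (hne' _)
  by_cases hB : ∃ n ≥ N, 0 < b n ∧ b (n + 1) < 0
  · obtain ⟨n, hn, h1, h2⟩ := hB
    refine ⟨n + 1, Or.inr ?_⟩
    have := h.neg.eq (n + 1)
    rw [this]
    exact goodPair_of_pos hq3 (by linarith [(hsign n hn).1 h1]) (by omega) (ht.neg.step _)
      (ht.neg.abs_le hq3 _) (hne'' _)
  push Not at hA hB
  rcases lt_or_gt_of_ne (ht.step N).digit_ne with h0 | h0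
  · have hb : ∀ n ≥ N, 0 < -b n := by
      intro n hn
      induction n, hn using Nat.le_induction with
      | base => omega
      | succ n hn ih =>
        have := hA n hn (by omega)
        have := (ht.step (n + 1)).digit_ne
        omega
    obtain ⟨n, hn⟩ := exists_goodPair_of_pos hq3 ht.neg h.neg (by simpa using hne) (N := N)
      (fun n hn => by
        have := (hN n hn).1
        rw [refSeq_neg, div_neg, div_neg, ← abs_neg]
        convert this using 2
        ring) hb
    exact ⟨n, Or.inr hn⟩
  · have hb : ∀ n ≥ N, 0 < b n := by
      intro n hn
      induction n, hn using Nat.le_induction with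
      | base => omega
      | succ n hn ih =>
        have := hB n hn ih
        have := (ht.step (n + 1)).digit_ne
        omega
    obtain ⟨n, hn⟩ := exists_goodPair_of_pos hq3 ht h hne (fun n hn => (hN n hn).1) hb
    exact ⟨n, Or.inl hn⟩

/-! ### Expansions that meet the boundary -/

/-- The iterates of `1 / R`, the forward endpoint which belongs to `-R`. -/
noncomputable def bseq (q k : ℕ) : ℝ := (U q)^[k] (1 / radius q)

/-- The iterates of `-1 / R - λ`, the forward endpoint which belongs to `r`. -/
noncomputable def cseq (q k : ℕ) : ℝ := (U q)^[k] (-1 / radius q - lam q)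

lemma bseq_succ (q k : ℕ) : bseq q (k + 1) = U q (bseq q k) := Function.iterate_succ_apply' _ _ _

lemma cseq_succ (q k : ℕ) : cseq q (k + 1) = U q (cseq q k) := Function.iterate_succ_apply' _ _ _

lemma bseq_one (q : ℕ) : bseq q 1 = -radius q - lam q := by
  simp [bseq, U]

lemma iterate_U_neg_of_lt {q k : ℕ} (hq3 : 3 ≤ q) {x : ℝ} (hx : x < -lam q) (hk : k + 2 ≤ q) :
    (U q)^[k] x < 0 := by
  have := iterate_U_lt_wseq (q := q) (i := q - 2 - k) (k := k) (x := x)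
    (by rwa [Nat.sub_add_cancel (by omega), wseq_sub_two hq3]) (by omega)
  exact this.trans_le (wseq_nonpos (by omega))

lemma bseq_succ_neg {q k : ℕ} (hq3 : 3 ≤ q) (hk : k + 2 ≤ q) : bseq q (k + 1) < 0 := by
  have e : bseq q (k + 1) = (U q)^[k] (bseq q 1) := by
    unfold bseq; rw [← Function.iterate_add_apply]
  rw [e]
  apply iterate_U_neg_of_lt hq3 _ hk
  rw [bseq_one]
  linarith [radius_pos hq3]

lemma cseq_neg {q k : ℕ} (hq3 : 3 ≤ q) (hk : k + 2 ≤ q) : cseq q k < 0 := by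
  apply iterate_U_neg_of_lt hq3 _ hk
  have : 0 < 1 / radius q := one_div_pos.2 (radius_pos hq3)
  rw [neg_div]
  linarith

lemma bseq_ne_zero {q k : ℕ} (hq3 : 3 ≤ q) (hk : k ≤ hq q) : bseq q k ≠ 0 := by
  cases k with
  | zero => exact (one_div_pos.2 (radius_pos hq3)).ne'
  | succ k => exact (bseq_succ_neg hq3 (by have := hq_succ_lt hq3; omega)).ne

/-- While the backward endpoint runs from `-R` to `R`, its partner runs from `1/R` to `-1/R`: the
same power of `U` exchanges the two pairs up to sign. -/
lemma bseq_hq_succ {q : ℕ} (hq3 : 3 ≤ q) : bseq q (hq q + 1) = -1 / radius q := by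
  have hn : ∀ k ≤ hq q, (U q)^[k] (1 / radius q) ≠ 0 := fun k hk => bseq_ne_zero hq3 hk
  have hl := one_le_lam hq3
  have hR := radius_pos hq3
  by_cases he : Even q
  · rw [bseq, iterate_U_hq_succ_even hq3 he hn, radius_even he, div_eq_div_iff (by linarith)
      (by norm_num)]
    ring
  · have h := radius_odd he
    have h1 := one_div_radius_odd hq3 he
    have h2 : 0 < 1 / radius q := one_div_pos.2 hR
    rw [bseq, iterate_U_hq_succ_odd hq3 he hn, div_eq_div_iff (by linarith) hR.ne', h1]
    linarith

lemma cseq_eq_bseq_succ {q : ℕ} (he : Even q) (k : ℕ) : cseq q k = bseq q (k + 1) := by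
  have : bseq q 1 = -1 / radius q - lam q := by rw [bseq_one, radius_even he]; norm_num
  unfold cseq
  rw [← this]
  unfold bseq
  rw [← Function.iterate_add_apply]

lemma cseq_kq_succ_odd {q : ℕ} (hq3 : 3 ≤ q) (ho : ¬ Even q) :
    cseq q (kq q + 1) = -radius q := by
  have hk := (odd_eq hq3 ho).2
  have hn : ∀ k ≤ hq q, (U q)^[k] (-1 / radius q - lam q) ≠ 0 :=
    fun k hk' => (cseq_neg hq3 (by have := hq_succ_lt hq3; omega)).ne
  have hl := one_le_lam hq3
  have hR := radius_pos hq3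
  have h := radius_odd ho
  have h1 := one_div_radius_odd hq3 ho
  have h2 : -1 / radius q = -(radius q + 2 - lam q) := by rw [neg_div, h1]
  have hl2 := lam_lt_two hq3
  rw [hk, cseq, iterate_U_hq_succ_odd hq3 ho hn, h2, div_eq_iff (by linarith)]
  linarith

/-- The endpoints in which the reduction of an expansion that meets the boundary may stop. -/
def Target (q : ℕ) (ξ t : ℝ) : Prop :=
  (t = radius q ∧ ξ = -1 / radius q) ∨ (t = radius q - lam q ∧ ξ = -1 / radius q - lam q) ∨
    (t = -(radius q - lam q) ∧ ξ = 1 / radius q + lam q)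

/-- On the boundary the closed intervals leave no choice of digit except at the end of the run,
where `U a_h = R` may be kept by the digit `1` or moved to `r` by the digit `2`. Both outcomes are
targets. -/
lemma aseq_transition {q : ℕ} (hq3 : 3 ≤ q) {k : ℕ} (hk : k ≤ hq q) {b : ℤ} {t' : ℝ}
    (hs : Step q (aseq q k) b t') :
    (k < hq q ∧ -1 / bseq q k - b * lam q = bseq q (k + 1) ∧ t' = aseq q (k + 1)) ∨
      (k = hq q ∧ Target q (-1 / bseq q k - b * lam q) t') := by
  have hl := one_le_lam hq3
  have ht := aseq_neg hq3 hk
  have hR := radius_pos hq3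
  have ha : |aseq q k| ≤ radius q := by
    rw [_root_.abs_le]
    exact ⟨aseq_le hq3 (Nat.zero_le _) (by omega), by linarith⟩
  obtain ⟨h1, h2⟩ := hs.of_neg ht
  have hb := hs.one_le hq3 ha ht
  have e1 := hs.eq_U
  rw [← aseq_succ] at e1
  have e2 : -1 / bseq q k - b * lam q = bseq q (k + 1) - (b - 1) * lam q := by
    rw [bseq_succ, U]; ring
  rw [e2]
  rcases hk.lt_or_eq with hk' | rfl
  · left
    have h3 := aseq_neg hq3 (show k + 1 ≤ hq q from hk')
    have hb1 : b = 1 := by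
      by_contra hc
      have : (2 : ℝ) ≤ b := by exact_mod_cast (show (2 : ℤ) ≤ b by omega)
      nlinarith
    subst hb1
    refine ⟨hk', by push_cast; ring, by rw [e1]; push_cast; ring⟩
  · right
    refine ⟨rfl, ?_⟩
    rw [aseq_hq_succ hq3] at e1
    rw [bseq_hq_succ hq3]
    rcases hb.eq_or_lt with rfl | hb2
    · left
      exact ⟨by rw [e1]; push_cast; ring, by push_cast; ring⟩
    · have hb3 : b = 2 := by
        by_contra hc
        have : (3 : ℝ) ≤ b := by exact_mod_cast (show (3 : ℤ) ≤ b by omega)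
        nlinarith
      subst hb3
      right; left
      exact ⟨by rw [e1]; push_cast; ring, by push_cast; ring⟩

/-- For odd `q` the run ends at `1/R = R + 2 - λ > R`, so the last digit is at least `2`. It leads
to `a_1`, except for `q = 3`, where the digits `2` and `3` lead to `R` and `r`. For even `q` this is
the tail of the run from `-R`. -/
lemma dseq_transition {q : ℕ} (hq3 : 3 ≤ q) {k : ℕ} (hk : k ≤ kq q) {b : ℤ} {t' : ℝ}
    (hs : Step q (dseq q k) b t') :
    (k < kq q ∧ -1 / cseq q k - b * lam q = cseq q (k + 1) ∧ t' = dseq q (k + 1)) ∨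
      Target q (-1 / cseq q k - b * lam q) t' ∨
      (1 ≤ hq q ∧ -1 / cseq q k - b * lam q = bseq q 1 ∧ t' = aseq q 1) := by
  have hl := one_le_lam hq3
  by_cases he : Even q
  · have h1 := even_eq hq3 he
    rw [dseq_eq_aseq_succ he] at hs
    rw [cseq_eq_bseq_succ he, cseq_eq_bseq_succ he, dseq_eq_aseq_succ he]
    rcases aseq_transition hq3 (by omega) hs with ⟨h2, h3⟩ | ⟨-, h2⟩
    · exact Or.inl ⟨by omega, h3⟩
    · exact Or.inr (Or.inl h2)
  have ht := dseq_neg hq3 hk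
  have hR := radius_pos hq3
  have ha : |dseq q k| ≤ radius q := by
    have h1 := dseq_le hq3 (Nat.zero_le k) (by omega)
    have h2 := lam_lt_two_mul_radius hq3
    rw [dseq_zero] at h1
    rw [_root_.abs_le]
    constructor <;> linarith
  obtain ⟨h1, h2⟩ := hs.of_neg ht
  have hb := hs.one_le hq3 ha ht
  have e1 := hs.eq_U
  rw [← dseq_succ] at e1
  have e2 : -1 / cseq q k - b * lam q = cseq q (k + 1) - (b - 1) * lam q := by
    rw [cseq_succ, U]; ring
  rw [e2]
  rcases hk.lt_or_eq with hk' | rfl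
  · left
    have h3 := dseq_neg hq3 (show k + 1 ≤ kq q from hk')
    have hb1 : b = 1 := by
      by_contra hc
      have : (2 : ℝ) ≤ b := by exact_mod_cast (show (2 : ℤ) ≤ b by omega)
      nlinarith
    subst hb1
    refine ⟨hk', by push_cast; ring, by rw [e1]; push_cast; ring⟩
  · right
    have h4 := one_div_radius_odd hq3 he
    have h5 := radius_odd_lt_one hq3 he
    have h6 := lam_lt_two hq3
    rw [dseq_kq_succ_odd hq3 he] at e1
    rw [cseq_kq_succ_odd hq3 he]
    have hb1 : b ≠ 1 := by
      rintro rfl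
      push_cast at e1
      linarith
    rcases (show (2 : ℤ) ≤ b by omega).eq_or_lt with rfl | hb2
    · by_cases h3 : q = 3
      · left; left
        subst h3
        rw [lam_three] at *
        constructor
        · rw [e1]; push_cast; linarith
        · rw [neg_div, h4]; push_cast; ring
      · right
        refine ⟨odd_hq_pos hq3 he h3, ?_, ?_⟩
        · rw [bseq_one]; push_cast; ring
        · rw [e1, aseq_one]; push_cast; ring
    · have hb3 : b = 3 := by
        by_contra hc
        have : (4 : ℝ) ≤ b := by exact_mod_cast (show (4 : ℤ) ≤ b by omega)
        nlinarith
      subst hb3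
      have h3 : q = 3 := by
        by_contra hc
        have := two_le_lam_sq (q := q) (by omega)
        push_cast at e1
        nlinarith
      subst h3
      left; right; left
      rw [lam_three] at *
      constructor
      · rw [e1]; push_cast; linarith
      · rw [neg_div, h4]; push_cast; ring

/-- The pairs of endpoints on the closed geodesic through `(1 / R, -R)`. -/
def Paired (q : ℕ) (ξ t : ℝ) : Prop :=
  (∃ k ≤ hq q, ξ = bseq q k ∧ t = aseq q k) ∨ ∃ k ≤ kq q, ξ = cseq q k ∧ t = dseq q k

lemma Target.paired {q : ℕ} {ξ t : ℝ} (h : Target q ξ t) : Paired q ξ t ∨ Paired q (-ξ) (-t) := by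
  rcases h with ⟨rfl, rfl⟩ | ⟨rfl, rfl⟩ | ⟨rfl, rfl⟩
  · right; left
    exact ⟨0, Nat.zero_le _, by simp [bseq, neg_div], rfl⟩
  · left; right
    exact ⟨0, Nat.zero_le _, rfl, rfl⟩
  · right; right
    exact ⟨0, Nat.zero_le _, by simp only [cseq, Function.iterate_zero, id]; rw [neg_div]; ring,
      by rw [dseq_zero, neg_neg]⟩

lemma Paired.step {q : ℕ} (hq3 : 3 ≤ q) {ξ t t' : ℝ} {b : ℤ} (h : Paired q ξ t)
    (hs : Step q t b t') : Paired q (-1 / ξ - b * lam q) t' ∨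
      Paired q (-(-1 / ξ - b * lam q)) (-t') := by
  rcases h with ⟨k, hk, rfl, rfl⟩ | ⟨k, hk, rfl, rfl⟩
  · rcases aseq_transition hq3 hk hs with ⟨h1, h2⟩ | ⟨-, h1⟩
    · exact Or.inl (Or.inl ⟨k + 1, h1, h2⟩)
    · exact h1.paired
  · rcases dseq_transition hq3 hk hs with ⟨h1, h2⟩ | h1 | ⟨h1, h2⟩
    · exact Or.inl (Or.inr ⟨k + 1, h1, h2⟩)
    · exact h1.paired
    · exact Or.inl (Or.inl ⟨1, h1, h2⟩)

lemma paired_step {q : ℕ} (hq3 : 3 ≤ q) {ξ t t' : ℝ} {b : ℤ}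
    (h : Paired q ξ t ∨ Paired q (-ξ) (-t)) (hs : Step q t b t') :
    Paired q (-1 / ξ - b * lam q) t' ∨ Paired q (-(-1 / ξ - b * lam q)) (-t') := by
  rcases h with h | h
  · exact h.step hq3 hs
  · have := h.step hq3 hs.neg
    have e : -1 / -ξ - ((-b : ℤ) : ℝ) * lam q = -(-1 / ξ - b * lam q) := by
      rw [div_neg]; push_cast; ring
    rw [e, neg_neg, neg_neg] at this
    exact this.symm

lemma Paired.ne_zero {q : ℕ} (hq3 : 3 ≤ q) {ξ t : ℝ} (h : Paired q ξ t) : ξ ≠ 0 := by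
  rcases h with ⟨k, hk, rfl, rfl⟩ | ⟨k, hk, rfl, rfl⟩
  · exact bseq_ne_zero hq3 hk
  · exact (cseq_neg hq3 (by have := eq_hq_add_kq hq3; omega)).ne

lemma exists_target_of_aseq {q : ℕ} (hq3 : 3 ≤ q) {b : ℕ → ℤ} {t ξ : ℕ → ℝ}
    (ht : DualSeq q b t) (h : ∀ n, ξ (n + 1) = -1 / ξ n - b n * lam q) (j : ℕ) :
    ∀ k n, k + j = hq q → ξ n = bseq q k → t n = aseq q k → Target q (ξ (n + j + 1))
      (t (n + j + 1)) := by
  induction j with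
  | zero =>
    intro k n hk h1 h2
    have hs := ht.step n
    rw [h2] at hs
    rcases aseq_transition hq3 (by omega) hs with ⟨h3, -⟩ | ⟨-, h3⟩
    · omega
    · rw [← h1, ← h] at h3
      exact h3
  | succ j ih =>
    intro k n hk h1 h2
    have hs := ht.step n
    rw [h2] at hs
    rcases aseq_transition hq3 (by omega) hs with ⟨-, h3, h4⟩ | ⟨h3, -⟩
    · rw [← h1, ← h] at h3
      have := ih (k + 1) (n + 1) (by omega) h3 h4
      rwa [show n + (j + 1) + 1 = n + 1 + j + 1 by ring]
    · omega

lemma exists_target_of_dseq {q : ℕ} (hq3 : 3 ≤ q) {b : ℕ → ℤ} {t ξ : ℕ → ℝ}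
    (ht : DualSeq q b t) (h : ∀ n, ξ (n + 1) = -1 / ξ n - b n * lam q) (j : ℕ) :
    ∀ k n, k + j = kq q → ξ n = cseq q k → t n = dseq q k →
      ∃ m > n, Target q (ξ m) (t m) := by
  induction j with
  | zero =>
    intro k n hk h1 h2
    have hs := ht.step n
    rw [h2] at hs
    rcases dseq_transition hq3 (by omega) hs with ⟨h3, -⟩ | h3 | ⟨h3, h4, h5⟩
    · omega
    · rw [← h1, ← h] at h3
      exact ⟨n + 1, by omega, h3⟩
    · rw [← h1, ← h] at h4
      exact ⟨_, by omega, exists_target_of_aseq hq3 ht h (hq q - 1) 1 (n + 1) (by omega) h4 h5⟩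
  | succ j ih =>
    intro k n hk h1 h2
    have hs := ht.step n
    rw [h2] at hs
    rcases dseq_transition hq3 (by omega) hs with ⟨-, h3, h4⟩ | h3 | ⟨h3, h4, h5⟩
    · rw [← h1, ← h] at h3
      obtain ⟨m, hm, hm'⟩ := ih (k + 1) (n + 1) (by omega) h3 h4
      exact ⟨m, by omega, hm'⟩
    · rw [← h1, ← h] at h3
      exact ⟨n + 1, by omega, h3⟩
    · rw [← h1, ← h] at h4
      exact ⟨_, by omega, exists_target_of_aseq hq3 ht h (hq q - 1) 1 (n + 1) (by omega) h4 h5⟩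

lemma exists_target_of_neg_radius {q : ℕ} (hq3 : 3 ≤ q) {b : ℕ → ℤ} {t ξ : ℕ → ℝ}
    (ht : DualSeq q b t) (h : ∀ n, ξ (n + 1) = -1 / ξ n - b n * lam q) {n : ℕ}
    (h1 : t n = -radius q) (h2 : ξ n = 1 / radius q) : ∃ m > n, Target q (ξ m) (t m) :=
  ⟨_, by omega, exists_target_of_aseq hq3 ht h (hq q) 0 n (by omega) h2 h1⟩

/-- From `R` or `-r` the sequence is followed after negation, and the target found is negated back.
The negative of `R` is not a target, so `-R` is followed through one more run. -/
lemma Target.exists_next {q : ℕ} (hq3 : 3 ≤ q) {b : ℕ → ℤ} {t ξ : ℕ → ℝ}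
    (ht : DualSeq q b t) (h : ∀ n, ξ (n + 1) = -1 / ξ n - b n * lam q) {n : ℕ}
    (hn : Target q (ξ n) (t n)) : ∃ m > n, Target q (ξ m) (t m) := by
  have hneg : ∀ n, -ξ (n + 1) = -1 / -ξ n - ((-b n : ℤ) : ℝ) * lam q := by
    intro n
    rw [h, div_neg]; push_cast; ring
  have key : ∀ m > n, Target q (-ξ m) (-t m) → ∃ m > n, Target q (ξ m) (t m) := by
    intro m hm h1
    rcases h1 with ⟨h1, h2⟩ | ⟨h1, h2⟩ | ⟨h1, h2⟩
    · obtain ⟨m', hm', h3⟩ := exists_target_of_neg_radius hq3 ht h (n := m) (by linarith)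
        (by rw [neg_div] at h2; linarith)
      exact ⟨m', by omega, h3⟩
    · exact ⟨m, hm, Or.inr (Or.inr ⟨by linarith, by rw [neg_div] at h2; linarith⟩)⟩
    · exact ⟨m, hm, Or.inr (Or.inl ⟨by linarith, by rw [neg_div]; linarith⟩)⟩
  rcases hn with ⟨h1, h2⟩ | ⟨h1, h2⟩ | ⟨h1, h2⟩
  · obtain ⟨m, hm, h3⟩ := exists_target_of_neg_radius hq3 ht.neg (ξ := fun n => -ξ n) hneg
      (n := n) (by rw [h1]) (by rw [h2, neg_div, neg_neg])
    exact key m hm h3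
  · exact exists_target_of_dseq hq3 ht h (kq q) 0 n (by omega) h2 h1
  · obtain ⟨m, hm, h3⟩ := exists_target_of_dseq hq3 ht.neg (ξ := fun n => -ξ n) hneg (kq q) 0 n (by omega)
      (by rw [h2, cseq, Function.iterate_zero, id, neg_div]; ring) (by rw [h1, neg_neg]; rfl)
    exact key m hm h3

lemma abs_sub_lt_of_inv {x z t e D : ℝ} (hx : x ≠ t) (hD : |z - t| = D)
    (hD0 : 0 < D) (he : |1 / (x - t) - 1 / (z - t)| < e) (he' : e ≤ 1 / (2 * D)) :
    |x - z| < 2 * D ^ 2 * e := by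
  have h1 := sub_ne_zero.2 hx
  have h2 : z - t ≠ 0 := by
    intro h
    rw [h, abs_zero] at hD
    linarith
  set d := 1 / (x - t) - 1 / (z - t) with hd
  have e1 : x - z = -d * (x - t) * (z - t) := by
    rw [hd]; field_simp; ring
  have e2 : 1 / (x - t) = 1 / (z - t) + d := by rw [hd]; ring
  have h3 : 1 / (2 * D) ≤ 1 / |x - t| := by
    have h4 : |1 / (z - t)| = 1 / D := by rw [abs_div, abs_one, hD]
    have h5 := abs_sub_abs_le_abs_sub (1 / (z - t)) (-d)
    rw [sub_neg_eq_add, abs_neg, ← e2, h4, abs_div, abs_one] at h5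
    have h6 : 1 / D - 1 / (2 * D) = 1 / (2 * D) := by field_simp; ring
    linarith
  have h7 : |x - t| ≤ 2 * D := by
    rwa [one_div_le_one_div (by positivity) (abs_pos.2 h1)] at h3
  rw [e1, abs_mul, abs_mul, abs_neg, hD]
  have hd0 := abs_nonneg d
  calc |d| * |x - t| * D ≤ |d| * (2 * D) * D := by gcongr
    _ < e * (2 * D) * D := by gcongr
    _ = _ := by ring

/-- Reduction, when the expansion of the backward endpoint meets the boundary. -/
theorem exists_target {q : ℕ} (hq3 : 3 ≤ q) {b : ℕ → ℤ} {t ξ : ℕ → ℝ} (ht : DualSeq q b t)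
    (h : FwdSeq q b t ξ) {n₀ : ℕ}
    (hn₀ : |t n₀| = radius q ∨ t n₀ = -(radius q - lam q)) {ε : ℝ} (hε : 0 < ε) :
    ∃ n z, Target q z (t n) ∧ |ξ n - z| < ε := by
  have hR := radius_pos hq3
  have hl := one_le_lam hq3
  have hRi : 0 < 1 / radius q := one_div_pos.2 hR
  obtain ⟨z₀, hz₀⟩ : ∃ z₀, (Paired q z₀ (t n₀) ∨ Paired q (-z₀) (-t n₀)) ∧
      ((t n₀ = -radius q ∧ z₀ = 1 / radius q) ∨ Target q z₀ (t n₀)) := by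
    have h0 : ∀ z, Target q z (t n₀) → ∃ z₀, (Paired q z₀ (t n₀) ∨ Paired q (-z₀) (-t n₀)) ∧
      ((t n₀ = -radius q ∧ z₀ = 1 / radius q) ∨ Target q z₀ (t n₀)) :=
      fun z hz => ⟨z, hz.paired, Or.inr hz⟩
    rcases hn₀ with h1 | h1
    · rcases abs_choice (t n₀) with h2 | h2
      · exact h0 _ (Or.inl ⟨by linarith, rfl⟩)
      · have h3 : t n₀ = -radius q := by linarith
        exact ⟨_, Or.inl (Or.inl ⟨0, Nat.zero_le _, rfl, h3⟩), Or.inl ⟨h3, rfl⟩⟩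
    · exact h0 _ (Or.inr (Or.inr ⟨h1, rfl⟩))
  have hts := ht.shift hq3 n₀
  have hξs := h.shift n₀
  let z : ℕ → ℝ := fun n => Nat.rec z₀ (fun n x => -1 / x - b (n₀ + n) * lam q) n
  have hzs : ∀ n, z (n + 1) = -1 / z n - b (n₀ + n) * lam q := fun _ => rfl
  have hp : ∀ n, Paired q (z n) (t (n₀ + n)) ∨ Paired q (-z n) (-t (n₀ + n)) := by
    intro n
    induction n with
    | zero => exact hz₀.1
    | succ n ih =>
      rw [hzs]
      exact paired_step hq3 ih (hts.step n)
  have hz0 : ∀ n, z n ≠ 0 := by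
    intro n
    rcases hp n with h1 | h1
    · exact h1.ne_zero hq3
    · exact neg_ne_zero.1 (h1.ne_zero hq3)
  have hzt : ∀ n, z n ≠ t (n₀ + n) := by
    intro n
    induction n with
    | zero =>
      show z₀ ≠ t n₀
      rcases hz₀.2 with ⟨h1, h2⟩ | ⟨h1, h2⟩ | ⟨h1, h2⟩ | ⟨h1, h2⟩ <;> rw [h1, h2] <;>
        (try rw [neg_div]) <;> intro e <;> linarith
    | succ n ih =>
      rw [hzs, (hts.step n).eq]
      intro e
      apply ih
      have h1 : -1 / z n = -1 / t (n₀ + n) := by linarith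
      have h2 := (hts.step n).ne
      rw [div_eq_div_iff (hz0 n) h2] at h1
      linarith
  have hz : FwdSeq q (fun n => b (n₀ + n)) (fun n => t (n₀ + n)) z := ⟨hz0, hzt, hzs⟩
  have hinf : ∀ N, ∃ m ≥ N, Target q (z m) (t (n₀ + m)) := by
    intro N
    induction N with
    | zero =>
      rcases hz₀.2 with ⟨h1, h2⟩ | h1
      · obtain ⟨m, -, hm⟩ := exists_target_of_neg_radius hq3 hts hzs (n := 0) h1 h2
        exact ⟨m, Nat.zero_le _, hm⟩
      · exact ⟨0, le_rfl, h1⟩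
    | succ N ih =>
      obtain ⟨m, hm, h1⟩ := ih
      obtain ⟨m', hm', h2⟩ := h1.exists_next hq3 hts hzs
      exact ⟨m', by omega, h2⟩
  -- At each of the three targets the endpoints of the closed geodesic have the same distance `R +
  -- 1/R`, so one estimate converts the contraction into distances.
  set D := radius q + 1 / radius q with hDdef
  have hD : 0 < D := by positivity
  obtain ⟨N, hN⟩ := hξs.contract hq3 hts hz
    (show 0 < min (1 / (2 * D)) (ε / (2 * D ^ 2)) by positivity)
  obtain ⟨m, hm, hT⟩ := hinf N
  refine ⟨n₀ + m, z m, hT, ?_⟩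
  have hdist : |z m - t (n₀ + m)| = D := by
    rcases hT with ⟨h1, h2⟩ | ⟨h1, h2⟩ | ⟨h1, h2⟩
    · rw [h1, h2, abs_of_neg (by rw [neg_div]; linarith), neg_div]; ring
    · rw [h1, h2, abs_of_neg (by rw [neg_div]; linarith), neg_div]; ring
    · rw [h1, h2, abs_of_pos (by linarith)]; ring
  refine (abs_sub_lt_of_inv (hξs.ne m) hdist hD (hN m hm) (min_le_left _ _)).trans_le ?_
  have h1 := min_le_right (1 / (2 * D)) (ε / (2 * D ^ 2))
  have h2 : 0 < 2 * D ^ 2 := by positivity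
  rw [le_div_iff₀ h2] at h1
  linarith

/-! ### The action on irrational points -/

lemma T_zpow_irrational {q : ℕ} {x : ℝ} (hx : x ∈ irrationalPoints q) (n : ℤ) :
    x + n * lam q ∈ irrationalPoints q :=
  smul_mem_irrationalPoints hx (zpow_mem (T_mem q) n) (T_zpow_smul_coe q n x)

lemma S_irrational {q : ℕ} {x : ℝ} (hx : x ∈ irrationalPoints q) :
    -1 / x ∈ irrationalPoints q :=
  smul_mem_irrationalPoints hx (S_mem q) (S_smul_coe (irrational_ne_zero hx))

lemma step_irrational {q : ℕ} {x : ℝ} (hx : x ∈ irrationalPoints q) (n : ℤ) :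
    -1 / x - n * lam q ∈ irrationalPoints q := by
  have := T_zpow_irrational (S_irrational hx) (-n)
  push_cast at this
  rwa [neg_mul, ← sub_eq_add_neg] at this

lemma T_inv_smul_coe (q : ℕ) (x : ℝ) :
    (T q)⁻¹ • (x : OnePoint ℝ) = ((x - lam q : ℝ) : OnePoint ℝ) := by
  rw [inv_smul_eq_iff, T_smul_coe, sub_add_cancel]

lemma U_irrational {q : ℕ} {x : ℝ} (hx : x ∈ irrationalPoints q) :
    U q x ∈ irrationalPoints q := by
  have := step_irrational hx 1
  rwa [Int.cast_one, one_mul] at this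

lemma iterate_U_irrational {q : ℕ} {x : ℝ} (hx : x ∈ irrationalPoints q) (n : ℕ) :
    (U q)^[n] x ∈ irrationalPoints q := by
  induction n with
  | zero => exact hx
  | succ n ih => rw [Function.iterate_succ_apply']; exact U_irrational ih

lemma T_inv_mul_S_pow_smul {q : ℕ} {x : ℝ} (hx : x ∈ irrationalPoints q) (n : ℕ) :
    ((T q)⁻¹ * S) ^ n • (x : OnePoint ℝ) = (((U q)^[n] x : ℝ) : OnePoint ℝ) := by
  induction n with
  | zero => simp
  | succ n ih =>
    rw [pow_succ', mul_smul, ih, mul_smul,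
      S_smul_coe (irrational_ne_zero (iterate_U_irrational hx n)), T_inv_smul_coe,
      Function.iterate_succ_apply', U]

/-- Regrouping shows that the third map for odd `q` is `U^{h+1}` after the translation by `-2λ`, so
the explicit formula applies. -/
lemma T_inv_mul_pow (q n : ℕ) :
    (T q)⁻¹ * (S * (T q)⁻¹) ^ n * S = ((T q)⁻¹ * S) ^ (n + 1) := by
  induction n with
  | zero => simp
  | succ n ih =>
    rw [pow_succ _ (n + 1), ← ih, pow_succ]
    simp only [mul_assoc]

lemma reductionWord_mem (q : ℕ) (b : ℕ → ℤ) (n : ℕ) : reductionWord q b n ∈ heckeGroup q := by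
  induction n with
  | zero => exact zpow_mem (T_mem q) _
  | succ n ih => exact mul_mem (mul_mem (zpow_mem (T_mem q) _) (S_mem q)) ih

lemma finalMaps_subset {q : ℕ} {A : GL (Fin 2) ℝ} (hA : A ∈ finalMaps q) : A ∈ heckeGroup q := by
  have hT := inv_mem (T_mem q)
  rcases hA with rfl | rfl | rfl
  · exact one_mem _
  · exact hT
  · split_ifs
    · exact mul_mem (mul_mem hT (S_mem q)) hT
    · exact mul_mem (mul_mem (mul_mem hT (pow_mem (mul_mem (S_mem q) hT) _)) (S_mem q))
        (zpow_mem (T_mem q) _)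

/-- The images of a number under the reduction words. -/
noncomputable def reductionSeq (q : ℕ) (b : ℕ → ℤ) (x : ℝ) : ℕ → ℝ
  | 0 => x - b 0 * lam q
  | n + 1 => -1 / reductionSeq q b x n - b (n + 1) * lam q

lemma reductionSeq_irrational {q : ℕ} {x : ℝ} (hx : x ∈ irrationalPoints q) (b : ℕ → ℤ) (n : ℕ) :
    reductionSeq q b x n ∈ irrationalPoints q := by
  induction n with
  | zero =>
    have := T_zpow_irrational hx (-b 0)
    push_cast at this
    rwa [neg_mul, ← sub_eq_add_neg] at this
  | succ n ih => exact step_irrational ih _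

lemma reductionWord_smul {q : ℕ} {x : ℝ} (hx : x ∈ irrationalPoints q) (b : ℕ → ℤ) (n : ℕ) :
    reductionWord q b n • (x : OnePoint ℝ) = (reductionSeq q b x n : OnePoint ℝ) := by
  induction n with
  | zero =>
    rw [reductionWord, T_zpow_smul_coe, reductionSeq]
    push_cast
    rw [neg_mul, ← sub_eq_add_neg]
  | succ n ih =>
    rw [reductionWord, mul_smul, ih, mul_smul,
      S_smul_coe (irrational_ne_zero (reductionSeq_irrational hx b n)), T_zpow_smul_coe,
      reductionSeq]
    push_cast
    rw [neg_mul, ← sub_eq_add_neg]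

/-! ### Reduced geodesics -/

lemma smul_mem_reducedGeodesics {q : ℕ} (hq3 : 3 ≤ q) {γ : Geodesic} {g : GL (Fin 2) ℝ} {ξ η : ℝ}
    (h1 : g • γ.fwd = (ξ : OnePoint ℝ)) (h2 : g • γ.bwd = (η : OnePoint ℝ))
    (hξ : ξ ∈ irrationalPoints q) (hη : η ∈ irrationalPoints q)
    (h : GoodPair q ξ η ∨ GoodPair q (-ξ) (-η)) (ht : ¬ SameTail q η (-r q)) :
    g • γ ∈ reducedGeodesics q :=
  ⟨ξ, η, h1, h2, mem_OmegaStar hq3 hξ hη h, ht⟩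

/-- The bound that ensures that the neighbours of the closed geodesic are reduced. -/
lemma exists_margin {q : ℕ} (hq3 : 3 ≤ q) : ∃ ε > 0, ε < 1 / radius q ∧
    farBound q ≤ 1 / radius q + lam q - ε ∧
    (¬ Even q → ε < 1 / radius q - 1 ∧ 1 / radius q + ε ≤ 2 / lam q) := by
  have hR := radius_pos hq3
  have hl := one_le_lam hq3
  have h1 := lam_lt_two_mul_radius hq3
  have hRi : 0 < 1 / radius q := one_div_pos.2 hR
  by_cases he : Even q
  · refine ⟨1 / 2, by norm_num, ?_, ?_, fun h => absurd he h⟩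
    · rw [radius_even he]; norm_num
    · rw [radius_even he, farBound, if_pos he]; linarith
  · have h2 : 1 < 1 / radius q := by
      rw [lt_div_iff₀ hR, one_mul]
      exact radius_odd_lt_one hq3 he
    have h3 : 1 / radius q < 2 / lam q := by
      rw [div_lt_div_iff₀ hR (by linarith)]; linarith
    have h4 : 0 < min (1 / radius q - 1) (2 / lam q - 1 / radius q) :=
      lt_min (by linarith) (by linarith)
    have h5 := min_le_left (1 / radius q - 1) (2 / lam q - 1 / radius q)
    have h6 := min_le_right (1 / radius q - 1) (2 / lam q - 1 / radius q)
    refine ⟨min (1 / radius q - 1) (2 / lam q - 1 / radius q) / 2, by linarith, by linarith, ?_,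
      fun _ => ⟨by linarith, by linarith⟩⟩
    rw [farBound, if_neg he]
    linarith

/-- The last of the final maps moves the neighbours of the closed geodesic with the backward
endpoint `-r` to neighbours of the one with the backward endpoint `r`. -/
lemma exists_finalMap {q : ℕ} (hq3 : 3 ≤ q) {ε ξ : ℝ} (hε : ε < 1 / radius q)
    (ho : ¬ Even q → ε < 1 / radius q - 1 ∧ 1 / radius q + ε ≤ 2 / lam q)
    (hξ : ξ ∈ irrationalPoints q) (hr : -(radius q - lam q) ∈ irrationalPoints q)
    (h : |ξ - (1 / radius q + lam q)| < ε) :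
    ∃ A ∈ finalMaps q, ∃ ξ' : ℝ, A • (ξ : OnePoint ℝ) = (ξ' : OnePoint ℝ) ∧
      A • ((-(radius q - lam q) : ℝ) : OnePoint ℝ) = ((radius q - lam q : ℝ) : OnePoint ℝ) ∧
      ξ' ≤ -farBound q := by
  obtain ⟨h1, h2⟩ := abs_lt.1 h
  have hl := one_le_lam hq3
  refine ⟨_, Or.inr (Or.inr rfl), ?_⟩
  by_cases he : Even q
  · rw [if_pos he]
    have hp : 0 < ξ - lam q := by linarith
    refine ⟨-1 / (ξ - lam q) - lam q, ?_, ?_, ?_⟩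
    · rw [mul_smul, T_inv_smul_coe, mul_smul, S_smul_coe hp.ne', T_inv_smul_coe]
    · rw [mul_smul, T_inv_smul_coe, mul_smul, S_smul_coe, T_inv_smul_coe, radius_even he]
      · norm_num
      · rw [radius_even he]; norm_num
    · have := div_pos one_pos hp
      rw [farBound, if_pos he, neg_div]
      linarith
  · rw [if_neg he]
    obtain ⟨h3, h4⟩ := ho he
    have hR := radius_pos hq3
    have key : ∀ x ∈ irrationalPoints q,
        ((T q)⁻¹ * (S * (T q)⁻¹) ^ hq q * S * T q ^ (-2 : ℤ)) • (x : OnePoint ℝ) =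
          ((-(x - 2 * lam q + 1) / (x - lam q - 1) : ℝ) : OnePoint ℝ) := by
      intro x hx
      have hx' := T_zpow_irrational hx (-2)
      rw [mul_smul, T_zpow_smul_coe, T_inv_mul_pow, T_inv_mul_S_pow_smul hx',
        iterate_U_hq_succ_odd hq3 he
          fun k _ => irrational_ne_zero (iterate_U_irrational hx' k)]
      push_cast
      congr 2 <;> ring
    refine ⟨_, key ξ hξ, ?_, ?_⟩
    · rw [key _ hr, OnePoint.coe_eq_coe]
      have e := radius_odd he
      rw [div_eq_iff (by linarith)]
      linarith
    · have hp : 0 < ξ - lam q - 1 := by linarith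
      -- With `u = ξ - λ > 1`, the image is at most `-(1 + λ)` exactly when `λu ≤ 2`; this explains
      -- the bound `2/λ` on the margin.
      have h5 : ξ - lam q ≤ 2 / lam q := by linarith
      rw [le_div_iff₀ (by linarith)] at h5
      rw [farBound, if_neg he, div_le_iff₀ hp]
      nlinarith

/-- The reduction of a geodesic along a dual regular expansion of its backward endpoint. -/
theorem exists_reduced {q : ℕ} (hq3 : 3 ≤ q) {γ : Geodesic} (hγ : γ.EndpointsIrrational q)
    {b : ℕ → ℤ} {y : ℝ} (hy : γ.bwd = (y : OnePoint ℝ))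
    (ht : DualSeq q (fun n => b (n + 1)) (reductionSeq q b y)) :
    ∃ n : ℕ, ∃ A ∈ finalMaps q, (A * reductionWord q b n) • γ ∈ reducedGeodesics q := by
  obtain ⟨⟨x, hx, hxγ⟩, y', hy', hyγ⟩ := hγ
  obtain rfl : y = y' := by rwa [hy, OnePoint.coe_eq_coe] at hyγ
  have hξi := reductionSeq_irrational hx b
  have hti := reductionSeq_irrational hy' b
  have hwξ := reductionWord_smul hx b
  have hwt := reductionWord_smul hy' b
  rw [← hxγ] at hwξ
  rw [← hyγ] at hwt
  set t := reductionSeq q b y with htdef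
  set ξ := reductionSeq q b x with hξdef
  have hξ : FwdSeq q (fun n => b (n + 1)) t ξ := by
    refine ⟨fun n => irrational_ne_zero (hξi n), fun n e => γ.ne ?_, fun n => rfl⟩
    apply MulAction.injective (reductionWord q b n)
    show reductionWord q b n • γ.fwd = reductionWord q b n • γ.bwd
    rw [hwξ, hwt, e]
  by_cases hs : ∃ n, |t (n + 1)| = radius q ∨ t (n + 1) = -(radius q - lam q)
  · obtain ⟨n₀, hn₀⟩ := hs
    obtain ⟨ε, hε, hε1, hε2, hε3⟩ := exists_margin hq3
    obtain ⟨n, z, hz, hd⟩ := exists_target hq3 ht hξ hn₀ hε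
    have h1 := abs_lt.1 hd
    suffices ∃ A ∈ finalMaps q, ∃ ξ' : ℝ, A • (ξ n : OnePoint ℝ) = (ξ' : OnePoint ℝ) ∧
        A • (t n : OnePoint ℝ) = ((radius q - lam q : ℝ) : OnePoint ℝ) ∧ ξ' ≤ -farBound q by
      obtain ⟨A, hA, ξ', h2, h3, h4⟩ := this
      have hAG := finalMaps_subset hA
      refine ⟨n, A, hA, smul_mem_reducedGeodesics hq3 (ξ := ξ') (η := radius q - lam q)
        (by rw [mul_smul, hwξ, h2]) (by rw [mul_smul, hwt, h3])
        (smul_mem_irrationalPoints (hξi n) hAG h2) (smul_mem_irrationalPoints (hti n) hAG h3)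
        (Or.inl (Or.inl ⟨h4, le_rfl, ?_⟩)) ?_⟩
      · linarith [one_le_lam hq3]
      · rw [← r_eq hq3]
        exact not_sameTail_r_neg_r hq3
    -- The backward endpoints `R`, `r` and `-r` are sent to `r` by `T⁻¹`, by the identity and by the
    -- third map, respectively.
    rcases hz with ⟨h2, rfl⟩ | ⟨h2, rfl⟩ | ⟨h2, rfl⟩
    · refine ⟨_, Or.inr (Or.inl rfl), _, T_inv_smul_coe q _, ?_, ?_⟩
      · rw [h2, T_inv_smul_coe]
      · rw [neg_div] at h1
        linarith
    · refine ⟨1, Or.inl rfl, _, one_smul _ _, by rw [h2, one_smul], ?_⟩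
      rw [neg_div] at h1
      linarith
    · have h3 := hti n
      rw [h2] at h3 ⊢
      exact exists_finalMap hq3 hε1 hε3 (hξi n) h3 hd
  · push Not at hs
    obtain ⟨n, hn⟩ := exists_goodPair hq3 ht hξ fun n => (hs n).1
    refine ⟨n + 1, 1, Or.inl rfl, ?_⟩
    rw [one_mul]
    refine smul_mem_reducedGeodesics hq3 (hwξ _) (hwt _) (hξi _) (hti _) hn ?_
    have := (ht.shift hq3 (n + 1)).not_sameTail hq3 (fun m => ?_) (fun m => ?_)
    · exact this
    · rw [show n + 1 + m = n + m + 1 by ring]; exact (hs _).1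
    · rw [show n + 1 + m = n + m + 1 by ring]; exact (hs _).2

/-! ### Dual regular fractions -/

lemma S_smul_S_smul (p : OnePoint ℝ) : S • S • p = p := by
  cases p with
  | infty => rw [S_smul_infty, S_smul_zero]
  | coe x =>
    by_cases hx : x = 0
    · rw [hx, S_smul_zero, S_smul_infty]
    · rw [S_smul_coe hx, S_smul_coe (div_ne_zero (by norm_num) hx)]
      congr 1
      field_simp

lemma continuousAt_T_zpow_smul (q : ℕ) (n : ℤ) (x : ℝ) :
    ContinuousAt (fun p : OnePoint ℝ => T q ^ n • p) (x : OnePoint ℝ) := by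
  rw [OnePoint.continuousAt_coe]
  have : (fun p : OnePoint ℝ => T q ^ n • p) ∘ ((↑) : ℝ → OnePoint ℝ) =
      fun x => ((x + n * lam q : ℝ) : OnePoint ℝ) := by
    funext x; exact T_zpow_smul_coe q n x
  rw [this]
  exact (OnePoint.continuous_coe.comp (by fun_prop)).continuousAt

lemma continuousAt_S_smul {x : ℝ} (hx : x ≠ 0) :
    ContinuousAt (fun p : OnePoint ℝ => S • p) (x : OnePoint ℝ) := by
  rw [OnePoint.continuousAt_coe]
  have h1 : ContinuousAt (fun x : ℝ => ((-1 / x : ℝ) : OnePoint ℝ)) x :=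
    OnePoint.continuous_coe.continuousAt.comp (f := fun x : ℝ => -1 / x)
      (continuousAt_const.div continuousAt_id hx)
  refine h1.congr ?_
  filter_upwards [isOpen_ne.mem_nhds hx] with z hz
  exact (S_smul_coe hz).symm

lemma fractionWord_eq_mul (q : ℕ) (a : ℕ → ℤ) (n : ℕ) :
    fractionWord q a n = T q ^ a 0 * fractionWord q (shiftDigits a 1) n := by
  induction n with
  | zero => simp [fractionWord, shiftDigits]
  | succ n ih =>
    rw [fractionWord, ih, fractionWord, shiftDigits, add_comm 1 n]
    simp only [mul_assoc]

lemma InfiniteValue.eq_add {q : ℕ} {b : ℕ → ℤ} {y t : ℝ} (h : InfiniteValue q b y)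
    (ht : InfiniteValue q (shiftDigits b 1) t) : t = y - b 0 * lam q := by
  have h1 := (continuousAt_T_zpow_smul q (b 0) t).tendsto.comp ht
  have e : (fun p : OnePoint ℝ => T q ^ b 0 • p) ∘
      (fun n => fractionWord q (shiftDigits b 1) n • ((0 : ℝ) : OnePoint ℝ)) =
      fun n => fractionWord q b n • ((0 : ℝ) : OnePoint ℝ) := by
    funext n
    rw [fractionWord_eq_mul q b, mul_smul, Function.comp_apply]
  rw [e, T_zpow_smul_coe] at h1
  have := OnePoint.coe_eq_coe.1 (tendsto_nhds_unique h h1)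
  linarith

/-- Continuity of `S` at the nonzero value lets the first digit be stripped from the limit; the two
factors `S` cancel because `S²` acts trivially. -/
lemma InfiniteValue.shift_eq {q : ℕ} {b : ℕ → ℤ} {j : ℕ} {s t : ℝ} (hs : s ≠ 0)
    (h : InfiniteValue q (shiftDigits b j) s) (ht : InfiniteValue q (shiftDigits b (j + 1)) t) :
    t = -1 / s - b j * lam q := by
  have hval : InfiniteValue q (fun i => b (j + i)) (-1 / s) := by
    have h1 := (continuousAt_S_smul hs).tendsto.comp (h.comp (tendsto_add_atTop_nat 1))
    rw [S_smul_coe hs] at h1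
    unfold InfiniteValue
    convert h1 using 1
    funext n
    simp only [Function.comp_apply]
    rw [fractionWord_succ]
    simp only [shiftDigits, zpow_zero, one_mul, mul_smul, S_smul_S_smul]
  have e : shiftDigits (fun i => b (j + i)) 1 = shiftDigits b (j + 1) := by
    funext i
    cases i with
    | zero => rfl
    | succ i => simp only [shiftDigits, add_assoc]
  have := hval.eq_add (by rwa [e])
  simpa using this

/-- Irrationality of `y` keeps every shifted value nonzero, so the values in the definition are
forced to be the images of `y` under the reduction words. -/
lemma IsDualRegular.dualSeq {q : ℕ} (hq3 : 3 ≤ q) {b : ℕ → ℤ} {y : ℝ} (h : IsDualRegular q b y)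
    (hy : y ∈ irrationalPoints q) :
    DualSeq q (fun n => b (n + 1)) (reductionSeq q b y) := by
  obtain ⟨hb, hv, t, ht, h0, h1, h2⟩ := h
  rw [R_eq hq3] at h0 h1 h2
  rw [r_eq hq3] at h1 h2
  have hi := reductionSeq_irrational hy b
  have e : ∀ n, reductionSeq q b y n = t (n + 1) := by
    intro n
    induction n with
    | zero => exact (hv.eq_add (ht 1 le_rfl)).symm
    | succ n ih =>
      have hne := irrational_ne_zero (hi n)
      rw [reductionSeq, ih]
      rw [ih] at hne
      exact ((ht (n + 1) (by omega)).shift_eq hne (ht (n + 2) (by omega))).symm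
  refine ⟨?_, fun n => ⟨irrational_ne_zero (hi n), hb _ (by omega), rfl, fun hn => ?_,
    fun hn => ?_⟩⟩
  · by_cases hb0 : b 0 = 0
    · rw [reductionSeq, hb0, Int.cast_zero, zero_mul, sub_zero]
      exact abs_le.2 (h0 hb0)
    · obtain ⟨z, hz, hz'⟩ := h1 hb0
      have hr := lam_lt_two_mul_radius hq3
      rw [e, ← hz']
      have hz1 : |z| ≤ radius q := abs_le.2 ⟨by linarith [hz.1], hz.2⟩
      have hs : |((b 0).sign : ℝ)| = 1 := by
        rcases lt_or_gt_of_ne hb0 with h | h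
        · simp [Int.sign_eq_neg_one_of_neg h]
        · simp [Int.sign_eq_one_of_pos h]
      rw [abs_mul, hs, one_mul]
      exact hz1
  · obtain ⟨z, hz, hz'⟩ := h2 (n + 1) (by omega)
    rw [e] at hn
    simp only [Real.sign_of_pos (show (0 : ℝ) < -t (n + 1) by linarith), one_mul] at hz'
    rw [e, ← hz']
    exact hz
  · obtain ⟨z, hz, hz'⟩ := h2 (n + 1) (by omega)
    rw [e] at hn
    simp only [Real.sign_of_neg (show -t (n + 1) < 0 by linarith), neg_one_mul] at hz'
    rw [e, ← hz']
    constructor <;> linarith [hz.1, hz.2]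

lemma exists_dualSeq {q : ℕ} (hq3 : 3 ≤ q) {y : ℝ} (hy : y ∈ irrationalPoints q) :
    ∃ b : ℕ → ℤ, DualSeq q (fun n => b (n + 1)) (reductionSeq q b y) := by
  have hl := one_le_lam hq3
  have hr := lam_lt_two_mul_radius hq3
  -- The leading digit is taken with `y - mλ ∈ [r, R)`, unlike that of `c_q^*`. The later argument
  -- only needs `|y - mλ| ≤ R`.
  set m := ⌊(y - (radius q - lam q)) / lam q⌋ with hm
  have h1 := Int.floor_le ((y - (radius q - lam q)) / lam q)
  have h2 := Int.lt_floor_add_one ((y - (radius q - lam q)) / lam q)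
  rw [← hm, le_div_iff₀ (by linarith)] at h1
  rw [← hm, div_lt_iff₀ (by linarith)] at h2
  let b : ℕ → ℤ := fun n => n.casesOn m
    fun n => nearestDual q (-1 / (Fdual q)^[n] (y - m * lam q))
  have hi := reductionSeq_irrational hy b
  have e : ∀ n, reductionSeq q b y n = (Fdual q)^[n] (y - m * lam q) := by
    intro n
    induction n with
    | zero => rfl
    | succ n ih =>
      have h0 := irrational_ne_zero (hi n)
      rw [Function.iterate_succ_apply', reductionSeq, ih]
      rw [ih] at h0
      rw [Fdual, if_neg h0]
  refine ⟨b, ?_⟩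
  have := dualSeq_Fdual hq3 (t := y - m * lam q) (abs_le.2 ⟨by linarith, by linarith⟩)
    fun n => by rw [← e]; exact irrational_ne_zero (hi n)
  rw [funext e]
  exact this

end Hecke

theorem mainTheorem7 (q : ℕ) (hq3 : 3 ≤ q) :
    (∀ (γ : Hecke.Geodesic) (b : ℕ → ℤ) (y : ℝ),
      γ.EndpointsIrrational q → γ.bwd = (y : OnePoint ℝ) → Hecke.IsDualRegular q b y →
        ∃ n : ℕ, ∃ A ∈ Hecke.finalMaps q,
          (A * Hecke.reductionWord q b n) • γ ∈ Hecke.reducedGeodesics q) ∧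
    (∀ c : Hecke.QuotientGeodesic q,
      (∀ γ : Hecke.Geodesic, Hecke.project q γ = c → γ.EndpointsIrrational q) →
        ∃ γ ∈ Hecke.reducedGeodesics q, Hecke.project q γ = c) := by
  constructor
  · intro γ b y hγ hy hb
    obtain ⟨-, y', hy', e⟩ := id hγ
    obtain rfl : y = y' := by rwa [hy, OnePoint.coe_eq_coe] at e
    exact Hecke.exists_reduced hq3 hγ hy (hb.dualSeq hq3 hy')
  · intro c hc
    obtain ⟨γ, rfl⟩ := Quotient.exists_rep c
    have hγ := hc γ rfl
    obtain ⟨-, y, hy, e⟩ := id hγ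
    obtain ⟨b, hb⟩ := Hecke.exists_dualSeq hq3 hy
    obtain ⟨n, A, hA, h⟩ := Hecke.exists_reduced hq3 hγ e hb
    refine ⟨_, h, Quotient.sound ?_⟩
    exact ⟨⟨A * Hecke.reductionWord q b n,
      mul_mem (Hecke.finalMaps_subset hA) (Hecke.reductionWord_mem q b n)⟩, rfl⟩
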